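/- **Model.** UAVs form a homogeneous Poisson point process of density $\lambda>0$ in the plane $\mathbb R^2$, at altitude $h_v\ge 0$; the typical base station (BS) is at the origin, at altitude $h_b\ge0$. Put $\Delta h=|h_v-h_b|$ and list the UAVs as $v_1,v_2,\dots$ with $r_n=\|v_n\|$, $r_1<r_2<\cdots$. Let $\beta_a,\beta_b,\varepsilon>0$, $\rho=\sqrt{\beta_a\beta_b}$, $\gamma(r)=\lfloor r\rho\rfloor$. Independently for each UAV, given the locations, the link to a UAV at horizontal distance $r$ is in state $\kappa=L$ (LOS) with probability $p_L(\gamma(r))$ and in state $\kappa=N$ (NLOS) with probability $p_N=1-p_L$, where $p_L(0)=1$ and, for $\gamma\ge1$, $$p_L(\gamma)=\prod_{n=0}^{\gamma}\Big(1-\exp\Big(-\frac{(\gamma\max(h_v,h_b)-(n+\frac12)\Delta h)^2}{2\varepsilon^2\gamma^2}\Big)\Big).$$ A link in state $\kappa$ has path loss $C_\kappa(r^2+\Delta h^2)^{-\alpha_\kappa/2}$, where $C_\kappa>0$, $\alpha_L\ge2$, $\alpha_N>2$, and fading power gain $g$ with the Gamma distribution of shape $\mathcal N_\kappa\in\{1,2,\dots\}$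 and mean $1$. Transmitter and receiver ($c=t,r$) have beamwidths $\theta_c^a\in[0,2\pi]$, $\theta_c^e\in[0,\pi]$, main lobe gain $M_c>0$ and side lobe gain $m_c\ge0$; with $q_c=\frac{\theta_c^a}{2\pi}\frac{\theta_c^e}{\pi}$, the directivity gain $G$ of an interfering link equals $o_1=M_tM_r$, $o_2=m_tM_r$, $o_3=M_tm_r$, $o_4=m_tm_r$ with probabilities $p_1=q_tq_r$, $p_2=(1-q_t)q_r$, $p_3=q_t(1-q_r)$, $p_4=(1-q_t)(1-q_r)$; the desired link has gain $o_1$. Fading and antenna gains are independent of each other, across UAVs, and of the locations and link states (except that the fading law depends on the state). The BS is served by the nearest UAV $v_1$; with transmit power $P_v>0$ and noise power $n_0^2>0$, $$\Upsilon_{down}=\frac{C_{\kappa_1}(r_1^2+\Delta h^2)^{-\alpha_{\kappa_1}/2}\,o_1\,g_1}{I+n_0^2/P_v},\qquad I=\sum_{n\ge2}C_{\kappa_n}(r_n^2+\Delta h^2)^{-\alpha_{\kappa_n}/2}\,G_n\,g_n,$$ and $P_{down}(\Upsilon)=\mathbb P[\Upsilon_{down}>\Upsilon]$ for $\Upsilon>0$.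 **The closed form.** Let $f_n(r)=2\pi\lambda r e^{-\pi\lambda r^2}$, $\eta_\kappa=\mathcal N_\kappa(\mathcal N_\kappa!)^{-1/\mathcal N_\kappa}$, and $$\mathcal L_{down}(s|r_1)=\exp\Big(-2\pi\lambda\sum_{i=1}^4p_i\big(\Theta^L(s,o_i|r_1)+\Theta^N(s,o_i|r_1)\big)\Big),$$ $$\Theta^\kappa(s,o|r_1)=p_\kappa(\gamma)\,Z^\kappa\big(s,r_1,\tfrac{\gamma+1}\rho,o\big)+\sum_{j=\gamma+1}^\infty p_\kappa(j)\,Z^\kappa\big(s,\tfrac j\rho,\tfrac{j+1}\rho,o\big),\qquad\gamma=\gamma(r_1),$$ $$Z^\kappa(s,a,b,o)=\tfrac{a^2+\Delta h^2}2F^\kappa\Big(\tfrac{sC_\kappa o}{\mathcal N_\kappa(a^2+\Delta h^2)^{\alpha_\kappa/2}}\Big)-\tfrac{b^2+\Delta h^2}2F^\kappa\Big(\tfrac{sC_\kappa o}{\mathcal N_\kappa(b^2+\Delta h^2)^{\alpha_\kappa/2}}\Big),$$ where $F^\kappa(z)={}_2F_1\big(-\tfrac2{\alpha_\kappa},\mathcal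 N_\kappa;1-\tfrac2{\alpha_\kappa};-z\big)-1$ if $\alpha_\kappa>2$, and, if $\alpha_\kappa=2$, $$F^\kappa(z)=\sum_{c=1}^{\mathcal N_\kappa-1}\frac{z\mathcal N_\kappa}{(z+1)^{\mathcal N_\kappa-c}(\mathcal N_\kappa-c)}-\frac{(z+1)^{\mathcal N_\kappa-1}-1}{(z+1)^{\mathcal N_\kappa-1}}-z\mathcal N_\kappa\ln\Big(1+\frac1z\Big)$$ (with $F^\kappa(0)=0$). Put $$\Psi^\kappa_{down}(r_1,\Upsilon)=\sum_{n=1}^{\mathcal N_\kappa}(-1)^{n+1}\binom{\mathcal N_\kappa}n\exp\Big(-\frac{n\eta_\kappa\Upsilon n_0^2}{P_vo_1C_\kappa(r_1^2+\Delta h^2)^{-\alpha_\kappa/2}}\Big)\mathcal L_{down}\Big(\frac{n\eta_\kappa\Upsilon}{o_1C_\kappa(r_1^2+\Delta h^2)^{-\alpha_\kappa/2}}\Big|r_1\Big)f_n(r_1)$$ and, with the Gauss–Chebyshev nodes $\zeta_k=\cos\big(\frac{2k-1}{2m}\pi\big)$, $$Q_m(\Upsilon)=\frac{\pi}{2m\rho}\sum_{k=1}^m\sqrt{1-\zeta_k^2}\sum_{\gamma=0}^\infty\Big(p_L(\gamma)\Psi^L_{down}\big(\tfrac{\zeta_k+2\gamma+1}{2\rho},\Upsilon\big)+p_N(\gamma)\Psi^N_{down}\big(\tfrac{\zeta_k+2\gamma+1}{2\rho},\Upsilon\big)\Big).$$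 **Theorem.** Almost surely $I<\infty$, and all the series above converge. $Q_m(\Upsilon)$ approximates $P_{down}(\Upsilon)$ in the following sense. As $m\to\infty$, $Q_m(\Upsilon)$ converges to $$Q_\infty(\Upsilon)=\mathbb E\Big[1-\big(1-e^{-\eta_{\kappa_1}T}\big)^{\mathcal N_{\kappa_1}}\Big],\qquad T=\frac{\Upsilon(I+n_0^2/P_v)}{C_{\kappa_1}(r_1^2+\Delta h^2)^{-\alpha_{\kappa_1}/2}o_1},$$ which is the coverage probability with the Gamma distribution function of the desired link's fading replaced by Alzer's expression $(1-e^{-\eta_\kappa x})^{\mathcal N_\kappa}$. Moreover $P_{down}(\Upsilon)\le Q_\infty(\Upsilon)$, and $|P_{down}(\Upsilon)-Q_\infty(\Upsilon)|\le\delta$ whenever $\delta$ bounds the difference between the Gamma distribution function and Alzer's expression, for all $x\ge0$ and both $\kappa$. If $\mathcal N_L=\mathcal N_N=1$, then $Q_m(\Upsilon)\to P_{down}(\Upsilon)$. -/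

import Mathlib

open MeasureTheory ProbabilityTheory Filter Topology
open scoped ENNReal

noncomputable section

namespace UAV

/-- The two states of a link: line of sight, or non line of sight. -/
inductive Link where
  | LOS
  | NLOS

/-- The parameters of the downlink: density `lam` of the UAVs, altitudes `hv` of the UAVs and `hb`
of the base stations, obstacle parameters `βa`, `βb`, `ε`, intercepts `C κ`, path loss exponents
`α κ`, Nakagami parameters `N κ`, the sectorized antenna patterns of the transmitters and of the
receivers (beamwidths in azimuth and elevation, main and side lobe gain), transmit power `Pv` of
the UAVs and noise power `noise` (that is `n₀²`). -/
structure Params where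
  lam : ℝ
  hv : ℝ
  hb : ℝ
  βa : ℝ
  βb : ℝ
  ε : ℝ
  C : Link → ℝ
  α : Link → ℝ
  N : Link → ℕ
  θta : ℝ
  θte : ℝ
  θra : ℝ
  θre : ℝ
  Mt : ℝ
  mt : ℝ
  Mr : ℝ
  mr : ℝ
  Pv : ℝ
  noise : ℝ
  lam_pos : 0 < lam
  hv_nonneg : 0 ≤ hv
  hb_nonneg : 0 ≤ hb
  βa_pos : 0 < βa
  βb_pos : 0 < βb
  ε_pos : 0 < ε
  C_pos : ∀ κ, 0 < C κ
  α_LOS : 2 ≤ α Link.LOS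
  α_NLOS : 2 < α Link.NLOS
  N_pos : ∀ κ, 1 ≤ N κ
  θta_mem : θta ∈ Set.Icc 0 (2 * Real.pi)
  θte_mem : θte ∈ Set.Icc 0 Real.pi
  θra_mem : θra ∈ Set.Icc 0 (2 * Real.pi)
  θre_mem : θre ∈ Set.Icc 0 Real.pi
  Mt_pos : 0 < Mt
  mt_nonneg : 0 ≤ mt
  Mr_pos : 0 < Mr
  mr_nonneg : 0 ≤ mr
  Pv_pos : 0 < Pv
  noise_pos : 0 < noise

namespace Params

variable (p : Params)

/-- The height difference `Δh_d`. -/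
def Δh : ℝ := |p.hv - p.hb|

/-- `√(β_a β_b)`. -/
def ρ : ℝ := Real.sqrt (p.βa * p.βb)

/-- The blockage level `γ(r) = ⌊r √(β_a β_b)⌋` at horizontal distance `r`. -/
def level (r : ℝ) : ℕ := ⌊r * p.ρ⌋₊

/-- The LOS probability at blockage level `γ`. At `γ = 0` the exponent of the only factor has the
denominator `γ² = 0` and is read as `-∞`: a link that meets no obstacle is LOS. -/
def pLOS (γ : ℕ) : ℝ :=
  if γ = 0 then 1
  else ∏ n ∈ Finset.range (γ + 1),
    (1 - Real.exp (-((γ * max p.hv p.hb - (n + 1 / 2) * |p.hv - p.hb|) ^ 2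
      / (2 * p.ε ^ 2 * γ ^ 2))))

/-- The probabilities `p_L(γ)` and `p_N(γ) = 1 - p_L(γ)`. -/
def prob : Link → ℕ → ℝ
  | Link.LOS, γ => p.pLOS γ
  | Link.NLOS, γ => 1 - p.pLOS γ

/-- The path loss of a link of state `κ` over the horizontal distance `r`. -/
def pathLoss (κ : Link) (r : ℝ) : ℝ :=
  p.C κ / Real.sqrt ((r ^ 2 + p.Δh ^ 2) ^ p.α κ)

/-- Main lobe probability of the transmitter. -/
def qt : ℝ := p.θta / (2 * Real.pi) * (p.θte / Real.pi)

/-- Main lobe probability of the receiver. -/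
def qr : ℝ := p.θra / (2 * Real.pi) * (p.θre / Real.pi)

/-- The four values of the directivity gain; `gain 0` is the maximal gain `G₀` (called `o₁`). -/
def gain : Fin 4 → ℝ := ![p.Mt * p.Mr, p.mt * p.Mr, p.Mt * p.mr, p.mt * p.mr]

/-- The probabilities of the four values of the directivity gain. -/
def gainProb : Fin 4 → ℝ :=
  ![p.qt * p.qr, (1 - p.qt) * p.qr, p.qt * (1 - p.qr), (1 - p.qt) * (1 - p.qr)]

/-- The law of the gain pattern of an interferer. -/
def gainLaw : Measure (Fin 4) :=
  ∑ i, ENNReal.ofReal (p.gainProb i) • Measure.dirac i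

/-- The law of the power gain `|ĥ|²` of Nakagami fading: Gamma of shape `N κ` and mean one. -/
def fadingLaw (κ : Link) : Measure ℝ := gammaMeasure (p.N κ) (p.N κ)

end Params

/-- The marks of a UAV: a uniform variable `u` that decides the link state (`u ≤ p_L` realizes the
Bernoulli variable of parameter `p_L`), the antenna pattern, and the fading power gains that apply
in the LOS and in the NLOS state. -/
abbrev Mark : Type := ℝ × Fin 4 × ℝ × ℝ

/-- The law of the marks: the four components are independent. -/
def Params.markLaw (p : Params) : Measure Mark :=
  (volume.restrict (Set.Icc (0 : ℝ) 1)).prod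
    (p.gainLaw.prod ((p.fadingLaw Link.LOS).prod (p.fadingLaw Link.NLOS)))

/-- The fading power gain that applies in state `κ`. -/
def Mark.fading (x : Mark) : Link → ℝ
  | Link.LOS => x.2.2.1
  | Link.NLOS => x.2.2.2

/-- The horizontal plane. -/
abbrev Plane : Type := EuclideanSpace ℝ (Fin 2)

/-- The random points `v 0, v 1, …` form a homogeneous Poisson point process of density `lam`:
the number of points in a Borel set of finite area is Poisson with mean `lam` times the area, and
the numbers of points in disjoint sets are independent. -/
structure IsPPP {Ω : Type*} [MeasurableSpace Ω] (P : Measure Ω) (v : ℕ → Ω → Plane)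
    (lam : ℝ) : Prop where
  measurable : ∀ n, Measurable (v n)
  poisson : ∀ A : Set Plane, MeasurableSet A → volume A < ∞ → ∀ k : ℕ,
    P {ω | {n | v n ω ∈ A}.encard = k} =
      ENNReal.ofReal (Real.exp (-(lam * volume.real A)) * (lam * volume.real A) ^ k / k.factorial)
  indep : ∀ (l : ℕ) (A : Fin l → Set Plane), (∀ i, MeasurableSet (A i)) →
    (∀ i, volume (A i) < ∞) → Pairwise (fun i j => Disjoint (A i) (A j)) →
    iIndepFun (fun i ω => {n | v n ω ∈ A i}.encard) P

/-- The downlink network seen from the typical base station, which is at the origin: the UAVs are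
a Poisson point process, listed by increasing horizontal distance (so that `v 0` is the nearest
one), and carry independent marks of law `p.markLaw`, independent of the locations. -/
structure IsNetwork {Ω : Type*} [MeasurableSpace Ω] (P : Measure Ω) (p : Params)
    (v : ℕ → Ω → Plane) (mark : ℕ → Ω → Mark) : Prop where
  ppp : IsPPP P v p.lam
  ranked : ∀ᵐ ω ∂P, StrictMono (fun n => ‖v n ω‖)
  mark_measurable : ∀ n, Measurable (mark n)
  mark_law : ∀ n, P.map (mark n) = p.markLaw
  mark_indep : iIndepFun mark P
  indep : IndepFun (fun ω n => v n ω) (fun ω n => mark n ω) P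

namespace Params

variable (p : Params)

open Classical in
/-- The state of the link between the typical base station and a UAV at `x` with mark `z`. -/
def state (x : Plane) (z : Mark) : Link :=
  if z.1 ≤ p.pLOS (p.level ‖x‖) then Link.LOS else Link.NLOS

/-- The channel gain of an interfering UAV at `x` with mark `z`. -/
def channelGain (x : Plane) (z : Mark) : ℝ :=
  p.pathLoss (p.state x z) ‖x‖ * p.gain z.2.1 * z.fading (p.state x z)

/-- The channel gain of the desired link, whose antennas are aligned. -/
def desiredGain (x : Plane) (z : Mark) : ℝ :=
  p.pathLoss (p.state x z) ‖x‖ * p.gain 0 * z.fading (p.state x z)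

section Network

variable {Ω : Type*} (v : ℕ → Ω → Plane) (mark : ℕ → Ω → Mark)

/-- The interference: all UAVs but the nearest one. -/
def interference (ω : Ω) : ℝ≥0∞ :=
  ∑' n : ℕ, ENNReal.ofReal (p.channelGain (v (n + 1) ω) (mark (n + 1) ω))

/-- The received SINR at the typical base station. -/
def sinr (ω : Ω) : ℝ≥0∞ :=
  ENNReal.ofReal (p.desiredGain (v 0 ω) (mark 0 ω)) /
    (p.interference v mark ω + ENNReal.ofReal (p.noise / p.Pv))

/-- The coverage probability `P_down(Υ)`. -/
def coverage [MeasurableSpace Ω] (P : Measure Ω) (Υ : ℝ) : ℝ :=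
  P.real {ω | ENNReal.ofReal Υ < p.sinr v mark ω}

/-- The constant `η_κ = N_κ (N_κ !)^(-1 / N_κ)`. -/
def η (κ : Link) : ℝ := p.N κ * ((p.N κ).factorial : ℝ) ^ (-1 / (p.N κ : ℝ))

/-- Alzer's expression `(1 - e^{-η x})^N`, which approximates the distribution function of the
fading power gain. -/
def alzer (κ : Link) (x : ℝ) : ℝ := (1 - Real.exp (-(p.η κ * x))) ^ p.N κ

/-- The value that the fading power gain of the desired link has to exceed for coverage. -/
def required (Υ : ℝ) (ω : Ω) : ℝ :=
  Υ * ((p.interference v mark ω).toReal + p.noise / p.Pv) /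
    (p.pathLoss (p.state (v 0 ω) (mark 0 ω)) ‖v 0 ω‖ * p.gain 0)

/-- `1 - (1 - e^{-η x})^N` at the required value `x` of the fading power gain. -/
def alzerTail (Υ : ℝ) (ω : Ω) : ℝ :=
  1 - p.alzer (p.state (v 0 ω) (mark 0 ω)) (p.required v mark Υ ω)

/-- The coverage probability when the distribution function of the fading power gain of the
desired link is replaced by Alzer's expression. -/
def alzerCoverage [MeasurableSpace Ω] (P : Measure Ω) (Υ : ℝ) : ℝ :=
  ∫ ω, p.alzerTail v mark Υ ω ∂P

end Network

/-- The density of the distance to the nearest UAV. -/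
def nearestPDF (r : ℝ) : ℝ :=
  2 * Real.pi * p.lam * r * Real.exp (-(Real.pi * p.lam * r ^ 2))

end Params

/-- The Gauss hypergeometric function `₂F₁(a, b; c; x)` at real `x ≤ 0`: the Gauss series in the
disc of convergence, and its analytic continuation by Pfaff's transformation, whose argument
`x / (x - 1)` is in `[0, 1)`, outside. -/
def gaussHyp (a b c x : ℝ) : ℝ :=
  if |x| < 1 then ordinaryHypergeometric a b c x
  else (1 - x) ^ (-b) * ordinaryHypergeometric (c - a) b c (x / (x - 1))

/-- The function `F^κ_α` for `α = 2`. -/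
def F2 (N : ℕ) (z : ℝ) : ℝ :=
  ∑ c ∈ Finset.Icc 1 (N - 1), z * N / ((z + 1) ^ (N - c) * ((N : ℝ) - c))
    - ((z + 1) ^ (N - 1) - 1) / (z + 1) ^ (N - 1)
    - z * N * Real.log (1 + 1 / z)

namespace Params

variable (p : Params)

open Classical in
/-- The function `F^κ_{α_κ}`. -/
def F (κ : Link) (z : ℝ) : ℝ :=
  if p.α κ = 2 then F2 (p.N κ) z
  else gaussHyp (-2 / p.α κ) (p.N κ) (1 - 2 / p.α κ) (-z) - 1

/-- `Z^κ(s, a, b, G)`. -/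
def Z (κ : Link) (s a b G : ℝ) : ℝ :=
  (a ^ 2 + p.Δh ^ 2) / 2
      * p.F κ (s * p.C κ * G / (p.N κ * (a ^ 2 + p.Δh ^ 2) ^ (p.α κ / 2)))
    - (b ^ 2 + p.Δh ^ 2) / 2
      * p.F κ (s * p.C κ * G / (p.N κ * (b ^ 2 + p.Δh ^ 2) ^ (p.α κ / 2)))

/-- The contribution `p_κ(j) Z^κ(s, j / √(β_a β_b), (j + 1) / √(β_a β_b), o_i)` of level `j`. -/
def ringTerm (κ : Link) (s : ℝ) (i : Fin 4) (j : ℕ) : ℝ :=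
  p.prob κ j * p.Z κ s (j / p.ρ) ((j + 1) / p.ρ) (p.gain i)

/-- `Θ^κ(s, o_i | r₁)`. -/
def Θ (κ : Link) (s : ℝ) (i : Fin 4) (r₁ : ℝ) : ℝ :=
  p.prob κ (p.level r₁) * p.Z κ s r₁ ((p.level r₁ + 1) / p.ρ) (p.gain i)
    + ∑' j : ℕ, p.ringTerm κ s i (p.level r₁ + 1 + j)

/-- The Laplace transform of the interference conditional on `r₁`, in closed form. -/
def laplace (s r₁ : ℝ) : ℝ :=
  Real.exp (-(2 * Real.pi * p.lam
    * ∑ i, p.gainProb i * (p.Θ Link.LOS s i r₁ + p.Θ Link.NLOS s i r₁)))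

/-- `Ψ^κ_down(r₁, Υ)`. -/
def Ψ (κ : Link) (r₁ Υ : ℝ) : ℝ :=
  ∑ n ∈ Finset.Icc 1 (p.N κ), (-1 : ℝ) ^ (n + 1) * (p.N κ).choose n
    * Real.exp (-(n * p.η κ * Υ * p.noise
        / (p.Pv * p.gain 0 * p.C κ * (r₁ ^ 2 + p.Δh ^ 2) ^ (-(p.α κ / 2)))))
    * p.laplace (n * p.η κ * Υ / (p.gain 0 * p.C κ * (r₁ ^ 2 + p.Δh ^ 2) ^ (-(p.α κ / 2)))) r₁
    * p.nearestPDF r₁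

/-- The term of blockage level `γ` at the node `ζ`. -/
def levelTerm (Υ ζ : ℝ) (γ : ℕ) : ℝ :=
  p.prob Link.LOS γ * p.Ψ Link.LOS ((ζ + 2 * γ + 1) / (2 * p.ρ)) Υ
    + p.prob Link.NLOS γ * p.Ψ Link.NLOS ((ζ + 2 * γ + 1) / (2 * p.ρ)) Υ

end Params

/-- The Gauss–Chebyshev nodes `cos ((2k - 1) π / (2m))`, `k = 1, …, m`. -/
def node (m k : ℕ) : ℝ := Real.cos ((2 * (k : ℝ) - 1) / (2 * m) * Real.pi)

/-- The quadrature expression for the coverage probability, with `m` nodes. -/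
def Params.quadrature (p : Params) (Υ : ℝ) (m : ℕ) : ℝ :=
  Real.pi / (2 * m * p.ρ)
    * ∑ k ∈ Finset.Icc 1 m, Real.sqrt (1 - node m k ^ 2)
      * ∑' γ : ℕ, p.levelTerm Υ (node m k) γ

end UAV

end

noncomputable section

namespace UAV

/-!
Alzer's tail `1 - (1 - e^{-ηT})^N` is a polynomial in `e^{-ηT}`, so its expectation is a
combination of Laplace transforms of the interference, at arguments that depend on the distance
`r₁` of the serving UAV. Given `r₁`, the other UAVs form a Poisson process outside the disc of
radius `r₁`. Infinite weight on an open disc turns the Laplace functional of the Poisson process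
into an expectation over the event that the disc is empty, so this functional already determines
the joint law of `r₁` and the interference. That the argument of the Laplace transform depends on
`r₁` is dealt with by discretizing it.

The Laplace transform is thus the exponential of a planar integral of the loss caused by one
interferer. The blockage level is constant on each ring `j ≤ rρ < j + 1`, and there `Z` is the
integral, because `z F' = (2 / α) (F + 1 - (1 + z)^{-N})`; for `α > 2` this equation comes from
Pfaff's transformation of `₂F₁`. Folding all the rings onto `[-1, 1]` turns the integral of the
resulting density over `r₁` into one whose Gauss-Chebyshev sum is `Q_m`; in the variable
`ζ = cos θ` that sum is a midpoint rule, which converges for continuous bounded integrands.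

The upper bound is Alzer's inequality: the Gamma distribution function minus Alzer's expression
vanishes at `0` and `∞`, and once its derivative is negative it never becomes positive again.
-/

/-! ### The hypergeometric function -/

section PowerSeries

open FormalMultilinearSeries

variable {𝕜 : Type*} [NontriviallyNormedField 𝕜] [CompleteSpace 𝕜] {a : ℕ → 𝕜} {x : 𝕜}

lemma hasSum_ofScalars_sum (hx : ‖x‖ₑ < (ofScalars 𝕜 a).radius) :
    HasSum (fun n => a n * x ^ n) ((ofScalars 𝕜 a).sum x) := by
  have hball := (ofScalars 𝕜 a).hasFPowerSeriesOnBall hx.pos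
  simpa [ofScalars_apply_eq, mul_comm] using hball.hasSum (mem_eball_zero_iff.2 hx)

lemma differentiableAt_ofScalars_sum (hx : ‖x‖ₑ < (ofScalars 𝕜 a).radius) :
    DifferentiableAt 𝕜 (ofScalars 𝕜 a).sum x :=
  ((ofScalars 𝕜 a).hasFPowerSeriesOnBall hx.pos).differentiableOn.differentiableAt
    (Metric.isOpen_eball.mem_nhds (mem_eball_zero_iff.2 hx))

lemma hasSum_natCast_mul_ofScalars (hx : ‖x‖ₑ < (ofScalars 𝕜 a).radius) :
    HasSum (fun n : ℕ => n * (a n * x ^ n)) (x * deriv (ofScalars 𝕜 a).sum x) := by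
  have hball := (ofScalars 𝕜 a).hasFPowerSeriesOnBall hx.pos
  have hfderiv : HasSum (fun n => (ofScalars 𝕜 a).derivSeries n (fun _ => x) x)
      (fderiv 𝕜 (ofScalars 𝕜 a).sum (0 + x) x) :=
    (hball.fderiv.hasSum (mem_eball_zero_iff.2 hx)).mapL (ContinuousLinearMap.apply 𝕜 𝕜 x)
  rw [zero_add, ← mul_one x, ← smul_eq_mul, map_smul, fderiv_apply_one_eq_deriv, smul_eq_mul,
    smul_eq_mul, mul_one] at hfderiv
  simp only [derivSeries_apply_diag] at hfderiv
  rw [← hasSum_nat_add_iff' 1]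
  simpa [ofScalars_apply_eq, mul_comm] using hfderiv

end PowerSeries

section Hypergeometric

variable {a b : ℝ}

lemma hasSum_ascPochhammer_mul_pow (b : ℝ) {x : ℝ} (hx : |x| < 1) :
    HasSum (fun n : ℕ => (n.factorial : ℝ)⁻¹ * (ascPochhammer ℝ n).eval b * x ^ n)
      ((1 - x) ^ (-b)) := by
  have hpoch (n : ℕ) : (ascPochhammer ℝ n).eval 1 ≠ 0 := (ascPochhammer_pos n 1 one_pos).ne'
  have hmem : -x ∈ Metric.eball (0 : ℝ) 1 := by
    simpa [edist_dist, Real.dist_eq, ENNReal.ofReal_lt_one] using hx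
  have hbin := (Real.one_add_rpow_hasFPowerSeriesOnBall_zero (a := -b)).hasSum hmem
  rw [binomialSeries_eq_ordinaryHypergeometricSeries (b := 1)
    (fun k h => by have : (0 : ℝ) ≤ k := k.cast_nonneg; linarith), zero_add,
    ← sub_eq_add_neg] at hbin
  refine hbin.congr_fun fun n => ?_
  rw [FormalMultilinearSeries.compContinuousLinearMap_apply]
  simp only [Function.comp_def, neg_apply, ContinuousLinearMap.id_apply,
    neg_neg]
  rw [ordinaryHypergeometricSeries_apply_eq, mul_inv_cancel_right₀ (hpoch n), smul_eq_mul]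

lemma enorm_lt_ordinaryHypergeometricSeries_radius {a b c x : ℝ} (ha : ∀ k : ℕ, (k : ℝ) ≠ -a)
    (hb : 0 < b) (hc : 0 < c) (hx : |x| < 1) :
    ‖x‖ₑ < (ordinaryHypergeometricSeries ℝ a b c).radius := by
  rw [ordinaryHypergeometricSeries_radius_eq_one ℝ a b c fun k => ?_, ← ofReal_norm,
    Real.norm_eq_abs, ENNReal.ofReal_lt_one]
  · exact hx
  · have : (0 : ℝ) ≤ k := k.cast_nonneg
    exact ⟨ha k, by linarith, by linarith⟩

lemma ascPochhammer_eval_mul_add (a : ℝ) (n : ℕ) :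
    (ascPochhammer ℝ n).eval a * (a + n) = a * (ascPochhammer ℝ n).eval (1 + a) := by
  rw [← ascPochhammer_succ_eval, ascPochhammer_succ_left, Polynomial.eval_mul,
    Polynomial.eval_comp]
  simp [add_comm]

lemma natCast_ne_neg (ha : -1 < a) (ha₀ : a ≠ 0) (k : ℕ) : (k : ℝ) ≠ -a := by
  rcases k.eq_zero_or_pos with rfl | hk
  · simpa [eq_comm] using ha₀
  · have : (1 : ℝ) ≤ k := by exact_mod_cast hk
    linarith

lemma differentiableAt_gaussSeries (ha : -1 < a) (ha₀ : a ≠ 0) (hb : 0 < b) {x : ℝ}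
    (hx : |x| < 1) : DifferentiableAt ℝ (ordinaryHypergeometric a b (1 + a)) x :=
  differentiableAt_ofScalars_sum
    (enorm_lt_ordinaryHypergeometricSeries_radius (natCast_ne_neg ha ha₀) hb (by linarith) hx)

lemma mul_deriv_gaussSeries (ha : -1 < a) (ha₀ : a ≠ 0) (hb : 0 < b) {x : ℝ} (hx : |x| < 1) :
    x * deriv (ordinaryHypergeometric a b (1 + a)) x
      = a * ((1 - x) ^ (-b) - ordinaryHypergeometric a b (1 + a) x) := by
  have hrad := enorm_lt_ordinaryHypergeometricSeries_radius (c := 1 + a)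
    (natCast_ne_neg ha ha₀) hb (by linarith) hx
  have hcoeff (n : ℕ) : a * ((n.factorial : ℝ)⁻¹ * (ascPochhammer ℝ n).eval b * x ^ n)
      = a * (ordinaryHypergeometricCoefficient a b (1 + a) n * x ^ n)
        + n * (ordinaryHypergeometricCoefficient a b (1 + a) n * x ^ n) := by
    have hpoch : (ascPochhammer ℝ n).eval (1 + a) ≠ 0 :=
      (ascPochhammer_pos n _ (by linarith)).ne'
    unfold ordinaryHypergeometricCoefficient
    field_simp
    linear_combination -(ascPochhammer ℝ n).eval b * x ^ n * ascPochhammer_eval_mul_add a n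
  have hsum := ((hasSum_ofScalars_sum hrad).mul_left a).add (hasSum_natCast_mul_ofScalars hrad)
  simp only [← hcoeff] at hsum
  have hode := hsum.unique ((hasSum_ascPochhammer_mul_pow b hx).mul_left a)
  change a * ordinaryHypergeometric a b (1 + a) x
    + x * deriv (ordinaryHypergeometric a b (1 + a)) x = _ at hode
  linear_combination hode

lemma differentiableAt_pfaffSeries (ha : -1 < a) (hb : 0 < b) {x : ℝ} (hx : |x| < 1) :
    DifferentiableAt ℝ (ordinaryHypergeometric 1 b (1 + a)) x :=
  differentiableAt_ofScalars_sum (enorm_lt_ordinaryHypergeometricSeries_radius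
    (natCast_ne_neg (by norm_num) one_ne_zero) hb (by linarith) hx)

lemma mul_deriv_pfaffSeries (ha : -1 < a) (hb : 0 < b) {x : ℝ} (hx : |x| < 1) :
    x * (1 - x) * deriv (ordinaryHypergeometric 1 b (1 + a)) x
      = (b * x - a) * ordinaryHypergeometric 1 b (1 + a) x + a := by
  have hrad := enorm_lt_ordinaryHypergeometricSeries_radius (c := 1 + a)
    (natCast_ne_neg (a := 1) (by norm_num) one_ne_zero) hb (by linarith) hx
  have hsum := hasSum_ofScalars_sum hrad
  have hsum' := hasSum_natCast_mul_ofScalars hrad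
  have hshift := (hasSum_nat_add_iff' 1).2 (hsum'.add (hsum.mul_left a))
  have hcoeff (n : ℕ) : ((n + 1 : ℕ) : ℝ)
        * (ordinaryHypergeometricCoefficient 1 b (1 + a) (n + 1) * x ^ (n + 1))
      + a * (ordinaryHypergeometricCoefficient 1 b (1 + a) (n + 1) * x ^ (n + 1))
      = x * (b * (ordinaryHypergeometricCoefficient 1 b (1 + a) n * x ^ n)
        + n * (ordinaryHypergeometricCoefficient 1 b (1 + a) n * x ^ n)) := by
    have hpoch : (ascPochhammer ℝ n).eval (1 + a) ≠ 0 :=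
      (ascPochhammer_pos n _ (by linarith)).ne'
    have hlast : 1 + a + n ≠ 0 := by
      have : (0 : ℝ) ≤ n := n.cast_nonneg
      linarith
    simp only [ordinaryHypergeometricCoefficient, ascPochhammer_eval_one, ascPochhammer_succ_eval,
      Nat.factorial_succ]
    push_cast
    field_simp
    ring
  simp only [hcoeff] at hshift
  have hode := hshift.unique (((hsum.mul_left b).add hsum').mul_left x)
  change x * deriv (ordinaryHypergeometric 1 b (1 + a)) x
    + a * ordinaryHypergeometric 1 b (1 + a) x - _
    = x * (b * ordinaryHypergeometric 1 b (1 + a) x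
      + x * deriv (ordinaryHypergeometric 1 b (1 + a)) x) at hode
  simp only [Finset.range_one, Finset.sum_singleton, CharP.cast_eq_zero, zero_add,
    ordinaryHypergeometricCoefficient, ascPochhammer_zero, Polynomial.eval_one, Nat.factorial_zero,
    Nat.cast_one, inv_one, mul_one, pow_zero] at hode
  linear_combination hode

/-- The right-hand side of Pfaff's transformation of `₂F₁(a, b; 1 + a; -z)`, which converges for
every `z ≥ 0`. -/
def pfaffHyp (a b z : ℝ) : ℝ :=
  (1 + z) ^ (-b) * ordinaryHypergeometric 1 b (1 + a) (z / (1 + z))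

lemma hasDerivAt_pfaffHyp (ha : -1 < a) (hb : 0 < b) {z : ℝ} (hz : 0 ≤ z) :
    ∃ d, HasDerivAt (pfaffHyp a b) d z ∧ z * d = a * ((1 + z) ^ (-b) - pfaffHyp a b z) := by
  have hz' : 0 < 1 + z := by positivity
  have hw : |z / (1 + z)| < 1 := by
    rw [abs_of_nonneg (by positivity), div_lt_one hz']; linarith
  have hdiv : HasDerivAt (fun z : ℝ => z / (1 + z)) (1 / (1 + z) ^ 2) z := by
    simpa using! (hasDerivAt_id z).div ((hasDerivAt_id z).const_add 1) hz'.ne'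
  have hpow : HasDerivAt (fun z : ℝ => (1 + z) ^ (-b)) (-b * (1 + z) ^ (-b - 1)) z := by
    simpa using! ((hasDerivAt_id z).const_add 1).rpow_const (p := -b) (Or.inl hz'.ne')
  refine ⟨_, hpow.mul ((differentiableAt_pfaffSeries ha hb hw).hasDerivAt.comp z hdiv), ?_⟩
  have hode := mul_deriv_pfaffSeries ha hb hw
  rw [pfaffHyp, Real.rpow_sub_one hz'.ne']
  field_simp at hode ⊢
  linear_combination hode

/-- The equation `z y' = c y` has the solutions `y = C z ^ c`, and for `c < 1` only `C = 0` makes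
`y` differentiable at `0`. -/
lemma eq_zero_of_mul_deriv_eq_mul {D : ℝ → ℝ} {c R : ℝ} (hc : c < 1) (hD₀ : D 0 = 0)
    (hD : ∀ y ∈ Set.Ico 0 R, ∃ d, HasDerivAt D d y ∧ y * d = c * D y) {z : ℝ}
    (hz : z ∈ Set.Ico 0 R) : D z = 0 := by
  rcases hz.1.eq_or_lt with rfl | hz₀
  · exact hD₀
  have hderiv : ∀ y ∈ Set.Ioo 0 R, HasDerivAt (fun y => D y * y ^ (-c)) 0 y := by
    intro y hy
    obtain ⟨d, hd, hode⟩ := hD y ⟨hy.1.le, hy.2⟩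
    refine (hd.mul (Real.hasDerivAt_rpow_const (p := -c) (Or.inl hy.1.ne'))).congr_deriv ?_
    rw [Real.rpow_sub_one hy.1.ne']
    have := hy.1.ne'
    field_simp
    linear_combination y ^ (-c) * hode
  have hconst : ∀ y ∈ Set.Ioo 0 R, D y * y ^ (-c) = D z * z ^ (-c) := fun y hy =>
    isOpen_Ioo.is_const_of_deriv_eq_zero isPreconnected_Ioo
      (fun x hx => (hderiv x hx).differentiableAt.differentiableWithinAt)
      (fun x hx => (hderiv x hx).deriv) hy ⟨hz₀, hz.2⟩
  have hlim : Tendsto (fun y => D y * y ^ (-c)) (𝓝[>] 0) (𝓝 0) := by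
    obtain ⟨d, hd, -⟩ := hD 0 ⟨le_rfl, hz₀.trans hz.2⟩
    have hslope := (hasDerivAt_iff_tendsto_slope_zero.1 hd).mono_left
      (nhdsWithin_mono 0 fun x (hx : 0 < x) => hx.ne')
    have hpow : Tendsto (fun y : ℝ => y ^ (1 - c)) (𝓝[>] 0) (𝓝 0) := by
      have hcont := (Real.continuousAt_rpow_const 0 (1 - c) (Or.inr (by linarith))).tendsto
      rw [Real.zero_rpow (by linarith)] at hcont
      exact hcont.mono_left nhdsWithin_le_nhds
    refine (mul_zero d ▸ hslope.mul hpow).congr' ?_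
    filter_upwards [self_mem_nhdsWithin] with y (hy : 0 < y)
    rw [zero_add, hD₀, sub_zero, smul_eq_mul, sub_eq_add_neg, Real.rpow_add hy, Real.rpow_one]
    field_simp
  have hzero : D z * z ^ (-c) = 0 :=
    tendsto_nhds_unique (tendsto_const_nhds.congr' <| by
      filter_upwards [Ioo_mem_nhdsGT (hz₀.trans hz.2)] with y hy using (hconst y hy).symm) hlim
  exact (mul_eq_zero.1 hzero).resolve_right (Real.rpow_pos_of_pos hz₀ _).ne'

lemma ordinaryHypergeometric_neg_eq_pfaffHyp (ha : -1 < a) (ha₀ : a ≠ 0) (hb : 0 < b) {z : ℝ}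
    (hz : z ∈ Set.Ico 0 1) : ordinaryHypergeometric a b (1 + a) (-z) = pfaffHyp a b z := by
  refine sub_eq_zero.1 (eq_zero_of_mul_deriv_eq_mul (c := -a) (R := 1)
    (D := fun z => ordinaryHypergeometric a b (1 + a) (-z) - pfaffHyp a b z)
    (by linarith) (by simp [pfaffHyp]) (fun y hy => ?_) hz)
  have hy' : |-y| < 1 := by rw [abs_neg, abs_of_nonneg hy.1]; exact hy.2
  have hd := (differentiableAt_gaussSeries ha ha₀ hb hy').hasDerivAt.comp y (hasDerivAt_neg y)
  obtain ⟨d', hd', hode'⟩ := hasDerivAt_pfaffHyp ha hb hy.1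
  refine ⟨_, hd.sub hd', ?_⟩
  have hode := mul_deriv_gaussSeries ha ha₀ hb hy'
  rw [sub_neg_eq_add] at hode
  linear_combination hode - hode'

lemma gaussHyp_neg_eq_pfaffHyp (ha : -1 < a) (ha₀ : a ≠ 0) (hb : 0 < b) {z : ℝ} (hz : 0 ≤ z) :
    gaussHyp a b (1 + a) (-z) = pfaffHyp a b z := by
  unfold gaussHyp
  split_ifs with h
  · rw [abs_neg, abs_of_nonneg hz] at h
    exact ordinaryHypergeometric_neg_eq_pfaffHyp ha ha₀ hb ⟨hz, h⟩
  · rw [pfaffHyp, sub_neg_eq_add, add_sub_cancel_right, ← neg_add', neg_div_neg_eq, add_comm z]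

lemma hasDerivAt_gaussHyp_neg (ha : -1 < a) (ha₀ : a ≠ 0) (hb : 0 < b) {z : ℝ} (hz : 0 < z) :
    HasDerivAt (fun z => gaussHyp a b (1 + a) (-z))
      (a * ((1 + z) ^ (-b) - gaussHyp a b (1 + a) (-z)) / z) z := by
  obtain ⟨d, hd, hode⟩ := hasDerivAt_pfaffHyp ha hb hz.le
  rw [gaussHyp_neg_eq_pfaffHyp ha ha₀ hb hz.le, ← hode, mul_div_cancel_left₀ _ hz.ne']
  refine hd.congr_of_eventuallyEq ?_
  filter_upwards [lt_mem_nhds hz] with y hy using gaussHyp_neg_eq_pfaffHyp ha ha₀ hb hy.le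

end Hypergeometric

section F2

variable {z : ℝ}

lemma F2_succ_div_self (m : ℕ) (hz : 0 < z) :
    F2 (m + 1) z / z = ∑ k ∈ Finset.range m, (m + 1) / (k + 1) * ((z + 1) ^ (k + 1))⁻¹
      - (1 - ((z + 1) ^ m)⁻¹) / z - (m + 1) * Real.log (1 + 1 / z) := by
  have hsum : ∑ c ∈ Finset.Icc 1 (m + 1 - 1),
        z * ((m + 1 : ℕ) : ℝ) / ((z + 1) ^ (m + 1 - c) * (((m + 1 : ℕ) : ℝ) - c))
      = z * ∑ k ∈ Finset.range m, (m + 1) / (k + 1) * ((z + 1) ^ (k + 1))⁻¹ := by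
    rw [Finset.mul_sum]
    refine Finset.sum_nbij' (fun c => m - c) (fun k => m - k) ?_ ?_ ?_ ?_ fun c hc => ?_
    iterate 4 simp only [Finset.mem_Icc, Finset.mem_range]; omega
    obtain ⟨-, hc⟩ := Finset.mem_Icc.1 hc
    rw [Nat.cast_sub (by omega : c ≤ m), show m + 1 - c = m - c + 1 by omega]
    push_cast
    rw [show (m : ℝ) + 1 - c = m - c + 1 by ring, div_mul_eq_div_div_swap]
    ring
  rw [F2, hsum]
  push_cast
  field_simp

lemma sum_inv_pow_add_two (m : ℕ) (hz : 0 < z) :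
    ∑ k ∈ Finset.range m, ((z + 1) ^ (k + 2))⁻¹
      = ((z + 1)⁻¹ - ((z + 1) ^ (m + 1))⁻¹) / z := by
  induction m with
  | zero => simp
  | succ m ih =>
    rw [Finset.sum_range_succ, ih]
    field_simp
    ring

lemma hasDerivAt_inv_add_one_pow (m : ℕ) (hz : 0 < z) :
    HasDerivAt (fun z : ℝ => ((z + 1) ^ m)⁻¹) (-m * ((z + 1) ^ (m + 1))⁻¹) z := by
  have hpow : (z + 1) ^ m ≠ 0 := pow_ne_zero m (by positivity)
  refine ((((hasDerivAt_id z).add_const 1).pow m).inv hpow).congr_deriv ?_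
  rcases m with _ | m
  · simp
  · simp only [id, Pi.pow_apply, Nat.add_sub_cancel]
    field_simp
    ring

lemma hasDerivAt_log_one_add_one_div (hz : 0 < z) :
    HasDerivAt (fun z : ℝ => Real.log (1 + 1 / z)) (-(z * (z + 1))⁻¹) z := by
  have hinv : HasDerivAt (fun z : ℝ => 1 + 1 / z) (-(z ^ 2)⁻¹) z := by
    simpa only [one_div] using (hasDerivAt_inv hz.ne').const_add 1
  refine (hinv.log (by positivity)).congr_deriv ?_
  field_simp

lemma hasDerivAt_F2_div_self {N : ℕ} (hN : 1 ≤ N) (hz : 0 < z) :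
    HasDerivAt (fun z => F2 N z / z) ((1 - ((1 + z) ^ N)⁻¹) / z ^ 2) z := by
  obtain ⟨m, rfl⟩ := Nat.exists_eq_add_of_le' hN
  have hsum := HasDerivAt.fun_sum fun k (_ : k ∈ Finset.range m) =>
    (hasDerivAt_inv_add_one_pow (k + 1) hz).const_mul (((m : ℝ) + 1) / (k + 1))
  have hquot := ((hasDerivAt_inv_add_one_pow m hz).const_sub 1).div (hasDerivAt_id z) hz.ne'
  have hlog := (hasDerivAt_log_one_add_one_div hz).const_mul ((m : ℝ) + 1)
  refine (((hsum.sub hquot).sub hlog).congr_of_eventuallyEq ?_).congr_deriv ?_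
  · filter_upwards [lt_mem_nhds hz] with y hy using F2_succ_div_self m hy
  · have hgeom : ∑ k ∈ Finset.range m,
        ((m : ℝ) + 1) / (k + 1) * (-((k + 1 : ℕ) : ℝ) * ((z + 1) ^ (k + 1 + 1))⁻¹)
        = -(m + 1) * (((z + 1)⁻¹ - ((z + 1) ^ (m + 1))⁻¹) / z) := by
      rw [← sum_inv_pow_add_two m hz, Finset.mul_sum]
      refine Finset.sum_congr rfl fun k _ => ?_
      push_cast
      field_simp
    rw [hgeom, add_comm 1 z]
    simp only [id]
    field_simp
    ring

lemma hasDerivAt_F2 {N : ℕ} (hN : 1 ≤ N) (hz : 0 < z) :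
    HasDerivAt (F2 N) ((F2 N z + 1 - ((1 + z) ^ N)⁻¹) / z) z := by
  refine (((hasDerivAt_F2_div_self hN hz).mul (hasDerivAt_id z)).congr_of_eventuallyEq
    ?_).congr_deriv ?_
  · filter_upwards [lt_mem_nhds hz] with y hy using (div_mul_cancel₀ _ hy.ne').symm
  · simp only [id]
    field_simp
    ring

end F2

/-! ### Quadrature and integration -/

section Integrals

variable {E : Type*} [NormedAddCommGroup E] [NormedSpace ℝ E]

lemma hasSum_integral_adjacent_intervals {f : ℝ → E} {a : ℕ → ℝ} (ha : Monotone a)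
    (ha_top : Tendsto a atTop atTop) (hf : IntegrableOn f (Set.Ioi (a 0))) :
    HasSum (fun j => ∫ u in a j..a (j + 1), f u) (∫ u in Set.Ioi (a 0), f u) := by
  have hunion : ⋃ j, Set.Ioc (a j) (a (j + 1)) = Set.Ioi (a 0) :=
    iUnion_Ioc_map_succ_eq_Ioi (fun j => ha j.zero_le) (not_bddAbove_of_tendsto_atTop ha_top)
  have hsum := hasSum_integral_iUnion (μ := volume) (fun j => measurableSet_Ioc)
    ha.pairwise_disjoint_on_Ioc_succ (hunion.symm ▸ hf)
  simpa only [Nat.succ_eq_succ, Nat.succ_eq_add_one, hunion,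
    intervalIntegral.integral_of_le (ha (Nat.le_succ _))] using hsum

lemma tendsto_setIntegral_Ioi_of_dominated {ι : Type*} {l : Filter ι} [l.IsCountablyGenerated]
    {F : ι → ℝ → E} {f : ℝ → E} {bound : ℝ → ℝ} {a : ι → ℝ} {a₀ c : ℝ}
    (hF : ∀ i, AEStronglyMeasurable (F i) (volume.restrict (Set.Ioi c)))
    (hbound : ∀ᶠ i in l, ∀ u ∈ Set.Ioi c, ‖F i u‖ ≤ bound u)
    (hbound_int : IntegrableOn bound (Set.Ioi c))
    (hlim : ∀ u ∈ Set.Ioi c, Tendsto (fun i => F i u) l (𝓝 (f u)))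
    (ha : Tendsto a l (𝓝 a₀)) (hca : ∀ᶠ i in l, c ≤ a i) :
    Tendsto (fun i => ∫ u in Set.Ioi (a i), F i u) l (𝓝 (∫ u in Set.Ioi a₀, f u)) := by
  rcases l.eq_or_neBot with rfl | _
  · exact tendsto_bot
  have hset {g : ℝ → E} {y : ℝ} (hy : c ≤ y) :
      ∫ u in Set.Ioi c, (Set.Ioi y).indicator g u = ∫ u in Set.Ioi y, g u := by
    rw [setIntegral_indicator measurableSet_Ioi, Set.inter_eq_right.2 (Set.Ioi_subset_Ioi hy)]
  rw [← hset (ge_of_tendsto ha hca)]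
  refine Tendsto.congr' (hca.mono fun i hi => hset hi)
    (tendsto_integral_filter_of_dominated_convergence bound
      (Eventually.of_forall fun i => (hF i).indicator measurableSet_Ioi) ?_ hbound_int ?_)
  · filter_upwards [hbound] with i hi
    filter_upwards [ae_restrict_mem measurableSet_Ioi] with u hu
    exact (norm_indicator_le_norm_self _ _).trans (hi u hu)
  · filter_upwards [ae_restrict_mem measurableSet_Ioi,
      ae_restrict_of_ae (Measure.ae_ne volume a₀)] with u hu hne
    rcases hne.lt_or_gt with h | h
    · rw [Set.indicator_of_notMem (Set.notMem_Ioi.2 h.le)]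
      refine tendsto_const_nhds.congr' ((ha.eventually (lt_mem_nhds h)).mono fun i hi => ?_)
      exact (Set.indicator_of_notMem (Set.notMem_Ioi.2 hi.le) _).symm
    · rw [Set.indicator_of_mem (Set.mem_Ioi.2 h)]
      refine (hlim u hu).congr' ((ha.eventually (gt_mem_nhds h)).mono fun i hi => ?_)
      exact (Set.indicator_of_mem (Set.mem_Ioi.2 hi) _).symm

lemma norm_smul_sub_integral_le [CompleteSpace E] {f : ℝ → E} {a b C : ℝ} {y : E} (hab : a ≤ b)
    (hf : IntervalIntegrable f volume a b) (hC : ∀ x ∈ Set.Ioc a b, ‖y - f x‖ ≤ C) :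
    ‖(b - a) • y - ∫ x in a..b, f x‖ ≤ C * (b - a) := by
  rw [← intervalIntegral.integral_const, ← intervalIntegral.integral_sub (by simp) hf,
    ← abs_of_nonneg (sub_nonneg.2 hab)]
  exact intervalIntegral.norm_integral_le_of_norm_le_const fun x hx =>
    hC x (Set.uIoc_of_le hab ▸ hx)

lemma norm_midpoint_sum_sub_integral_le [CompleteSpace E] {f : ℝ → E} {a h C : ℝ} {m : ℕ}
    (hh : 0 ≤ h) (hf : ContinuousOn f (Set.Icc a (a + m * h)))
    (hC : ∀ x ∈ Set.Icc a (a + m * h), ∀ y ∈ Set.Icc a (a + m * h),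
      dist x y ≤ h → ‖f x - f y‖ ≤ C) :
    ‖h • ∑ k ∈ Finset.range m, f (a + (k + 1 / 2) * h) - ∫ x in a..a + m * h, f x‖
      ≤ m * (C * h) := by
  set t : ℕ → ℝ := fun k => a + k * h with ht
  have hmono : Monotone t := fun i j hij => by simp only [ht]; gcongr
  have hwidth (k : ℕ) : t (k + 1) - t k = h := by simp only [ht]; push_cast; ring
  have hcell {k : ℕ} (hk : k < m) : Set.Icc (t k) (t (k + 1)) ⊆ Set.Icc a (a + m * h) :=
    Set.Icc_subset_Icc (le_add_of_nonneg_right (by positivity)) (hmono hk)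
  have hmid (k : ℕ) : a + (k + 1 / 2) * h ∈ Set.Icc (t k) (t (k + 1)) := by
    simp only [ht, Set.mem_Icc]
    push_cast
    constructor <;> linarith
  have hint {k : ℕ} (hk : k < m) : IntervalIntegrable f volume (t k) (t (k + 1)) :=
    (hf.mono (hcell hk)).intervalIntegrable_of_Icc (hmono k.le_succ)
  have hsum := intervalIntegral.sum_integral_adjacent_intervals (a := t) (n := m)
    fun k hk => hint hk
  simp only [ht, Nat.cast_zero, zero_mul, add_zero] at hsum
  rw [← hsum, Finset.smul_sum, ← Finset.sum_sub_distrib]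
  refine (norm_sum_le_of_le (f := fun k : ℕ => h • f (a + (k + 1 / 2) * h)
    - ∫ x in t k..t (k + 1), f x) _ (n := fun _ => C * h) fun k hk => ?_).trans_eq (by simp)
  have hk := Finset.mem_range.1 hk
  have hle := norm_smul_sub_integral_le (hmono k.le_succ) (hint hk)
    (y := f (a + (k + 1 / 2) * h)) fun x hx => hC _ (hcell hk (hmid k)) x
      (hcell hk (Set.Ioc_subset_Icc_self hx))
      ((Real.dist_le_of_mem_Icc (hmid k) (Set.Ioc_subset_Icc_self hx)).trans_eq (hwidth k))
  rwa [hwidth] at hle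

lemma tendsto_midpoint_sum [CompleteSpace E] {f : ℝ → E} {a b : ℝ} (hab : a ≤ b)
    (hf : ContinuousOn f (Set.Icc a b)) :
    Tendsto (fun m : ℕ => ((b - a) / m) •
        ∑ k ∈ Finset.range m, f (a + (k + 1 / 2) * ((b - a) / m)))
      atTop (𝓝 (∫ x in a..b, f x)) := by
  rw [Metric.tendsto_nhds]
  intro ε hε
  have hba := sub_nonneg.2 hab
  obtain ⟨δ, hδ, huc⟩ := Metric.uniformContinuousOn_iff.1
    (isCompact_Icc.uniformContinuousOn_of_continuous hf) (ε / (b - a + 1)) (by positivity)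
  have hmesh : Tendsto (fun m : ℕ => (b - a) / m) atTop (𝓝 0) :=
    tendsto_const_div_atTop_nhds_zero_nat (b - a)
  filter_upwards [hmesh.eventually_lt_const hδ, eventually_gt_atTop 0] with m hmδ hm
  have hm₀ : (m : ℝ) ≠ 0 := Nat.cast_ne_zero.2 hm.ne'
  have hend : a + m * ((b - a) / m) = b := by field_simp; ring
  have hle := norm_midpoint_sum_sub_integral_le (f := f) (a := a) (h := (b - a) / m) (m := m)
    (C := ε / (b - a + 1)) (by positivity) (by rwa [hend]) fun x hx y hy hxy => by
      rw [hend] at hx hy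
      rw [← dist_eq_norm]
      exact (huc x hx y hy (hxy.trans_lt hmδ)).le
  rw [hend] at hle
  rw [dist_eq_norm]
  calc _ ≤ m * (ε / (b - a + 1) * ((b - a) / m)) := hle
    _ = ε * ((b - a) / (b - a + 1)) := by field_simp
    _ < ε := mul_lt_of_lt_one_right hε ((div_lt_one (by positivity)).2 (lt_add_one _))

end Integrals

section GaussChebyshev

open Polynomial.Chebyshev (measureT)

lemma sum_node_eq_sum_range (f : ℝ → ℝ) (m : ℕ) :
    ∑ k ∈ Finset.Icc 1 m, f (node m k)
      = ∑ k ∈ Finset.range m, f (Real.cos (0 + (k + 1 / 2) * ((Real.pi - 0) / m))) := by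
  rw [Finset.range_eq_Ico, ← Finset.Ico_add_one_right_eq_Icc,
    Finset.sum_Ico_eq_sum_range, Nat.add_sub_cancel, Finset.range_eq_Ico]
  refine Finset.sum_congr rfl fun k _ => ?_
  rw [node]
  congr 2
  push_cast
  ring

theorem tendsto_gaussChebyshev {f : ℝ → ℝ} (hf : ContinuousOn f (Set.Icc (-1) 1)) :
    Tendsto (fun m : ℕ => Real.pi / m * ∑ k ∈ Finset.Icc 1 m, f (node m k)) atTop
      (𝓝 (∫ x, f x ∂measureT)) := by
  have hcos : Continuous fun θ => f (Real.cos θ) :=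
    hf.comp_continuous Real.continuous_cos Real.cos_mem_Icc
  simpa only [Polynomial.Chebyshev.integral_measureT_eq_integral_cos, sum_node_eq_sum_range,
    smul_eq_mul, sub_zero] using tendsto_midpoint_sum Real.pi_pos.le hcos.continuousOn

lemma continuousOn_sqrt_one_sub_sq_mul {g : ℝ → ℝ} {B : ℝ} (hg : ContinuousOn g (Set.Ioo (-1) 1))
    (hB : ∀ x ∈ Set.Ioo (-1 : ℝ) 1, |g x| ≤ B) :
    ContinuousOn (fun x => √(1 - x ^ 2) * g x) (Set.Icc (-1) 1) := by
  have hsqrt : Continuous fun x : ℝ => √(1 - x ^ 2) := by fun_prop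
  intro x hx
  by_cases hx' : x ∈ Set.Ioo (-1) 1
  · exact (hsqrt.continuousAt.mul (hg.continuousAt (isOpen_Ioo.mem_nhds hx'))).continuousWithinAt
  have hzero {y : ℝ} (hy : y ∈ Set.Icc (-1) 1) (hy' : y ∉ Set.Ioo (-1) 1) : √(1 - y ^ 2) = 0 := by
    rcases Set.eq_endpoints_or_mem_Ioo_of_mem_Icc hy with rfl | rfl | h
    · norm_num
    · norm_num
    · exact absurd h hy'
  have hlim : Tendsto (fun y => √(1 - y ^ 2) * B) (𝓝[Set.Icc (-1) 1] x) (𝓝 0) := by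
    simpa only [ContinuousWithinAt, hzero hx hx', zero_mul] using
      (hsqrt.continuousWithinAt (s := Set.Icc (-1) 1) (x := x)).mul_const B
  rw [ContinuousWithinAt, hzero hx hx', zero_mul]
  refine squeeze_zero_norm' ?_ hlim
  filter_upwards [self_mem_nhdsWithin] with y hy
  by_cases hy' : y ∈ Set.Ioo (-1) 1
  · rw [norm_mul, Real.norm_of_nonneg (Real.sqrt_nonneg _)]
    exact mul_le_mul_of_nonneg_left (hB y hy') (Real.sqrt_nonneg _)
  · simp [hzero hy hy']

lemma integral_sqrt_one_sub_sq_mul_measureT (g : ℝ → ℝ) :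
    ∫ x, √(1 - x ^ 2) * g x ∂measureT = ∫ x in (-1 : ℝ)..1, g x := by
  rw [Polynomial.Chebyshev.integral_measureT, intervalIntegral.integral_of_le (by norm_num),
    intervalIntegral.integral_of_le (by norm_num), integral_Ioc_eq_integral_Ioo,
    integral_Ioc_eq_integral_Ioo]
  refine setIntegral_congr_fun measurableSet_Ioo fun x hx => ?_
  have hpos : 0 < 1 - x ^ 2 := by nlinarith [hx.1, hx.2]
  have : 0 < √(1 - x ^ 2) := Real.sqrt_pos.2 hpos
  rw [Real.sqrt_inv]
  field_simp

theorem tendsto_gaussChebyshev_of_bounded {g : ℝ → ℝ} {B : ℝ}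
    (hg : ContinuousOn g (Set.Ioo (-1) 1)) (hB : ∀ x ∈ Set.Ioo (-1 : ℝ) 1, |g x| ≤ B) :
    Tendsto (fun m : ℕ => Real.pi / m *
        ∑ k ∈ Finset.Icc 1 m, √(1 - node m k ^ 2) * g (node m k)) atTop
      (𝓝 (∫ x in (-1 : ℝ)..1, g x)) := by
  rw [← integral_sqrt_one_sub_sq_mul_measureT]
  exact tendsto_gaussChebyshev (continuousOn_sqrt_one_sub_sq_mul hg hB)

end GaussChebyshev

/-! ### Laplace functional of the Poisson process -/

section NegExp

/-- The function `x ↦ exp (-x)` on the extended nonnegative numbers, with the value `0` at `∞`;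
it carries the Laplace transforms of sums that need not be finite. -/
def negExp (x : ℝ≥0∞) : ℝ≥0∞ := EReal.exp (-(x : EReal))

lemma negExp_zero : negExp 0 = 1 := by simp [negExp]

lemma negExp_top : negExp ⊤ = 0 := by simp [negExp]

lemma negExp_ofReal {t : ℝ} (ht : 0 ≤ t) :
    negExp (ENNReal.ofReal t) = ENNReal.ofReal (Real.exp (-t)) := by
  rw [negExp, EReal.coe_ennreal_ofReal, max_eq_left ht, ← EReal.coe_neg, EReal.exp_coe]

lemma negExp_add (x y : ℝ≥0∞) : negExp (x + y) = negExp x * negExp y := by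
  rw [negExp, negExp, negExp, EReal.coe_ennreal_add, EReal.neg_add, sub_eq_add_neg, EReal.exp_add]
  · left; simp
  · right; simp

lemma continuous_negExp : Continuous negExp :=
  ENNReal.continuous_exp.comp (continuous_neg.comp continuous_coe_ennreal_ereal)

lemma measurable_negExp : Measurable negExp := continuous_negExp.measurable

lemma antitone_negExp : Antitone negExp := fun _ _ h =>
  EReal.exp_monotone (EReal.neg_le_neg_iff.2 (EReal.coe_ennreal_le_coe_ennreal_iff.2 h))

lemma negExp_le_one (x : ℝ≥0∞) : negExp x ≤ 1 := negExp_zero ▸ antitone_negExp (zero_le)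

lemma negExp_ne_top (x : ℝ≥0∞) : negExp x ≠ ⊤ := ((negExp_le_one x).trans_lt ENNReal.one_lt_top).ne

lemma negExp_natCast_mul (n : ℕ) (x : ℝ≥0∞) : negExp (n * x) = negExp x ^ n := by
  induction n with
  | zero => simp [negExp_zero]
  | succ n ih => rw [Nat.cast_add, Nat.cast_one, add_mul, one_mul, negExp_add, ih, pow_succ]

lemma negExp_sum {ι : Type*} (s : Finset ι) (f : ι → ℝ≥0∞) :
    negExp (∑ i ∈ s, f i) = ∏ i ∈ s, negExp (f i) := by
  classical
  induction s using Finset.induction_on with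
  | empty => simp [negExp_zero]
  | insert a s ha ih => rw [Finset.sum_insert ha, Finset.prod_insert ha, negExp_add, ih]

lemma tsum_negExp_mul_poisson {m : ℝ} (hm : 0 ≤ m) (x : ℝ≥0∞) :
    ∑' k : ℕ, negExp (k * x) * ENNReal.ofReal (Real.exp (-m) * m ^ k / k.factorial)
      = negExp ((1 - negExp x) * ENNReal.ofReal m) := by
  obtain ⟨q, hq, hq₁, hqx⟩ : ∃ q : ℝ, 0 ≤ q ∧ q ≤ 1 ∧ negExp x = ENNReal.ofReal q :=
    ⟨(negExp x).toReal, ENNReal.toReal_nonneg,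
      ENNReal.toReal_le_of_le_ofReal zero_le_one (by simpa using negExp_le_one x),
      (ENNReal.ofReal_toReal (negExp_ne_top x)).symm⟩
  have hterm (k : ℕ) : negExp (k * x) * ENNReal.ofReal (Real.exp (-m) * m ^ k / k.factorial)
      = ENNReal.ofReal (Real.exp (-m) * ((q * m) ^ k / k.factorial)) := by
    rw [negExp_natCast_mul, hqx, ← ENNReal.ofReal_pow hq, ← ENNReal.ofReal_mul (by positivity)]
    congr 1
    ring
  have hexp : HasSum (fun k : ℕ => Real.exp (-m) * ((q * m) ^ k / k.factorial))
      (Real.exp (-m) * Real.exp (q * m)) := by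
    rw [Real.exp_eq_exp_ℝ]
    exact (NormedSpace.expSeries_div_hasSum_exp (q * m)).mul_left _
  simp only [hterm]
  rw [← ENNReal.ofReal_tsum_of_nonneg (fun k => by positivity) hexp.summable, hexp.tsum_eq, hqx,
    ← ENNReal.ofReal_one, ← ENNReal.ofReal_sub _ hq, ← ENNReal.ofReal_mul (by linarith),
    negExp_ofReal (mul_nonneg (by linarith) hm), ← Real.exp_add]
  congr 2
  ring

lemma lintegral_negExp_mul_of_poisson {Ω : Type*} [MeasurableSpace Ω] {P : Measure Ω}
    [IsProbabilityMeasure P] {X : Ω → ℕ∞} (hX : Measurable X) {m : ℝ} (hm : 0 ≤ m)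
    (hlaw : ∀ k : ℕ, P {ω | X ω = k} = ENNReal.ofReal (Real.exp (-m) * m ^ k / k.factorial))
    (x : ℝ≥0∞) :
    ∫⁻ ω, negExp (X ω * x) ∂P = negExp ((1 - negExp x) * ENNReal.ofReal m) := by
  rcases eq_or_ne x 0 with rfl | hx
  · simp [negExp_zero]
  rw [← lintegral_map (f := fun k : ℕ∞ => negExp (k * x)) (measurable_of_countable _) hX,
    lintegral_countable', ← tsum_negExp_mul_poisson hm]
  have hsupp : Function.support (fun k : ℕ∞ => negExp (k * x) * P.map X {k})
      ⊆ Set.range ((↑) : ℕ → ℕ∞) := fun k hk => by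
    induction k with
    | top => simp [ENNReal.top_mul hx, negExp_top] at hk
    | coe k => exact ⟨k, rfl⟩
  rw [← Nat.cast_injective.tsum_eq hsupp]
  refine tsum_congr fun k => ?_
  rw [Measure.map_apply hX (measurableSet_singleton _), ← hlaw, ENat.toENNReal_coe]
  rfl

end NegExp

lemma exists_monotone_simpleFunc_tendsto {α : Type*} [MeasurableSpace α] (μ : Measure α)
    [SigmaFinite μ] {f : α → ℝ≥0∞} (hf : Measurable f) :
    ∃ g : ℕ → SimpleFunc α ℝ≥0∞, (∀ k, μ (Function.support (g k)) < ∞) ∧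
      (∀ y, Monotone fun k => g k y) ∧ ∀ y, Tendsto (fun k => g k y) atTop (𝓝 (f y)) := by
  have hrestrict (k : ℕ) (y : α) :
      (SimpleFunc.eapprox f k).restrict (spanningSets μ k) y
        = (spanningSets μ k).indicator (SimpleFunc.eapprox f k) y :=
    SimpleFunc.restrict_apply _ (measurableSet_spanningSets μ k) y
  refine ⟨fun k => (SimpleFunc.eapprox f k).restrict (spanningSets μ k), fun k => ?_,
    fun y i j hij => ?_, fun y => ?_⟩
  · refine (measure_mono fun y hy => ?_).trans_lt (measure_spanningSets_lt_top μ k)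
    rw [Function.mem_support, hrestrict] at hy
    exact Set.mem_of_indicator_ne_zero hy
  · simp only [hrestrict]
    exact (Set.indicator_le_indicator (SimpleFunc.monotone_eapprox f hij y)).trans
      (Set.indicator_le_indicator_of_subset (monotone_spanningSets μ hij) (fun _ => zero_le) y)
  · have hlim : Tendsto (fun k => SimpleFunc.eapprox f k y) atTop (𝓝 (f y)) := by
      rw [← SimpleFunc.iSup_eapprox_apply hf y]
      exact tendsto_atTop_iSup fun i j hij => SimpleFunc.monotone_eapprox f hij y
    obtain ⟨K, hK⟩ := Set.mem_iUnion.1 ((iUnion_spanningSets μ).symm ▸ Set.mem_univ y)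
    refine hlim.congr' ?_
    filter_upwards [eventually_ge_atTop K] with k hk
    rw [hrestrict, Set.indicator_of_mem (monotone_spanningSets μ hk hK)]

section PoissonProcess

variable {Ω : Type*} {v : ℕ → Ω → Plane}

lemma tsum_indicator_const_eq_encard_mul (A : Set Plane) (x : ℝ≥0∞) (ω : Ω) :
    ∑' n, A.indicator (fun _ => x) (v n ω) = {n | v n ω ∈ A}.encard * x := by
  rw [← ENNReal.tsum_set_const]
  exact (tsum_subtype {n | v n ω ∈ A} (fun _ => x)).symm

variable [MeasurableSpace Ω] {P : Measure Ω} {lam : ℝ}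

lemma measurable_encard (hv : ∀ n, Measurable (v n)) {A : Set Plane} (hA : MeasurableSet A) :
    Measurable fun ω => {n | v n ω ∈ A}.encard := by
  have hsum : Measurable fun ω => ∑' n, A.indicator (fun _ => (1 : ℝ≥0∞)) (v n ω) :=
    Measurable.tsum fun n => (measurable_const.indicator hA).comp (hv n)
  simp only [tsum_indicator_const_eq_encard_mul, mul_one] at hsum
  refine measurable_to_countable' fun k => ?_
  convert! hsum (measurableSet_singleton (k : ℝ≥0∞)) using 1
  ext ω
  simp

namespace IsPPP

lemma iIndepFun_encard (h : IsPPP P v lam) {ι : Type*} [Finite ι] {A : ι → Set Plane}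
    (hA : ∀ i, MeasurableSet (A i)) (hvol : ∀ i, volume (A i) < ∞)
    (hdisj : Pairwise fun i j => Disjoint (A i) (A j)) :
    iIndepFun (fun i ω => {n | v n ω ∈ A i}.encard) P := by
  obtain ⟨l, ⟨e⟩⟩ := Finite.exists_equiv_fin ι
  have hfin := h.indep l (A ∘ e.symm) (fun _ => hA _) (fun _ => hvol _)
    fun i j hij => hdisj (e.symm.injective.ne hij)
  simpa using hfin.precomp e.injective

variable [IsProbabilityMeasure P]

lemma lintegral_negExp_encard (h : IsPPP P v lam) (hlam : 0 ≤ lam) {A : Set Plane}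
    (hA : MeasurableSet A) (hvol : volume A < ∞) (x : ℝ≥0∞) :
    ∫⁻ ω, negExp ({n | v n ω ∈ A}.encard * x) ∂P
      = negExp ((1 - negExp x) * (ENNReal.ofReal lam * volume A)) := by
  rw [lintegral_negExp_mul_of_poisson (measurable_encard h.measurable hA) (by positivity)
    (h.poisson A hA hvol), ENNReal.ofReal_mul hlam, ofReal_measureReal hvol.ne]

lemma lintegral_negExp_sum_step (h : IsPPP P v lam) (hlam : 0 ≤ lam) {ι : Type*} [Fintype ι]
    {A : ι → Set Plane} (hA : ∀ i, MeasurableSet (A i)) (hvol : ∀ i, volume (A i) < ∞)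
    (hdisj : Pairwise fun i j => Disjoint (A i) (A j)) (x : ι → ℝ≥0∞) :
    ∫⁻ ω, negExp (∑' n, ∑ i, (A i).indicator (fun _ => x i) (v n ω)) ∂P
      = negExp (∑ i, (1 - negExp (x i)) * (ENNReal.ofReal lam * volume (A i))) := by
  have hind : iIndepFun (fun i ω => negExp ({n | v n ω ∈ A i}.encard * x i)) P :=
    (h.iIndepFun_encard hA hvol hdisj).comp (fun i (k : ℕ∞) => negExp (k * x i))
      fun i => measurable_of_countable _
  simp only [Summable.tsum_finsetSum fun _ _ => ENNReal.summable,
    tsum_indicator_const_eq_encard_mul, negExp_sum]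
  rw [lintegral_prod_eq_prod_lintegral_of_indepFun _ _ hind fun i =>
    (measurable_of_countable fun k : ℕ∞ => negExp (k * x i)).comp
      (measurable_encard h.measurable (hA i))]
  exact Finset.prod_congr rfl fun i _ => h.lintegral_negExp_encard hlam (hA i) (hvol i) (x i)

lemma lintegral_negExp_sum_simpleFunc (h : IsPPP P v lam) (hlam : 0 ≤ lam)
    (f : SimpleFunc Plane ℝ≥0∞) (hf : volume (Function.support f) < ∞) :
    ∫⁻ ω, negExp (∑' n, f (v n ω)) ∂P
      = negExp (∫⁻ y, (1 - negExp (f y)) ∂(ENNReal.ofReal lam • volume)) := by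
  classical
  set s : Finset ℝ≥0∞ := f.range.erase 0 with hs
  set A : s → Set Plane := fun c => f ⁻¹' {c.1} with hA_def
  have hA (c : s) : MeasurableSet (A c) := f.measurableSet_preimage _
  have hvol (c : s) : volume (A c) < ∞ := by
    refine (measure_mono fun y (hy : f y = c) => ?_).trans_lt hf
    rw [Function.mem_support, hy]
    exact Finset.ne_of_mem_erase c.2
  have hdisj : Pairwise fun c d => Disjoint (A c) (A d) := fun c d hcd =>
    Set.disjoint_left.2 fun y (hc : f y = c) (hd : f y = d) => hcd (Subtype.ext (hc.symm.trans hd))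
  have hsum (g : ℝ≥0∞ → ℝ≥0∞) (hg : g 0 = 0) (y : Plane) :
      g (f y) = ∑ c, (A c).indicator (fun _ => g c) y := by
    simp only [hA_def, Set.indicator_apply, Set.mem_preimage, Set.mem_singleton_iff]
    rw [Finset.sum_coe_sort s (fun c => if f y = c then g c else 0), Finset.sum_ite_eq]
    by_cases hy : f y = 0 <;> simp [hs, hy, hg]
  have hint : ∫⁻ y, (1 - negExp (f y)) ∂(ENNReal.ofReal lam • volume)
      = ∑ c : s, (1 - negExp c) * (ENNReal.ofReal lam * volume (A c)) := by
    simp only [hsum (fun x => 1 - negExp x) (by simp [negExp_zero]),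
      lintegral_finsetSum _ fun c _ => measurable_const.indicator (hA c),
      lintegral_indicator (hA _), setLIntegral_const, Measure.smul_apply, smul_eq_mul]
  rw [hint, ← h.lintegral_negExp_sum_step hlam hA hvol hdisj]
  exact lintegral_congr fun ω => congrArg negExp (tsum_congr fun n => hsum id rfl _)

theorem lintegral_negExp_sum (h : IsPPP P v lam) (hlam : 0 ≤ lam) {f : Plane → ℝ≥0∞}
    (hf : Measurable f) :
    ∫⁻ ω, negExp (∑' n, f (v n ω)) ∂P
      = negExp (∫⁻ y, (1 - negExp (f y)) ∂(ENNReal.ofReal lam • volume)) := by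
  obtain ⟨g, hg_supp, hg_mono, hg_lim⟩ := exists_monotone_simpleFunc_tendsto volume hf
  have hsum (ω : Ω) : Tendsto (fun k => ∑' n, g k (v n ω)) atTop (𝓝 (∑' n, f (v n ω))) := by
    simp only [← lintegral_count]
    exact lintegral_tendsto_of_tendsto_of_monotone
      (fun k => (measurable_of_countable _).aemeasurable)
      (Eventually.of_forall fun n => hg_mono _) (Eventually.of_forall fun n => hg_lim _)
  have hleft : Tendsto (fun k => ∫⁻ ω, negExp (∑' n, g k (v n ω)) ∂P) atTop
      (𝓝 (∫⁻ ω, negExp (∑' n, f (v n ω)) ∂P)) := by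
    refine tendsto_lintegral_of_dominated_convergence (fun _ => 1) (fun k => ?_)
      (fun k => Eventually.of_forall fun ω => negExp_le_one _) (by simp)
      (Eventually.of_forall fun ω => (continuous_negExp.tendsto _).comp (hsum ω))
    exact measurable_negExp.comp
      (Measurable.tsum fun n => (g k).measurable.comp (h.measurable n))
  have hright : Tendsto (fun k => ∫⁻ y, (1 - negExp (g k y)) ∂(ENNReal.ofReal lam • volume)) atTop
      (𝓝 (∫⁻ y, (1 - negExp (f y)) ∂(ENNReal.ofReal lam • volume))) := by
    refine lintegral_tendsto_of_tendsto_of_monotone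
      (fun k => (measurable_const.sub (measurable_negExp.comp (g k).measurable)).aemeasurable)
      (Eventually.of_forall fun y i j hij =>
        tsub_le_tsub_left (antitone_negExp (hg_mono y hij)) 1)
      (Eventually.of_forall fun y => ENNReal.Tendsto.sub tendsto_const_nhds
        ((continuous_negExp.tendsto _).comp (hg_lim y)) (Or.inl ENNReal.one_ne_top))
  simp only [h.lintegral_negExp_sum_simpleFunc hlam (g _) (hg_supp _)] at hleft
  exact tendsto_nhds_unique hleft ((continuous_negExp.tendsto _).comp hright)

end IsPPP

end PoissonProcess

lemma lintegral_ofReal_norm {g : ℝ → ℝ} (hg : ∀ r, 0 ≤ g r)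
    (hint : IntegrableOn (fun r => r * g r) (Set.Ioi 0)) :
    ∫⁻ y : Plane, ENNReal.ofReal (g ‖y‖)
      = ENNReal.ofReal (2 * Real.pi * ∫ r in Set.Ioi 0, r * g r) := by
  have hdim : Module.finrank ℝ Plane = 2 := by simp [Plane]
  have hi : Integrable (fun y : Plane => g ‖y‖) := by
    rw [integrable_fun_norm_addHaar volume (f := g), hdim]
    simpa using hint
  have hball : (volume : Measure Plane).real (Metric.ball 0 1) = Real.pi := by
    rw [Measure.real, EuclideanSpace.volume_ball_fin_two]
    simp [Real.pi_pos.le]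
  rw [← ofReal_integral_eq_lintegral_ofReal hi (Eventually.of_forall fun y => hg _),
    integral_fun_norm_addHaar volume g, hdim, hball]
  simp only [Nat.add_one_sub_one, pow_one, nsmul_eq_mul, smul_eq_mul, Nat.cast_ofNat, mul_assoc]

/-! ### Alzer's inequality -/

lemma lintegral_negExp_gammaMeasure {a r c : ℝ} (ha : 0 < a) (hr : 0 < r) (hc : 0 ≤ c) :
    ∫⁻ x, negExp (ENNReal.ofReal (c * x)) ∂(gammaMeasure a r)
      = ENNReal.ofReal ((r / (r + c)) ^ a) := by
  have hrc : 0 < r + c := by positivity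
  have hpdf (b : ℝ) : Measurable (gammaPDF a b) := (measurable_gammaPDFReal a b).ennreal_ofReal
  have hexp : Measurable fun x : ℝ => negExp (ENNReal.ofReal (c * x)) :=
    measurable_negExp.comp (measurable_const.mul measurable_id).ennreal_ofReal
  -- the exponential tilts the Gamma density of rate `r` into that of rate `r + c`
  have htilt (x : ℝ) : gammaPDF a r x * negExp (ENNReal.ofReal (c * x))
      = ENNReal.ofReal ((r / (r + c)) ^ a) * gammaPDF a (r + c) x := by
    rcases lt_or_ge x 0 with hx | hx
    · rw [gammaPDF_of_neg hx, gammaPDF_of_neg hx, zero_mul, mul_zero]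
    have := Real.Gamma_pos_of_pos ha
    have hsplit : Real.exp (-((r + c) * x)) = Real.exp (-(r * x)) * Real.exp (-(c * x)) := by
      rw [← Real.exp_add, add_mul, neg_add]
    have hpow : (r + c) ^ a ≠ 0 := (Real.rpow_pos_of_pos hrc a).ne'
    rw [gammaPDF_of_nonneg hx, gammaPDF_of_nonneg hx, negExp_ofReal (by positivity),
      ← ENNReal.ofReal_mul (by positivity), ← ENNReal.ofReal_mul (by positivity),
      Real.div_rpow hr.le hrc.le, hsplit]
    congr 1
    field_simp
  rw [gammaMeasure, lintegral_withDensity_eq_lintegral_mul _ (hpdf r) hexp]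
  simp only [Pi.mul_apply, htilt]
  rw [lintegral_const_mul _ (hpdf _), lintegral_gammaPDF_eq_one ha hrc, mul_one]

section Alzer

lemma integral_exp_neg_mul_unit {t : ℝ} (ht : t ≠ 0) :
    ∫ s in Set.Icc (0 : ℝ) 1, Real.exp (-(t * s)) = (1 - Real.exp (-t)) / t := by
  rw [integral_Icc_eq_integral_Ioc, ← intervalIntegral.integral_of_le zero_le_one]
  have h := intervalIntegral.integral_comp_mul_left (a := 0) (b := 1) Real.exp (neg_ne_zero.2 ht)
  simp only [neg_mul, mul_zero, mul_one, integral_exp, Real.exp_zero, smul_eq_mul] at h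
  rw [h, inv_neg, neg_mul, ← mul_neg, neg_sub, inv_mul_eq_div]

lemma rpow_le_one_sub_exp_div {t u : ℝ} (ht : 0 < t) (htu : t ≤ u) :
    ((1 - Real.exp (-t)) / t) ^ (u / t) ≤ (1 - Real.exp (-u)) / u := by
  have hu := ht.trans_le htu
  have : IsProbabilityMeasure (volume.restrict (Set.Icc (0 : ℝ) 1)) := ⟨by simp⟩
  have hint (c : ℝ) : IntegrableOn (fun s : ℝ => Real.exp (-(c * s))) (Set.Icc 0 1) :=
    (by fun_prop : Continuous fun s : ℝ => Real.exp (-(c * s))).integrableOn_Icc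
  have hpow (s : ℝ) : Real.exp (-(t * s)) ^ (u / t) = Real.exp (-(u * s)) := by
    rw [← Real.exp_mul]
    congr 1
    field_simp
  have hJensen := (convexOn_rpow ((one_le_div ht).2 htu)).map_integral_le
    (μ := volume.restrict (Set.Icc (0 : ℝ) 1)) (f := fun s => Real.exp (-(t * s)))
    (Real.continuous_rpow_const (by positivity)).continuousOn isClosed_Ici
    (Eventually.of_forall fun s => (Real.exp_pos _).le) (hint t)
    (by simp only [Function.comp_def, hpow]; exact hint u)
  simpa only [hpow, integral_exp_neg_mul_unit ht.ne', integral_exp_neg_mul_unit hu.ne']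
    using hJensen

lemma exp_neg_mul_le_pow_of_le {c t u : ℝ} (m : ℕ) (ht : 0 < t) (htu : t ≤ u)
    (h : Real.exp (-(c * t)) ≤ ((1 - Real.exp (-t)) / t) ^ m) :
    Real.exp (-(c * u)) ≤ ((1 - Real.exp (-u)) / u) ^ m := by
  have hut : 0 ≤ u / t := div_nonneg (ht.le.trans htu) ht.le
  have hmean : 0 ≤ (1 - Real.exp (-t)) / t :=
    div_nonneg (sub_nonneg.2 (Real.exp_le_one_iff.2 (neg_nonpos.2 ht.le))) ht.le
  calc Real.exp (-(c * u)) = Real.exp (-(c * t)) ^ (u / t) := by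
        rw [← Real.exp_mul]
        congr 1
        field_simp
    _ ≤ (((1 - Real.exp (-t)) / t) ^ m) ^ (u / t) :=
        Real.rpow_le_rpow (Real.exp_pos _).le h hut
    _ = (((1 - Real.exp (-t)) / t) ^ (u / t)) ^ m := by
        rw [← Real.rpow_natCast_mul hmean, mul_comm (m : ℝ), Real.rpow_mul_natCast hmean]
    _ ≤ ((1 - Real.exp (-u)) / u) ^ m :=
        pow_le_pow_left₀ (Real.rpow_nonneg hmean _) (rpow_le_one_sub_exp_div ht htu) m

lemma nonneg_of_deriv_neg_persists {D D' : ℝ → ℝ} (hD : ∀ x, HasDerivAt D (D' x) x) (h₀ : D 0 = 0)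
    (htop : Tendsto D atTop (𝓝 0)) (hneg : ∀ x y, 0 < x → x ≤ y → D' x < 0 → D' y ≤ 0) {x : ℝ}
    (hx : 0 ≤ x) : 0 ≤ D x := by
  by_contra! hDx
  have hx₀ : 0 < x := hx.lt_of_ne fun h => hDx.ne (h ▸ h₀)
  have hcont : Continuous D := continuous_iff_continuousAt.2 fun x => (hD x).continuousAt
  obtain ⟨c, hc, hslope⟩ := exists_hasDerivAt_eq_slope D D' hx₀ hcont.continuousOn fun y _ => hD y
  have hc_neg : D' c < 0 := by
    rw [hslope, h₀, sub_zero, sub_zero]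
    exact div_neg_of_neg_of_pos hDx hx₀
  have hanti : AntitoneOn D (Set.Ici c) := by
    refine antitoneOn_of_deriv_nonpos (convex_Ici c) hcont.continuousOn
      (fun y _ => (hD y).differentiableAt.differentiableWithinAt) fun y hy => ?_
    rw [interior_Ici] at hy
    rw [(hD y).deriv]
    exact hneg c y hc.1 (le_of_lt hy) hc_neg
  refine hDx.not_ge (le_of_tendsto htop ?_)
  filter_upwards [eventually_ge_atTop x] with y hy
  exact hanti hc.2.le (hc.2.le.trans hy) hy

/-- The density on `[0, ∞)` of the Gamma distribution of shape `m + 1` and mean one, extended to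
an analytic function on the real line. -/
def erlangDensity (m : ℕ) (t : ℝ) : ℝ :=
  ((m : ℝ) + 1) ^ (m + 1) / m.factorial * t ^ m * Real.exp (-((m + 1) * t))

lemma continuous_erlangDensity (m : ℕ) : Continuous (erlangDensity m) := by
  unfold erlangDensity
  fun_prop

lemma gammaMeasure_real_Iic (m : ℕ) {x : ℝ} (hx : 0 ≤ x) :
    (gammaMeasure ((m : ℝ) + 1) ((m : ℝ) + 1)).real (Set.Iic x)
      = ∫ t in (0 : ℝ)..x, erlangDensity m t := by
  have hm : (0 : ℝ) < (m : ℝ) + 1 := by positivity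
  have := isProbabilityMeasure_gammaMeasure hm hm
  have hpdf : gammaPDFReal ((m : ℝ) + 1) ((m : ℝ) + 1)
      = (Set.Ici 0).indicator (erlangDensity m) := by
    ext t
    rw [gammaPDFReal, Set.indicator_apply]
    simp only [Set.mem_Ici, erlangDensity]
    rw [Real.Gamma_nat_eq_factorial, add_sub_cancel_right, Real.rpow_natCast]
    congr 4
    exact_mod_cast Real.rpow_natCast ((m : ℝ) + 1) (m + 1)
  rw [← cdf_eq_real, cdf_gammaMeasure_eq_integral hm hm, hpdf,
    setIntegral_indicator measurableSet_Ici, Set.inter_comm, Set.Ici_inter_Iic,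
    integral_Icc_eq_integral_Ioc, intervalIntegral.integral_of_le hx]

lemma tendsto_integral_erlangDensity (m : ℕ) :
    Tendsto (fun x => ∫ t in (0 : ℝ)..x, erlangDensity m t) atTop (𝓝 1) := by
  have hm : (0 : ℝ) < (m : ℝ) + 1 := by positivity
  have := isProbabilityMeasure_gammaMeasure hm hm
  refine (tendsto_cdf_atTop (gammaMeasure ((m : ℝ) + 1) ((m : ℝ) + 1))).congr' ?_
  filter_upwards [eventually_ge_atTop 0] with x hx
  rw [cdf_eq_real, gammaMeasure_real_Iic m hx]

lemma hasDerivAt_integral_erlangDensity_sub (m : ℕ) (η x : ℝ) :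
    HasDerivAt
      (fun x => (∫ t in (0 : ℝ)..x, erlangDensity m t) - (1 - Real.exp (-(η * x))) ^ (m + 1))
      (erlangDensity m x
        - (m + 1) * (1 - Real.exp (-(η * x))) ^ m * (Real.exp (-(η * x)) * η)) x := by
  have hcont := continuous_erlangDensity m
  have hcdf : HasDerivAt (fun x => ∫ t in (0 : ℝ)..x, erlangDensity m t) (erlangDensity m x) x :=
    intervalIntegral.integral_hasDerivAt_right (hcont.intervalIntegrable _ _)
      hcont.stronglyMeasurable.stronglyMeasurableAtFilter hcont.continuousAt
  have hexp : HasDerivAt (fun x => 1 - Real.exp (-(η * x))) (Real.exp (-(η * x)) * η) x := by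
    have hlin : HasDerivAt (fun x => -(η * x)) (-η) x := by
      simpa using! ((hasDerivAt_id x).const_mul η).neg
    exact (hlin.exp.const_sub 1).congr_deriv (by ring)
  refine (hcdf.sub (hexp.fun_pow (m + 1))).congr_deriv ?_
  simp

lemma erlangDensity_sub_eq {m : ℕ} {η y : ℝ} (hη : η ≠ 0)
    (hηm : η ^ (m + 1) * (m + 1).factorial = ((m : ℝ) + 1) ^ (m + 1)) (hy : y ≠ 0) :
    erlangDensity m y - (m + 1) * (1 - Real.exp (-(η * y))) ^ m * (Real.exp (-(η * y)) * η)
      = (m + 1) * η ^ (m + 1) * y ^ m * Real.exp (-(η * y))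
        * (Real.exp (-(((m + 1) / η - 1) * (η * y)))
          - ((1 - Real.exp (-(η * y))) / (η * y)) ^ m) := by
  have hconst : ((m : ℝ) + 1) ^ (m + 1) / m.factorial = (m + 1) * η ^ (m + 1) := by
    rw [← hηm, Nat.factorial_succ]
    push_cast
    field_simp
  have hexp : Real.exp (-(((m : ℝ) + 1) * y))
      = Real.exp (-(η * y)) * Real.exp (-(((m + 1) / η - 1) * (η * y))) := by
    rw [← Real.exp_add]
    congr 1
    field_simp
    ring
  rw [erlangDensity, hconst, hexp, div_pow]
  field_simp
  ring

theorem one_sub_exp_pow_le_integral_erlangDensity {m : ℕ} {η : ℝ} (hη : 0 < η)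
    (hηm : η ^ (m + 1) * (m + 1).factorial = ((m : ℝ) + 1) ^ (m + 1)) {x : ℝ} (hx : 0 ≤ x) :
    (1 - Real.exp (-(η * x))) ^ (m + 1) ≤ ∫ t in (0 : ℝ)..x, erlangDensity m t := by
  refine sub_nonneg.1 (nonneg_of_deriv_neg_persists
    (hasDerivAt_integral_erlangDensity_sub m η) (by simp) ?_ (fun x y hx hxy hneg => ?_) hx)
  · have hexp : Tendsto (fun x : ℝ => Real.exp (-(η * x))) atTop (𝓝 0) :=
      Real.tendsto_exp_neg_atTop_nhds_zero.comp (tendsto_id.const_mul_atTop hη)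
    simpa using (tendsto_integral_erlangDensity m).sub ((hexp.const_sub 1).pow (m + 1))
  · have hy : 0 < y := hx.trans_le hxy
    rw [erlangDensity_sub_eq hη.ne' hηm hx.ne'] at hneg
    rw [erlangDensity_sub_eq hη.ne' hηm hy.ne']
    have hle := (sub_neg.1 (neg_of_mul_neg_right hneg (by positivity))).le
    exact mul_nonpos_of_nonneg_of_nonpos (by positivity) (sub_nonpos.2
      (exp_neg_mul_le_pow_of_le m (by positivity) (mul_le_mul_of_nonneg_left hxy hη.le) hle))

end Alzer

/-! ### The loss and its planar integral -/

lemma one_sub_inv_one_add_pow_le {z : ℝ} (hz : 0 ≤ z) (N : ℕ) :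
    1 - ((1 + z) ^ N)⁻¹ ≤ N * z := by
  have hle_one : z / (1 + z) ≤ 1 := (div_le_one (by positivity)).2 (by linarith)
  have hBernoulli := one_add_mul_le_pow (a := -(z / (1 + z))) (by linarith) N
  have hinv : 1 + -(z / (1 + z)) = (1 + z)⁻¹ := by
    field_simp
    ring
  have hle : N * (z / (1 + z)) ≤ N * z :=
    mul_le_mul_of_nonneg_left (div_le_self hz (by linarith)) N.cast_nonneg
  rw [hinv, inv_pow] at hBernoulli
  linarith

namespace Params

section Loss

variable {p : Params} {κ : Link} {s t G u : ℝ}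

lemma two_le_α (p : Params) (κ : Link) : 2 ≤ p.α κ := by
  cases κ
  · exact p.α_LOS
  · exact p.α_NLOS.le

lemma ρ_pos (p : Params) : 0 < p.ρ := Real.sqrt_pos.2 (mul_pos p.βa_pos p.βb_pos)

lemma N_cast_pos (p : Params) (κ : Link) : (0 : ℝ) < p.N κ := Nat.cast_pos.2 (p.N_pos κ)

lemma F_zero (p : Params) (κ : Link) : p.F κ 0 = 0 := by
  unfold F
  split_ifs
  · simp [F2]
  · simp [gaussHyp]

lemma hasDerivAt_F (p : Params) (κ : Link) {z : ℝ} (hz : 0 < z) :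
    HasDerivAt (p.F κ) (2 / p.α κ * (p.F κ z + 1 - ((1 + z) ^ p.N κ)⁻¹) / z) z := by
  by_cases hα : p.α κ = 2
  · have hF : p.F κ = F2 (p.N κ) := by
      ext
      simp only [F, if_pos hα]
    simpa [hF, hα] using hasDerivAt_F2 (p.N_pos κ) hz
  · have hα₂ : 2 < p.α κ := (p.two_le_α κ).lt_of_ne' hα
    have hF : p.F κ = fun z => gaussHyp (-2 / p.α κ) (p.N κ) (1 + -2 / p.α κ) (-z) - 1 := by
      ext
      simp only [F, if_neg hα, neg_div, sub_eq_add_neg]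
    have ha : -1 < -2 / p.α κ := by
      rw [lt_div_iff₀ (by linarith)]
      linarith
    rw [hF]
    refine ((hasDerivAt_gaussHyp_neg ha (div_ne_zero (by norm_num) (by linarith))
      (p.N_cast_pos κ) hz).sub_const 1).congr_deriv ?_
    rw [Real.rpow_neg (by linarith), Real.rpow_natCast]
    ring

/-- The argument of `F` in `Z`: `s / N` times the mean power received over a link in state `κ` of
horizontal length `u` and directivity gain `G`. -/
def relPower (p : Params) (κ : Link) (s G u : ℝ) : ℝ :=
  s * p.C κ * G / (p.N κ * (u ^ 2 + p.Δh ^ 2) ^ (p.α κ / 2))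

/-- One minus the Laplace transform, at `s`, of the power received from a link in state `κ` of
horizontal length `u` and directivity gain `G`. -/
def loss (p : Params) (κ : Link) (s G u : ℝ) : ℝ :=
  1 - ((1 + p.relPower κ s G u) ^ p.N κ)⁻¹

lemma relPower_nonneg (hs : 0 ≤ s) (hG : 0 ≤ G) (u : ℝ) : 0 ≤ p.relPower κ s G u := by
  have := (p.C_pos κ).le
  unfold relPower
  positivity

lemma loss_nonneg (hs : 0 ≤ s) (hG : 0 ≤ G) (u : ℝ) : 0 ≤ p.loss κ s G u :=
  sub_nonneg.2 (inv_le_one_of_one_le₀ (one_le_pow₀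
    (le_add_of_nonneg_right (relPower_nonneg hs hG u))))

lemma loss_lt_one (hs : 0 ≤ s) (hG : 0 ≤ G) (u : ℝ) : p.loss κ s G u < 1 := by
  have := relPower_nonneg (p := p) (κ := κ) hs hG u
  exact sub_lt_self _ (by positivity)

lemma loss_mono (hs : 0 ≤ s) (hst : s ≤ t) (hG : 0 ≤ G) (u : ℝ) :
    p.loss κ s G u ≤ p.loss κ t G u := by
  have hnonneg := relPower_nonneg (p := p) (κ := κ) hs hG u
  have hle : p.relPower κ s G u ≤ p.relPower κ t G u := by
    have := (p.C_pos κ).le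
    unfold relPower
    gcongr
  unfold loss
  gcongr

lemma loss_le_rpow (hs : 0 ≤ s) (hG : 0 ≤ G) (hu : 0 < u) :
    p.loss κ s G u ≤ s * p.C κ * G * u ^ (-p.α κ) := by
  have hα := p.two_le_α κ
  have hC := (p.C_pos κ).le
  have hdist : u ^ p.α κ ≤ (u ^ 2 + p.Δh ^ 2) ^ (p.α κ / 2) := by
    calc u ^ p.α κ = (u ^ 2) ^ (p.α κ / 2) := by
          rw [Real.rpow_div_two_eq_sqrt _ (sq_nonneg u), Real.sqrt_sq hu.le]
      _ ≤ (u ^ 2 + p.Δh ^ 2) ^ (p.α κ / 2) :=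
          Real.rpow_le_rpow (by positivity) (le_add_of_nonneg_right (sq_nonneg _)) (by linarith)
  have : 0 < u ^ p.α κ := Real.rpow_pos_of_pos hu _
  calc p.loss κ s G u ≤ p.N κ * p.relPower κ s G u :=
        one_sub_inv_one_add_pow_le (relPower_nonneg hs hG u) _
    _ = s * p.C κ * G / (u ^ 2 + p.Δh ^ 2) ^ (p.α κ / 2) := by
        rw [relPower, mul_div_assoc', mul_div_mul_left _ _ (p.N_cast_pos κ).ne']
    _ ≤ s * p.C κ * G / u ^ p.α κ := by gcongr
    _ = s * p.C κ * G * u ^ (-p.α κ) := by rw [Real.rpow_neg hu.le, div_eq_mul_inv]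

lemma continuousAt_relPower (hu : 0 < u) :
    ContinuousAt (fun y : ℝ × ℝ => p.relPower κ y.1 G y.2) (s, u) := by
  have hdist : 0 < u ^ 2 + p.Δh ^ 2 := by positivity
  exact ContinuousAt.div (by fun_prop)
    (continuousAt_const.mul (ContinuousAt.rpow_const (by fun_prop) (Or.inl hdist.ne')))
    (mul_ne_zero (p.N_cast_pos κ).ne' (Real.rpow_pos_of_pos hdist _).ne')

lemma continuousAt_loss (hs : 0 ≤ s) (hG : 0 ≤ G) (hu : 0 < u) :
    ContinuousAt (fun y : ℝ × ℝ => p.loss κ y.1 G y.2) (s, u) := by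
  have hnonneg := relPower_nonneg (p := p) (κ := κ) hs hG u
  exact continuousAt_const.sub (ContinuousAt.inv₀
    ((continuousAt_const.add (continuousAt_relPower hu)).pow _) (by positivity))

lemma measurable_loss (κ : Link) (G : ℝ) :
    Measurable (fun y : ℝ × ℝ => p.loss κ y.1 G y.2) := by
  unfold loss relPower
  fun_prop

lemma hasDerivAt_relPower (hu : 0 < u) :
    HasDerivAt (p.relPower κ s G)
      (-(p.α κ * u / (u ^ 2 + p.Δh ^ 2)) * p.relPower κ s G u) u := by
  have hdist : 0 < u ^ 2 + p.Δh ^ 2 := by positivity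
  have : 0 < (u ^ 2 + p.Δh ^ 2) ^ (p.α κ / 2) := Real.rpow_pos_of_pos hdist _
  have hN := p.N_cast_pos κ
  have hden := (((hasDerivAt_pow 2 u).add_const (p.Δh ^ 2)).rpow_const (p := p.α κ / 2)
    (Or.inl hdist.ne')).const_mul (p.N κ : ℝ)
  refine ((hasDerivAt_const u (s * p.C κ * G)).div hden (by positivity)).congr_deriv ?_
  rw [Real.rpow_sub_one hdist.ne', relPower]
  field_simp
  ring

lemma hasDerivAt_neg_sq_mul_F (hu : 0 < u) (hpos : 0 < p.relPower κ s G u) :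
    HasDerivAt (fun u => -((u ^ 2 + p.Δh ^ 2) / 2 * p.F κ (p.relPower κ s G u)))
      (u * p.loss κ s G u) u := by
  have hα := p.two_le_α κ
  have hsq := ((hasDerivAt_pow 2 u).add_const (p.Δh ^ 2)).div_const 2
  have hF := (p.hasDerivAt_F κ hpos).comp u (hasDerivAt_relPower hu)
  refine (hsq.mul hF).neg.congr_deriv ?_
  simp only [loss, Function.comp_apply]
  field_simp
  ring

lemma Z_eq_integral (κ : Link) {a b : ℝ} (hs : 0 ≤ s) (hG : 0 ≤ G) (ha : 0 < a)
    (hab : a ≤ b) : p.Z κ s a b G = ∫ u in a..b, u * p.loss κ s G u := by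
  have hC := p.C_pos κ
  have hN := p.N_cast_pos κ
  rcases (mul_nonneg (mul_nonneg hs hC.le) hG).eq_or_lt with hzero | hpos
  · have hloss (u : ℝ) : p.loss κ s G u = 0 := by simp [loss, relPower, ← hzero]
    simp [Z, ← hzero, F_zero, hloss]
  have hsub {u : ℝ} (hu : u ∈ Set.uIcc a b) : 0 < u :=
    ha.trans_le (Set.uIcc_of_le hab ▸ hu).1
  have hcont : ContinuousOn (fun u => u * p.loss κ s G u) (Set.uIcc a b) := fun u hu =>
    (continuousAt_id.mul (ContinuousAt.comp (f := fun u => (s, u))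
      (continuousAt_loss hs hG (hsub hu)) (by fun_prop))).continuousWithinAt
  rw [intervalIntegral.integral_eq_sub_of_hasDerivAt (fun u hu => hasDerivAt_neg_sq_mul_F (hsub hu)
    (div_pos hpos (mul_pos hN (Real.rpow_pos_of_pos (by have := hsub hu; positivity) _))))
    hcont.intervalIntegrable]
  simp only [Z, relPower]
  ring

end Loss

section LinkProbability

variable {p : Params}

/-- The exponent in the probability that the `n`-th of the obstacles at blockage level `γ` is not
tall enough to cut the link. -/
def clearance (p : Params) (γ n : ℕ) : ℝ :=
  (γ * max p.hv p.hb - (n + 1 / 2) * |p.hv - p.hb|) ^ 2 / (2 * p.ε ^ 2 * γ ^ 2)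

lemma pLOS_eq_prod {γ : ℕ} (hγ : γ ≠ 0) :
    p.pLOS γ = ∏ n ∈ Finset.range (γ + 1), (1 - Real.exp (-p.clearance γ n)) :=
  if_neg hγ

lemma one_sub_exp_neg_clearance_mem_Icc (γ n : ℕ) :
    1 - Real.exp (-p.clearance γ n) ∈ Set.Icc (0 : ℝ) 1 := by
  have hclear : 0 ≤ p.clearance γ n := by
    unfold clearance
    positivity
  exact ⟨sub_nonneg.2 (Real.exp_le_one_iff.2 (neg_nonpos.2 hclear)),
    sub_le_self _ (Real.exp_pos _).le⟩

lemma pLOS_mem_Icc (γ : ℕ) : p.pLOS γ ∈ Set.Icc (0 : ℝ) 1 := by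
  rcases eq_or_ne γ 0 with rfl | hγ
  · simp [pLOS]
  rw [pLOS_eq_prod hγ]
  exact ⟨Finset.prod_nonneg fun n _ => (one_sub_exp_neg_clearance_mem_Icc γ n).1,
    Finset.prod_le_one (fun n _ => (one_sub_exp_neg_clearance_mem_Icc γ n).1)
      fun n _ => (one_sub_exp_neg_clearance_mem_Icc γ n).2⟩

lemma prob_LOS_add_prob_NLOS (γ : ℕ) : p.prob Link.LOS γ + p.prob Link.NLOS γ = 1 := by
  simp [prob]

lemma prob_nonneg (κ : Link) (γ : ℕ) : 0 ≤ p.prob κ γ := by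
  cases κ
  · exact (pLOS_mem_Icc γ).1
  · exact sub_nonneg.2 (pLOS_mem_Icc γ).2

lemma prob_le_one (κ : Link) (γ : ℕ) : p.prob κ γ ≤ 1 := by
  cases κ
  · exact (pLOS_mem_Icc γ).2
  · exact sub_le_self _ (pLOS_mem_Icc γ).1

lemma clearance_le {γ n : ℕ} (hγ : γ ≠ 0) (hn : n ≤ γ) :
    p.clearance γ n ≤ (max p.hv p.hb + 2 * |p.hv - p.hb|) ^ 2 / (2 * p.ε ^ 2) := by
  have hε := p.ε_pos
  have hγ₁ : (1 : ℝ) ≤ γ := Nat.one_le_cast.2 (Nat.one_le_iff_ne_zero.2 hγ)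
  have hnγ : (n : ℝ) ≤ γ := Nat.cast_le.2 hn
  have hmax : 0 ≤ max p.hv p.hb := le_max_of_le_left p.hv_nonneg
  have hdiff := abs_nonneg (p.hv - p.hb)
  have habs : |γ * max p.hv p.hb - (n + 1 / 2) * (|p.hv - p.hb|)|
      ≤ γ * (max p.hv p.hb + 2 * |p.hv - p.hb|) := by
    have : (0 : ℝ) ≤ n := n.cast_nonneg
    rw [abs_le]
    constructor <;> nlinarith
  rw [clearance, ← sq_abs]
  calc |γ * max p.hv p.hb - (n + 1 / 2) * (|p.hv - p.hb|)| ^ 2 / (2 * p.ε ^ 2 * γ ^ 2)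
      ≤ (γ * (max p.hv p.hb + 2 * |p.hv - p.hb|)) ^ 2 / (2 * p.ε ^ 2 * γ ^ 2) := by gcongr
    _ = (max p.hv p.hb + 2 * |p.hv - p.hb|) ^ 2 / (2 * p.ε ^ 2) := by field_simp

lemma exists_pLOS_le_exp (p : Params) :
    ∃ θ > 0, ∀ γ : ℕ, p.pLOS γ ≤ Real.exp (-(θ * γ)) := by
  set θ := Real.exp (-((max p.hv p.hb + 2 * |p.hv - p.hb|) ^ 2 / (2 * p.ε ^ 2)))
  have hθ_pos : 0 < θ := Real.exp_pos _
  refine ⟨θ, hθ_pos, fun γ => ?_⟩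
  rcases eq_or_ne γ 0 with rfl | hγ
  · simp [pLOS]
  have hfactor {n : ℕ} (hn : n ∈ Finset.range (γ + 1)) :
      1 - Real.exp (-p.clearance γ n) ≤ Real.exp (-θ) := by
    have hclear := clearance_le (p := p) hγ (Nat.lt_succ_iff.1 (Finset.mem_range.1 hn))
    exact (sub_le_sub_left (Real.exp_le_exp.2 (neg_le_neg hclear)) 1).trans
      (Real.one_sub_le_exp_neg θ)
  calc p.pLOS γ ≤ ∏ _n ∈ Finset.range (γ + 1), Real.exp (-θ) := by
        rw [pLOS_eq_prod hγ]
        exact Finset.prod_le_prod (fun n _ => (one_sub_exp_neg_clearance_mem_Icc γ n).1)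
          fun n => hfactor
    _ = Real.exp (-(θ * (γ + 1))) := by
        rw [Finset.prod_const, Finset.card_range, ← Real.exp_nat_mul]
        push_cast
        ring_nf
    _ ≤ Real.exp (-(θ * γ)) := Real.exp_le_exp.2 (by nlinarith)

lemma measurable_level (p : Params) : Measurable p.level :=
  Nat.measurable_floor.comp (measurable_id.mul_const _)

lemma measurable_prob_level (κ : Link) : Measurable (fun u => p.prob κ (p.level u)) :=
  (measurable_from_nat (f := p.prob κ)).comp p.measurable_level

lemma level_div_le {r : ℝ} (hr : 0 ≤ r) : p.level r / p.ρ ≤ r :=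
  (div_le_iff₀ p.ρ_pos).2 (Nat.floor_le (mul_nonneg hr p.ρ_pos.le))

lemma lt_level_add_one_div (r : ℝ) : r < (p.level r + 1) / p.ρ :=
  (lt_div_iff₀ p.ρ_pos).2 (Nat.lt_floor_add_one _)

lemma level_eq {u : ℝ} {j : ℕ} (hj : j / p.ρ ≤ u) (hu : u < (j + 1) / p.ρ) : p.level u = j :=
  (Nat.floor_eq_iff (mul_nonneg ((div_nonneg j.cast_nonneg p.ρ_pos.le).trans hj) p.ρ_pos.le)).2
    ⟨(div_le_iff₀ p.ρ_pos).1 hj, (lt_div_iff₀ p.ρ_pos).1 hu⟩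

end LinkProbability

end Params

namespace Params

section Rings

variable {p : Params} {κ : Link} {s t G u r : ℝ}

/-- The integrand of `Θ` in polar coordinates: the radius times the loss, thinned by the
probability of the link state. -/
def thinnedLoss (p : Params) (κ : Link) (s G u : ℝ) : ℝ :=
  u * (p.prob κ (p.level u) * p.loss κ s G u)

lemma measurable_thinnedLoss (κ : Link) (s G : ℝ) : Measurable (p.thinnedLoss κ s G) :=
  measurable_id.mul ((measurable_prob_level κ).mul
    ((measurable_loss κ G).comp measurable_prodMk_left))

lemma thinnedLoss_nonneg (hs : 0 ≤ s) (hG : 0 ≤ G) (hu : 0 ≤ u) : 0 ≤ p.thinnedLoss κ s G u :=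
  mul_nonneg hu (mul_nonneg (prob_nonneg _ _) (loss_nonneg hs hG u))

lemma thinnedLoss_le_mul_prob (hs : 0 ≤ s) (hG : 0 ≤ G) (hu : 0 ≤ u) :
    p.thinnedLoss κ s G u ≤ u * p.prob κ (p.level u) :=
  mul_le_mul_of_nonneg_left
    (mul_le_of_le_one_right (prob_nonneg _ _) (loss_lt_one hs hG u).le) hu

lemma thinnedLoss_le_rpow (hs : 0 ≤ s) (hG : 0 ≤ G) (hu : 0 < u) :
    p.thinnedLoss κ s G u ≤ s * p.C κ * G * u ^ (1 - p.α κ) :=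
  calc p.thinnedLoss κ s G u ≤ u * (1 * (s * p.C κ * G * u ^ (-p.α κ))) :=
        mul_le_mul_of_nonneg_left (mul_le_mul (prob_le_one _ _) (loss_le_rpow hs hG hu)
          (loss_nonneg hs hG u) zero_le_one) hu.le
    _ = s * p.C κ * G * u ^ (1 - p.α κ) := by
        rw [sub_eq_add_neg, Real.rpow_add hu, Real.rpow_one]
        ring

lemma integrableOn_thinnedLoss_of_le {A : Set ℝ} {g : ℝ → ℝ} (hs : 0 ≤ s) (hG : 0 ≤ G)
    (hA : MeasurableSet A) (hpos : A ⊆ Set.Ioi 0) (hg : IntegrableOn g A)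
    (hle : ∀ u ∈ A, p.thinnedLoss κ s G u ≤ g u) : IntegrableOn (p.thinnedLoss κ s G) A := by
  refine Integrable.mono' hg (measurable_thinnedLoss κ s G).aestronglyMeasurable ?_
  filter_upwards [ae_restrict_mem hA] with u hu
  rw [Real.norm_of_nonneg (thinnedLoss_nonneg hs hG (le_of_lt (hpos hu)))]
  exact hle u hu

-- For `α = 2` the loss alone is not integrable: the exponential decay of `pLOS` is needed.
lemma integrableOn_thinnedLoss_LOS (hs : 0 ≤ s) (hG : 0 ≤ G) :
    IntegrableOn (p.thinnedLoss Link.LOS s G) (Set.Ioi 0) := by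
  obtain ⟨θ, hθ, hle⟩ := p.exists_pLOS_le_exp
  have hint := integrableOn_rpow_mul_exp_neg_mul_rpow (p := 1) (s := 1) (b := θ * p.ρ)
    (by norm_num) (by norm_num) (mul_pos hθ p.ρ_pos)
  refine integrableOn_thinnedLoss_of_le hs hG measurableSet_Ioi subset_rfl
    (hint.const_mul (Real.exp θ)) fun u (hu : 0 < u) => ?_
  have hprob : p.prob Link.LOS (p.level u) ≤ Real.exp θ * Real.exp (-(θ * p.ρ) * u) := by
    have hlevel : u * p.ρ < p.level u + 1 := Nat.lt_floor_add_one _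
    rw [← Real.exp_add]
    exact (hle _).trans (Real.exp_le_exp.2 (by nlinarith))
  calc p.thinnedLoss Link.LOS s G u ≤ u * p.prob Link.LOS (p.level u) :=
        thinnedLoss_le_mul_prob hs hG hu.le
    _ ≤ u * (Real.exp θ * Real.exp (-(θ * p.ρ) * u)) := mul_le_mul_of_nonneg_left hprob hu.le
    _ = Real.exp θ * (u ^ (1 : ℝ) * Real.exp (-(θ * p.ρ) * u ^ (1 : ℝ))) := by
        rw [Real.rpow_one]
        ring

lemma integrableOn_thinnedLoss_NLOS (hs : 0 ≤ s) (hG : 0 ≤ G) :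
    IntegrableOn (p.thinnedLoss Link.NLOS s G) (Set.Ioi 0) := by
  rw [← Set.Ioc_union_Ioi_eq_Ioi zero_le_one]
  refine IntegrableOn.union ?_ ?_
  · refine integrableOn_thinnedLoss_of_le (g := fun _ => 1) hs hG measurableSet_Ioc
      (fun u hu => hu.1) (by simp) fun u hu => ?_
    exact (thinnedLoss_le_mul_prob hs hG hu.1.le).trans
      (mul_le_one₀ hu.2 (prob_nonneg _ _) (prob_le_one _ _))
  · have hint := integrableOn_Ioi_rpow_of_lt (a := 1 - p.α Link.NLOS)
      (by linarith [p.α_NLOS]) one_pos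
    exact integrableOn_thinnedLoss_of_le hs hG measurableSet_Ioi
      (Set.Ioi_subset_Ioi zero_le_one) (hint.const_mul (s * p.C Link.NLOS * G))
      fun u hu => thinnedLoss_le_rpow hs hG (zero_lt_one.trans hu)

lemma integrableOn_thinnedLoss (κ : Link) (hs : 0 ≤ s) (hG : 0 ≤ G) :
    IntegrableOn (p.thinnedLoss κ s G) (Set.Ioi 0) := by
  cases κ
  · exact integrableOn_thinnedLoss_LOS hs hG
  · exact integrableOn_thinnedLoss_NLOS hs hG

lemma gain_nonneg (i : Fin 4) : 0 ≤ p.gain i := by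
  have := p.Mt_pos.le
  have := p.Mr_pos.le
  have := p.mt_nonneg
  have := p.mr_nonneg
  fin_cases i <;> simp only [gain] <;> exact mul_nonneg ‹_› ‹_›

lemma gain_zero_pos (p : Params) : 0 < p.gain 0 := mul_pos p.Mt_pos p.Mr_pos

lemma beamwidth_fraction_mem_Icc {a b : ℝ} (ha : a ∈ Set.Icc 0 (2 * Real.pi))
    (hb : b ∈ Set.Icc 0 Real.pi) : a / (2 * Real.pi) * (b / Real.pi) ∈ Set.Icc (0 : ℝ) 1 := by
  have hπ := Real.pi_pos
  have ha_div : 0 ≤ a / (2 * Real.pi) := div_nonneg ha.1 (by positivity)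
  have hb_div : 0 ≤ b / Real.pi := div_nonneg hb.1 hπ.le
  exact ⟨mul_nonneg ha_div hb_div, mul_le_one₀ ((div_le_one (by positivity)).2 ha.2) hb_div
    ((div_le_one hπ).2 hb.2)⟩

lemma gainProb_nonneg (i : Fin 4) : 0 ≤ p.gainProb i := by
  obtain ⟨hqt, hqt'⟩ : p.qt ∈ Set.Icc (0 : ℝ) 1 :=
    beamwidth_fraction_mem_Icc p.θta_mem p.θte_mem
  obtain ⟨hqr, hqr'⟩ : p.qr ∈ Set.Icc (0 : ℝ) 1 :=
    beamwidth_fraction_mem_Icc p.θra_mem p.θre_mem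
  rw [← sub_nonneg] at hqt' hqr'
  fin_cases i <;> simp only [gainProb] <;> exact mul_nonneg ‹_› ‹_›

lemma sum_gainProb (p : Params) : ∑ i, p.gainProb i = 1 := by
  simp only [Fin.sum_univ_four, gainProb, Matrix.cons_val]
  ring

lemma prob_mul_Z_eq_integral (κ : Link) {a b : ℝ} {j : ℕ} (hs : 0 ≤ s) (hG : 0 ≤ G) (ha : 0 < a)
    (hab : a ≤ b) (hj : j / p.ρ ≤ a) (hb : b ≤ (j + 1) / p.ρ) :
    p.prob κ j * p.Z κ s a b G = ∫ u in a..b, p.thinnedLoss κ s G u := by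
  rw [Z_eq_integral κ hs hG ha hab, ← intervalIntegral.integral_const_mul]
  refine intervalIntegral.integral_congr_Ioo_of_le hab fun u hu => ?_
  rw [thinnedLoss, level_eq (hj.trans hu.1.le) (hu.2.trans_le hb)]
  ring

lemma ringTerm_eq_integral (κ : Link) (hs : 0 ≤ s) (i : Fin 4) {j : ℕ} (hj : 0 < j) :
    p.ringTerm κ s i j = ∫ u in j / p.ρ..(j + 1) / p.ρ, p.thinnedLoss κ s (p.gain i) u := by
  have hρ := p.ρ_pos
  exact prob_mul_Z_eq_integral κ hs (gain_nonneg i) (div_pos (Nat.cast_pos.2 hj) hρ)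
    (div_le_div_of_nonneg_right (le_add_of_nonneg_right zero_le_one) hρ.le) le_rfl le_rfl

lemma monotone_natCast_div_ρ (p : Params) : Monotone fun j : ℕ => j / p.ρ :=
  fun _ _ hij => div_le_div_of_nonneg_right (Nat.cast_le.2 hij) p.ρ_pos.le

lemma tendsto_natCast_div_ρ (p : Params) : Tendsto (fun j : ℕ => j / p.ρ) atTop atTop :=
  tendsto_natCast_atTop_atTop.atTop_div_const p.ρ_pos

lemma hasSum_ringTerm (κ : Link) (hs : 0 ≤ s) (i : Fin 4) {n : ℕ} (hn : 0 < n) :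
    HasSum (fun j => p.ringTerm κ s i (n + j))
      (∫ u in Set.Ioi (n / p.ρ), p.thinnedLoss κ s (p.gain i) u) := by
  have hint : IntegrableOn (p.thinnedLoss κ s (p.gain i)) (Set.Ioi (n / p.ρ)) :=
    (integrableOn_thinnedLoss κ hs (gain_nonneg i)).mono_set
      (Set.Ioi_subset_Ioi (div_nonneg n.cast_nonneg p.ρ_pos.le))
  have hsum := hasSum_integral_adjacent_intervals (a := fun j => (n + j : ℕ) / p.ρ)
    (fun _ _ hij => p.monotone_natCast_div_ρ (Nat.add_le_add_left hij n))
    (p.tendsto_natCast_div_ρ.comp (tendsto_add_atTop_nat n |>.congr fun j => add_comm j n)) hint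
  refine hsum.congr_fun fun j => ?_
  rw [ringTerm_eq_integral κ hs i (Nat.add_pos_left hn j), ← add_assoc, Nat.cast_succ]

lemma summable_ringTerm (κ : Link) (hs : 0 ≤ s) (i : Fin 4) : Summable (p.ringTerm κ s i) := by
  rw [← summable_nat_add_iff 1]
  simpa only [add_comm 1] using (hasSum_ringTerm κ hs i one_pos).summable

lemma Θ_eq_integral (κ : Link) (hs : 0 ≤ s) (i : Fin 4) (hr : 0 < r) :
    p.Θ κ s i r = ∫ u in Set.Ioi r, p.thinnedLoss κ s (p.gain i) u := by
  have hlt := (p.lt_level_add_one_div r).le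
  have hint := integrableOn_thinnedLoss (p := p) κ hs (gain_nonneg (p := p) i)
  rw [Θ, (hasSum_ringTerm κ hs i (p.level r).succ_pos).tsum_eq, Nat.cast_succ,
    prob_mul_Z_eq_integral κ hs (gain_nonneg i) hr hlt (level_div_le hr.le) le_rfl]
  exact intervalIntegral.integral_interval_add_Ioi (hint.mono_set (Set.Ioi_subset_Ioi hr.le))
    (hint.mono_set (Set.Ioi_subset_Ioi (hr.le.trans hlt)))

end Rings

section Laplace

variable {p : Params} {s t u r : ℝ}

/-- One minus the Laplace transform, at `s`, of the power received from an interferer at the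
horizontal distance `u`, averaged over its link state and directivity gain. -/
def meanLoss (p : Params) (s u : ℝ) : ℝ :=
  ∑ i, p.gainProb i * (p.prob Link.LOS (p.level u) * p.loss Link.LOS s (p.gain i) u
    + p.prob Link.NLOS (p.level u) * p.loss Link.NLOS s (p.gain i) u)

lemma mul_meanLoss (s u : ℝ) : u * p.meanLoss s u = ∑ i, p.gainProb i *
    (p.thinnedLoss Link.LOS s (p.gain i) u + p.thinnedLoss Link.NLOS s (p.gain i) u) := by
  simp only [meanLoss, thinnedLoss, Finset.mul_sum]
  exact Finset.sum_congr rfl fun i _ => by ring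

lemma integrableOn_mul_meanLoss (hs : 0 ≤ s) :
    IntegrableOn (fun u => u * p.meanLoss s u) (Set.Ioi 0) := by
  simp only [mul_meanLoss]
  exact integrable_finsetSum _ fun i _ =>
    ((integrableOn_thinnedLoss _ hs (gain_nonneg i)).add
      (integrableOn_thinnedLoss _ hs (gain_nonneg i))).const_mul _

/-- The Laplace transform, at `s`, of the interference from beyond the distance `r`, as it comes
out of the Poisson process; it agrees with the closed form `laplace` for `0 ≤ s` and `0 < r`. -/
def laplaceIntegral (p : Params) (s r : ℝ) : ℝ :=
  Real.exp (-(2 * Real.pi * p.lam * ∫ u in Set.Ioi r, u * p.meanLoss s u))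

lemma laplace_eq_laplaceIntegral (hs : 0 ≤ s) (hr : 0 < r) :
    p.laplace s r = p.laplaceIntegral s r := by
  have hint (κ : Link) (i : Fin 4) :
      IntegrableOn (p.thinnedLoss κ s (p.gain i)) (Set.Ioi r) :=
    (integrableOn_thinnedLoss κ hs (gain_nonneg i)).mono_set (Set.Ioi_subset_Ioi hr.le)
  have hsum : ∫ u in Set.Ioi r, u * p.meanLoss s u
      = ∑ i, p.gainProb i * (p.Θ Link.LOS s i r + p.Θ Link.NLOS s i r) := by
    have hint_add (i : Fin 4) : IntegrableOn (fun u => p.thinnedLoss Link.LOS s (p.gain i) u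
        + p.thinnedLoss Link.NLOS s (p.gain i) u) (Set.Ioi r) :=
      (hint Link.LOS i).add (hint Link.NLOS i)
    simp only [mul_meanLoss]
    rw [integral_finsetSum _ fun i _ => (hint_add i).const_mul (p.gainProb i)]
    refine Finset.sum_congr rfl fun i _ => ?_
    rw [integral_const_mul, integral_add (hint _ i) (hint _ i), Θ_eq_integral _ hs i hr,
      Θ_eq_integral _ hs i hr]
  rw [laplace, laplaceIntegral, hsum]

lemma meanLoss_nonneg (hs : 0 ≤ s) (u : ℝ) : 0 ≤ p.meanLoss s u :=
  Finset.sum_nonneg fun i _ => mul_nonneg (gainProb_nonneg i)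
    (add_nonneg (mul_nonneg (prob_nonneg _ _) (loss_nonneg hs (gain_nonneg i) u))
      (mul_nonneg (prob_nonneg _ _) (loss_nonneg hs (gain_nonneg i) u)))

lemma meanLoss_mono (hs : 0 ≤ s) (hst : s ≤ t) (u : ℝ) : p.meanLoss s u ≤ p.meanLoss t u :=
  Finset.sum_le_sum fun i _ => mul_le_mul_of_nonneg_left
    (add_le_add (mul_le_mul_of_nonneg_left (loss_mono hs hst (gain_nonneg i) u) (prob_nonneg _ _))
      (mul_le_mul_of_nonneg_left (loss_mono hs hst (gain_nonneg i) u) (prob_nonneg _ _)))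
    (gainProb_nonneg i)

lemma measurable_meanLoss (p : Params) (s : ℝ) : Measurable (p.meanLoss s) := by
  have hthinned (κ : Link) (i : Fin 4) :
      Measurable fun u => p.prob κ (p.level u) * p.loss κ s (p.gain i) u :=
    (measurable_prob_level κ).mul ((measurable_loss κ _).comp measurable_prodMk_left)
  exact Finset.measurable_fun_sum _ fun i _ => ((hthinned _ i).add (hthinned _ i)).const_mul _

lemma continuousAt_meanLoss_left (hs : 0 ≤ s) (hu : 0 < u) :
    ContinuousAt (fun s => p.meanLoss s u) s := by
  have hloss (κ : Link) (i : Fin 4) : ContinuousAt (fun s => p.loss κ s (p.gain i) u) s :=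
    ContinuousAt.comp (f := fun s => (s, u)) (continuousAt_loss hs (gain_nonneg i) hu)
      (by fun_prop)
  exact tendsto_finsetSum _ fun i _ => ((((hloss Link.LOS i).const_mul _).add
    ((hloss Link.NLOS i).const_mul _)).const_mul _).tendsto

lemma laplaceIntegral_le_one (hs : 0 ≤ s) (hr : 0 ≤ r) : p.laplaceIntegral s r ≤ 1 := by
  have hintegral : 0 ≤ ∫ u in Set.Ioi r, u * p.meanLoss s u :=
    setIntegral_nonneg measurableSet_Ioi fun u hu =>
      mul_nonneg (hr.trans (le_of_lt hu)) (meanLoss_nonneg hs u)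
  have hlam := p.lam_pos
  have := Real.pi_pos
  exact Real.exp_le_one_iff.2 (neg_nonpos.2 (by positivity))

lemma laplaceIntegral_pos (s r : ℝ) : 0 < p.laplaceIntegral s r := Real.exp_pos _

lemma tendsto_laplaceIntegral {ι : Type*} {l : Filter ι} [l.IsCountablyGenerated] {s r : ι → ℝ}
    {s₀ r₀ : ℝ} (hs : Tendsto s l (𝓝 s₀)) (hr : Tendsto r l (𝓝 r₀))
    (hs_nonneg : ∀ᶠ i in l, 0 ≤ s i) (hr_nonneg : ∀ᶠ i in l, 0 ≤ r i) (hs₀ : 0 ≤ s₀) :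
    Tendsto (fun i => p.laplaceIntegral (s i) (r i)) l (𝓝 (p.laplaceIntegral s₀ r₀)) := by
  have hintegral : Tendsto (fun i => ∫ u in Set.Ioi (r i), u * p.meanLoss (s i) u) l
      (𝓝 (∫ u in Set.Ioi r₀, u * p.meanLoss s₀ u)) := by
    refine tendsto_setIntegral_Ioi_of_dominated
      (fun _ => (measurable_id.mul (p.measurable_meanLoss _)).aestronglyMeasurable) ?_
      (integrableOn_mul_meanLoss (p := p) (s := s₀ + 1) (by linarith))
      (fun u hu => ((continuousAt_meanLoss_left hs₀ hu).tendsto.comp hs).const_mul u) hr hr_nonneg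
    filter_upwards [hs_nonneg, hs.eventually_le_const (lt_add_one s₀)] with i hsi hle u hu
    rw [Real.norm_of_nonneg (mul_nonneg (le_of_lt hu) (meanLoss_nonneg hsi u))]
    exact mul_le_mul_of_nonneg_left (meanLoss_mono hsi hle u) (le_of_lt hu)
  exact (Real.continuous_exp.tendsto _).comp (hintegral.const_mul _).neg

end Laplace

end Params

/-! ### The density of the coverage probability -/

namespace Params

section CoverDensity

variable {p : Params} {Υ r ζ : ℝ}

/-- The argument of `laplace` in the `n`-th term of `Ψ`. -/
def laplaceArg (p : Params) (κ : Link) (Υ : ℝ) (n : ℕ) (r : ℝ) : ℝ :=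
  n * p.η κ * Υ / (p.gain 0 * p.C κ * (r ^ 2 + p.Δh ^ 2) ^ (-(p.α κ / 2)))

/-- The exponent of the noise factor in the `n`-th term of `Ψ`. -/
def noiseArg (p : Params) (κ : Link) (Υ : ℝ) (n : ℕ) (r : ℝ) : ℝ :=
  n * p.η κ * Υ * p.noise / (p.Pv * p.gain 0 * p.C κ * (r ^ 2 + p.Δh ^ 2) ^ (-(p.α κ / 2)))

lemma noiseArg_eq (κ : Link) (Υ : ℝ) (n : ℕ) (r : ℝ) :
    p.noiseArg κ Υ n r = p.noise / p.Pv * p.laplaceArg κ Υ n r := by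
  rw [noiseArg, laplaceArg, div_mul_div_comm]
  congr 1 <;> ring

lemma η_pos (κ : Link) : 0 < p.η κ := by
  have := p.N_cast_pos κ
  unfold η
  positivity

lemma laplaceArg_nonneg (κ : Link) (hΥ : 0 < Υ) (n : ℕ) (r : ℝ) : 0 ≤ p.laplaceArg κ Υ n r := by
  have := p.η_pos κ
  have := p.gain_zero_pos
  have := p.C_pos κ
  unfold laplaceArg
  positivity

lemma noiseArg_nonneg (κ : Link) (hΥ : 0 < Υ) (n : ℕ) (r : ℝ) : 0 ≤ p.noiseArg κ Υ n r := by
  rw [noiseArg_eq]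
  exact mul_nonneg (div_pos p.noise_pos p.Pv_pos).le (laplaceArg_nonneg κ hΥ n r)

lemma continuousAt_laplaceArg (κ : Link) (Υ : ℝ) (n : ℕ) (hr : 0 < r) :
    ContinuousAt (p.laplaceArg κ Υ n) r := by
  have hdist : 0 < r ^ 2 + p.Δh ^ 2 := by positivity
  have := Real.rpow_pos_of_pos hdist (-(p.α κ / 2))
  have := p.gain_zero_pos
  have := p.C_pos κ
  exact continuousAt_const.div (continuousAt_const.mul
    (ContinuousAt.rpow_const (by fun_prop) (Or.inl hdist.ne'))) (by positivity)

/-- The `n`-th term of `Ψ` without its coefficient, with the Laplace transform of the interference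
in the integral form `laplaceIntegral`. -/
def coverTerm (p : Params) (κ : Link) (Υ : ℝ) (n : ℕ) (r : ℝ) : ℝ :=
  Real.exp (-p.noiseArg κ Υ n r) * p.laplaceIntegral (p.laplaceArg κ Υ n r) r * p.nearestPDF r

lemma Ψ_eq_sum_coverTerm (κ : Link) (hΥ : 0 < Υ) (hr : 0 < r) :
    p.Ψ κ r Υ = ∑ n ∈ Finset.Icc 1 (p.N κ), (-1 : ℝ) ^ (n + 1) * (p.N κ).choose n
      * p.coverTerm κ Υ n r := by
  refine Finset.sum_congr rfl fun n _ => ?_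
  rw [coverTerm, ← laplace_eq_laplaceIntegral (laplaceArg_nonneg κ hΥ n r) hr, noiseArg,
    laplaceArg]
  ring

lemma nearestPDF_nonneg (hr : 0 ≤ r) : 0 ≤ p.nearestPDF r := by
  have := p.lam_pos
  unfold nearestPDF
  positivity

lemma continuous_nearestPDF (p : Params) : Continuous p.nearestPDF := by
  unfold nearestPDF
  fun_prop

lemma integrableOn_nearestPDF (p : Params) : IntegrableOn p.nearestPDF (Set.Ioi 0) := by
  have hgauss := (integrable_mul_exp_neg_mul_sq (mul_pos Real.pi_pos p.lam_pos)).const_mul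
    (2 * Real.pi * p.lam)
  refine (hgauss.congr (Eventually.of_forall fun r => ?_)).integrableOn
  simp only [nearestPDF, neg_mul]
  ring

lemma coverTerm_nonneg (κ : Link) (Υ : ℝ) (n : ℕ) (hr : 0 ≤ r) : 0 ≤ p.coverTerm κ Υ n r :=
  mul_nonneg (mul_nonneg (Real.exp_pos _).le (laplaceIntegral_pos _ _).le) (nearestPDF_nonneg hr)

lemma coverTerm_le_nearestPDF (κ : Link) (hΥ : 0 < Υ) (n : ℕ) (hr : 0 ≤ r) :
    p.coverTerm κ Υ n r ≤ p.nearestPDF r :=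
  mul_le_of_le_one_left (nearestPDF_nonneg hr) (mul_le_one₀
    (Real.exp_le_one_iff.2 (neg_nonpos.2 (noiseArg_nonneg κ hΥ n r))) (laplaceIntegral_pos _ _).le
    (laplaceIntegral_le_one (laplaceArg_nonneg κ hΥ n r) hr))

lemma continuousAt_coverTerm (κ : Link) (hΥ : 0 < Υ) (n : ℕ) (hr : 0 < r) :
    ContinuousAt (p.coverTerm κ Υ n) r := by
  have harg := continuousAt_laplaceArg (p := p) κ Υ n hr
  have hnoise : ContinuousAt (p.noiseArg κ Υ n) r := by
    simpa only [← noiseArg_eq] using harg.const_mul (p.noise / p.Pv)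
  have hlaplace : ContinuousAt (fun r => p.laplaceIntegral (p.laplaceArg κ Υ n r) r) r :=
    tendsto_laplaceIntegral harg tendsto_id
      (Eventually.of_forall fun r => laplaceArg_nonneg κ hΥ n r)
      ((lt_mem_nhds hr).mono fun _ h => h.le) (laplaceArg_nonneg κ hΥ n r)
  exact (hnoise.neg.rexp.mul hlaplace).mul p.continuous_nearestPDF.continuousAt

lemma continuousAt_Ψ (κ : Link) (hΥ : 0 < Υ) (hr : 0 < r) :
    ContinuousAt (fun r => p.Ψ κ r Υ) r := by
  have hsum : ContinuousAt (fun r => ∑ n ∈ Finset.Icc 1 (p.N κ), (-1 : ℝ) ^ (n + 1)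
      * (p.N κ).choose n * p.coverTerm κ Υ n r) r :=
    tendsto_finsetSum _ fun n _ => ((continuousAt_coverTerm κ hΥ n hr).const_mul _).tendsto
  refine hsum.congr ?_
  filter_upwards [lt_mem_nhds hr] with y hy using (Ψ_eq_sum_coverTerm κ hΥ hy).symm

lemma abs_Ψ_le (κ : Link) (hΥ : 0 < Υ) (hr : 0 < r) :
    |p.Ψ κ r Υ| ≤ 2 ^ p.N κ * p.nearestPDF r := by
  have hpdf := nearestPDF_nonneg (p := p) hr.le
  have hterm (n : ℕ) : |(-1 : ℝ) ^ (n + 1) * (p.N κ).choose n * p.coverTerm κ Υ n r|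
      ≤ (p.N κ).choose n * p.nearestPDF r := by
    rw [abs_mul, abs_mul, abs_neg_one_pow, one_mul, Nat.abs_cast,
      abs_of_nonneg (coverTerm_nonneg κ Υ n hr.le)]
    exact mul_le_mul_of_nonneg_left (coverTerm_le_nearestPDF κ hΥ n hr.le) (Nat.cast_nonneg _)
  rw [Ψ_eq_sum_coverTerm κ hΥ hr]
  calc |∑ n ∈ Finset.Icc 1 (p.N κ), (-1 : ℝ) ^ (n + 1) * (p.N κ).choose n * p.coverTerm κ Υ n r|
      ≤ ∑ n ∈ Finset.Icc 1 (p.N κ), ((p.N κ).choose n : ℝ) * p.nearestPDF r :=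
        (Finset.abs_sum_le_sum_abs _ _).trans (Finset.sum_le_sum fun n _ => hterm n)
    _ ≤ ∑ n ∈ Finset.range (p.N κ + 1), ((p.N κ).choose n : ℝ) * p.nearestPDF r :=
        Finset.sum_le_sum_of_subset_of_nonneg
          (fun n hn => Finset.mem_range_succ_iff.2 (Finset.mem_Icc.1 hn).2)
          fun n _ _ => mul_nonneg (Nat.cast_nonneg _) hpdf
    _ = 2 ^ p.N κ * p.nearestPDF r := by
        rw [← Finset.sum_mul, ← Nat.cast_sum, Nat.sum_range_choose, Nat.cast_pow, Nat.cast_ofNat]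

/-- The density at the distance `r` of the serving UAV of the coverage probability, taken with
Alzer's expression. -/
def coverDensity (p : Params) (Υ r : ℝ) : ℝ :=
  p.prob Link.LOS (p.level r) * p.Ψ Link.LOS r Υ + p.prob Link.NLOS (p.level r) * p.Ψ Link.NLOS r Υ

lemma abs_coverDensity_le (hΥ : 0 < Υ) (hr : 0 < r) :
    |p.coverDensity Υ r| ≤ (2 ^ p.N Link.LOS + 2 ^ p.N Link.NLOS) * p.nearestPDF r := by
  have hterm (κ : Link) : |p.prob κ (p.level r) * p.Ψ κ r Υ| ≤ 2 ^ p.N κ * p.nearestPDF r := by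
    rw [abs_mul, abs_of_nonneg (prob_nonneg _ _)]
    exact (mul_le_of_le_one_left (abs_nonneg _) (prob_le_one _ _)).trans (abs_Ψ_le κ hΥ hr)
  rw [add_mul]
  exact (abs_add_le _ _).trans (add_le_add (hterm _) (hterm _))

lemma integrableOn_coverDensity (hΥ : 0 < Υ) : IntegrableOn (p.coverDensity Υ) (Set.Ioi 0) := by
  have hΨ (κ : Link) : AEStronglyMeasurable (fun r => p.Ψ κ r Υ) (volume.restrict (Set.Ioi 0)) :=
    ContinuousOn.aestronglyMeasurable
      (fun r hr => (continuousAt_Ψ κ hΥ hr).continuousWithinAt) measurableSet_Ioi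
  refine Integrable.mono' (p.integrableOn_nearestPDF.const_mul
    (2 ^ p.N Link.LOS + 2 ^ p.N Link.NLOS)) ?_ ?_
  · exact ((measurable_prob_level _).aestronglyMeasurable.mul (hΨ _)).add
      ((measurable_prob_level _).aestronglyMeasurable.mul (hΨ _))
  · filter_upwards [ae_restrict_mem measurableSet_Ioi] with r hr using abs_coverDensity_le hΥ hr

end CoverDensity

section Quadrature

variable {p : Params} {Υ ζ : ℝ}

/-- The point that the quadrature node `ζ` selects in the ring of blockage level `γ`. -/
def nodeDist (p : Params) (γ : ℕ) (ζ : ℝ) : ℝ := (ζ + 2 * γ + 1) / (2 * p.ρ)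

lemma nodeDist_mem_Ioo (hζ : ζ ∈ Set.Ioo (-1) 1) (γ : ℕ) :
    p.nodeDist γ ζ ∈ Set.Ioo (γ / p.ρ) ((γ + 1) / p.ρ) := by
  have hρ := p.ρ_pos
  constructor
  · rw [nodeDist, div_lt_div_iff₀ hρ (by positivity)]
    nlinarith [hζ.1]
  · rw [nodeDist, div_lt_div_iff₀ (by positivity) hρ]
    nlinarith [hζ.2]

lemma nodeDist_pos (hζ : ζ ∈ Set.Ioo (-1) 1) (γ : ℕ) : 0 < p.nodeDist γ ζ :=
  (div_nonneg γ.cast_nonneg p.ρ_pos.le).trans_lt (nodeDist_mem_Ioo hζ γ).1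

lemma levelTerm_eq_coverDensity (Υ : ℝ) (hζ : ζ ∈ Set.Ioo (-1) 1) (γ : ℕ) :
    p.levelTerm Υ ζ γ = p.coverDensity Υ (p.nodeDist γ ζ) := by
  have hmem := nodeDist_mem_Ioo (p := p) hζ γ
  rw [levelTerm, coverDensity, level_eq hmem.1.le hmem.2, nodeDist]

/-- A summable bound, uniform in the node, for the terms of the blockage levels. -/
def levelBound (p : Params) (γ : ℕ) : ℝ :=
  (2 ^ p.N Link.LOS + 2 ^ p.N Link.NLOS) * (2 * Real.pi * p.lam * ((γ + 1) / p.ρ)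
    * Real.exp (-(Real.pi * p.lam * (γ / p.ρ) ^ 2)))

lemma abs_levelTerm_le (hΥ : 0 < Υ) (hζ : ζ ∈ Set.Ioo (-1) 1) (γ : ℕ) :
    |p.levelTerm Υ ζ γ| ≤ p.levelBound γ := by
  obtain ⟨hlt, hgt⟩ := nodeDist_mem_Ioo (p := p) hζ γ
  have hρ := p.ρ_pos
  have hlam := p.lam_pos
  have hpos := nodeDist_pos (p := p) hζ γ
  rw [levelTerm_eq_coverDensity Υ hζ]
  refine (abs_coverDensity_le hΥ hpos).trans ?_
  unfold levelBound nearestPDF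
  gcongr

lemma summable_levelBound (p : Params) : Summable p.levelBound := by
  have hρ := p.ρ_pos
  have hlam := p.lam_pos
  set c := Real.pi * p.lam / p.ρ ^ 2 with hc
  set K := (2 ^ p.N Link.LOS + 2 ^ p.N Link.NLOS) * (2 * Real.pi * p.lam / p.ρ) with hK
  have hc_pos : 0 < c := by positivity
  have hsummable := ((Real.summable_pow_mul_exp_neg_nat_mul 1 hc_pos).add
    (Real.summable_pow_mul_exp_neg_nat_mul 0 hc_pos)).mul_left K
  refine Summable.of_nonneg_of_le (fun γ => by unfold levelBound; positivity) (fun γ => ?_)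
    hsummable
  have hexp : Real.exp (-(Real.pi * p.lam * (γ / p.ρ) ^ 2)) ≤ Real.exp (-c * γ) := by
    have hsq : (γ : ℝ) ≤ (γ : ℝ) ^ 2 := by exact_mod_cast Nat.le_self_pow two_ne_zero γ
    have hexponent : Real.pi * p.lam * (γ / p.ρ) ^ 2 = c * (γ : ℝ) ^ 2 := by
      rw [hc]
      field_simp
    rw [hexponent, neg_mul]
    gcongr
  calc p.levelBound γ = K * ((γ + 1) * Real.exp (-(Real.pi * p.lam * (γ / p.ρ) ^ 2))) := by
        rw [levelBound, hK]
        ring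
    _ ≤ K * ((γ + 1) * Real.exp (-c * γ)) := by gcongr
    _ = K * ((γ : ℝ) ^ 1 * Real.exp (-c * γ) + (γ : ℝ) ^ 0 * Real.exp (-c * γ)) := by ring

lemma summable_levelTerm (hΥ : 0 < Υ) (hζ : ζ ∈ Set.Ioo (-1) 1) : Summable (p.levelTerm Υ ζ) :=
  Summable.of_norm_bounded p.summable_levelBound fun γ => abs_levelTerm_le hΥ hζ γ

lemma continuousOn_levelTerm (hΥ : 0 < Υ) (γ : ℕ) :
    ContinuousOn (fun ζ => p.levelTerm Υ ζ γ) (Set.Ioo (-1) 1) := by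
  intro ζ hζ
  have hdist : ContinuousAt (p.nodeDist γ) ζ := by
    unfold nodeDist
    fun_prop
  have hΨ (κ : Link) : ContinuousAt (fun ζ => p.Ψ κ (p.nodeDist γ ζ) Υ) ζ :=
    ContinuousAt.comp (f := p.nodeDist γ) (continuousAt_Ψ κ hΥ (nodeDist_pos hζ γ)) hdist
  exact (((hΨ _).const_mul _).add ((hΨ _).const_mul _)).continuousWithinAt

/-- The sum over the blockage levels at the node `ζ`. -/
def nodeSum (p : Params) (Υ ζ : ℝ) : ℝ := ∑' γ : ℕ, p.levelTerm Υ ζ γ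

lemma continuousOn_nodeSum (hΥ : 0 < Υ) : ContinuousOn (p.nodeSum Υ) (Set.Ioo (-1) 1) :=
  continuousOn_tsum (continuousOn_levelTerm hΥ) p.summable_levelBound
    fun γ _ hζ => abs_levelTerm_le hΥ hζ γ

lemma abs_nodeSum_le (hΥ : 0 < Υ) (hζ : ζ ∈ Set.Ioo (-1) 1) :
    |p.nodeSum Υ ζ| ≤ ∑' γ, p.levelBound γ :=
  tsum_of_norm_bounded (f := p.levelTerm Υ ζ) p.summable_levelBound.hasSum
    fun γ => abs_levelTerm_le hΥ hζ γ

lemma integral_levelTerm (Υ : ℝ) (γ : ℕ) :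
    ∫ ζ in (-1)..1, p.levelTerm Υ ζ γ
      = 2 * p.ρ * ∫ u in γ / p.ρ..(γ + 1) / p.ρ, p.coverDensity Υ u := by
  have hρ := p.ρ_pos
  have hshift : ∫ ζ in (-1)..1, p.levelTerm Υ ζ γ
      = ∫ ζ in (-1)..1, p.coverDensity Υ (ζ / (2 * p.ρ) + (2 * γ + 1) / (2 * p.ρ)) :=
    intervalIntegral.integral_congr_Ioo_of_le (by norm_num) fun ζ hζ => by
      rw [levelTerm_eq_coverDensity Υ hζ, nodeDist, add_assoc, add_div]
  rw [hshift, intervalIntegral.integral_comp_div_add _ (by positivity), smul_eq_mul]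
  congr 2 <;> field_simp <;> ring

lemma hasSum_integral_levelTerm (hΥ : 0 < Υ) :
    HasSum (fun γ => ∫ ζ in (-1)..1, p.levelTerm Υ ζ γ) (∫ ζ in (-1)..1, p.nodeSum Υ ζ) := by
  have hmem : ∀ᵐ ζ : ℝ, ζ ∈ Set.uIoc (-1 : ℝ) 1 → ζ ∈ Set.Ioo (-1 : ℝ) 1 := by
    filter_upwards [Measure.ae_ne volume (1 : ℝ)] with ζ hne hζ
    rw [Set.uIoc_of_le (by norm_num)] at hζ
    exact ⟨hζ.1, hζ.2.lt_of_ne hne⟩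
  refine intervalIntegral.hasSum_integral_of_dominated_convergence
    (fun γ _ => p.levelBound γ) (fun γ => ?_) (fun γ => ?_)
    (Eventually.of_forall fun _ _ => p.summable_levelBound) intervalIntegrable_const ?_
  · rw [Set.uIoc_of_le (by norm_num), ← restrict_Ioo_eq_restrict_Ioc]
    exact (continuousOn_levelTerm hΥ γ).aestronglyMeasurable measurableSet_Ioo
  · filter_upwards [hmem] with ζ hζ hIoc using abs_levelTerm_le hΥ (hζ hIoc) γ
  · filter_upwards [hmem] with ζ hζ hIoc using (summable_levelTerm hΥ (hζ hIoc)).hasSum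

lemma integral_nodeSum (hΥ : 0 < Υ) :
    ∫ ζ in (-1)..1, p.nodeSum Υ ζ = 2 * p.ρ * ∫ r in Set.Ioi 0, p.coverDensity Υ r := by
  have hrings := hasSum_integral_adjacent_intervals (f := p.coverDensity Υ)
    p.monotone_natCast_div_ρ p.tendsto_natCast_div_ρ
    (by simpa only [Nat.cast_zero, zero_div] using integrableOn_coverDensity hΥ)
  simp only [Nat.cast_zero, zero_div, Nat.cast_succ] at hrings
  refine (hasSum_integral_levelTerm hΥ).unique ?_
  simpa only [integral_levelTerm] using hrings.mul_left (2 * p.ρ)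

theorem tendsto_quadrature (hΥ : 0 < Υ) :
    Tendsto (p.quadrature Υ) atTop (𝓝 (∫ r in Set.Ioi 0, p.coverDensity Υ r)) := by
  have hρ := p.ρ_pos
  have hlim := (tendsto_gaussChebyshev_of_bounded (continuousOn_nodeSum hΥ)
    fun ζ => abs_nodeSum_le (p := p) hΥ).const_mul (2 * p.ρ)⁻¹
  rw [integral_nodeSum hΥ, inv_mul_cancel_left₀ (by positivity)] at hlim
  refine hlim.congr fun m => ?_
  simp only [quadrature, nodeSum]
  rw [← mul_assoc, inv_mul_eq_div, div_div]
  ring_nf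

end Quadrature

end Params

/-! ### The nearest point -/

lemma integral_mul_ite_lt_one {g : ℝ → ℝ} {a : ℝ} (ha : 0 ≤ a)
    (hg : IntegrableOn (fun r => r * g r) (Set.Ioi a)) :
    IntegrableOn (fun r => r * if r < a then 1 else g r) (Set.Ioi 0) ∧
      ∫ r in Set.Ioi 0, r * (if r < a then 1 else g r)
        = a ^ 2 / 2 + ∫ r in Set.Ioi a, r * g r := by
  have hnear : Set.EqOn (fun r => r * if r < a then 1 else g r) (fun r => r) (Set.Ioo 0 a) :=
    fun r hr => by simp only [hr.2, if_true, mul_one]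
  have hfar : Set.EqOn (fun r => r * if r < a then 1 else g r) (fun r => r * g r) (Set.Ioi a) :=
    fun r hr => by simp only [not_lt.2 (le_of_lt (Set.mem_Ioi.1 hr)), if_false]
  have hint_near : IntegrableOn (fun r => r * if r < a then 1 else g r) (Set.Ioc 0 a) :=
    (integrableOn_Ioc_iff_integrableOn_Ioo (by finiteness)).2
      (((continuous_id.integrableOn_Icc (a := 0) (b := a)).mono_set
        Set.Ioo_subset_Icc_self).congr_fun hnear.symm measurableSet_Ioo)
  have hint_far : IntegrableOn (fun r => r * if r < a then 1 else g r) (Set.Ioi a) :=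
    hg.congr_fun hfar.symm measurableSet_Ioi
  rw [← Set.Ioc_union_Ioi_eq_Ioi ha]
  refine ⟨hint_near.union hint_far, ?_⟩
  rw [setIntegral_union (Set.Ioc_disjoint_Ioi le_rfl) measurableSet_Ioi hint_near hint_far,
    setIntegral_congr_fun measurableSet_Ioi hfar, integral_Ioc_eq_integral_Ioo,
    setIntegral_congr_fun measurableSet_Ioo hnear, ← integral_Ioc_eq_integral_Ioo,
    ← intervalIntegral.integral_of_le ha, integral_id]
  ring

section Nearest

variable {Ω : Type*} [MeasurableSpace Ω] {P : Measure Ω} {v : ℕ → Ω → Plane} {lam : ℝ}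

lemma IsPPP.lintegral_negExp_sum_of_le_norm_nearest [IsProbabilityMeasure P] (h : IsPPP P v lam)
    (hlam : 0 ≤ lam) (hrank : ∀ᵐ ω ∂P, StrictMono fun n => ‖v n ω‖) {f : Plane → ℝ≥0∞}
    (hf : Measurable f) (a : ℝ) :
    ∫⁻ ω, (Set.Ici a).indicator 1 ‖v 0 ω‖ * negExp (∑' n, f (v n ω)) ∂P
      = negExp (∫⁻ y, (1 - (Set.Ici a).indicator 1 ‖y‖ * negExp (f y))
          ∂(ENNReal.ofReal lam • volume)) := by
  -- Infinite weight on the open disc of radius `a` encodes that the disc is empty.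
  set g : Plane → ℝ≥0∞ := fun y => (Set.Iio a).indicator (fun _ => ⊤) ‖y‖ + f y with hg
  have hg_meas : Measurable g :=
    ((measurable_const.indicator measurableSet_Iio).comp measurable_norm).add hf
  have hg_far {y : Plane} (hy : a ≤ ‖y‖) : g y = f y := by
    simp only [hg, Set.indicator_of_notMem (show ‖y‖ ∉ Set.Iio a from not_lt.2 hy), zero_add]
  have hg_near {y : Plane} (hy : ‖y‖ < a) : g y = ⊤ := by
    simp only [hg, Set.indicator_of_mem (show ‖y‖ ∈ Set.Iio a from hy), top_add]
  have hpoint (y : Plane) : (Set.Ici a).indicator 1 ‖y‖ * negExp (f y) = negExp (g y) := by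
    rcases le_or_gt a ‖y‖ with hy | hy
    · rw [hg_far hy, Set.indicator_of_mem (Set.mem_Ici.2 hy), Pi.one_apply, one_mul]
    · rw [hg_near hy, Set.indicator_of_notMem (Set.notMem_Ici.2 hy), zero_mul, negExp_top]
  have hsum : ∀ᵐ ω ∂P, (Set.Ici a).indicator 1 ‖v 0 ω‖ * negExp (∑' n, f (v n ω))
      = negExp (∑' n, g (v n ω)) := by
    filter_upwards [hrank] with ω hω
    rcases le_or_gt a ‖v 0 ω‖ with h0 | h0
    · rw [Set.indicator_of_mem (Set.mem_Ici.2 h0), Pi.one_apply, one_mul]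
      refine congrArg negExp (tsum_congr fun n => ?_)
      have hnearest : ‖v 0 ω‖ ≤ ‖v n ω‖ := hω.monotone n.zero_le
      rw [hg_far (h0.trans hnearest)]
    · have htop : g (v 0 ω) = ⊤ := hg_near h0
      rw [Set.indicator_of_notMem (Set.notMem_Ici.2 h0), zero_mul,
        ENNReal.tsum_eq_top_of_eq_top ⟨0, htop⟩, negExp_top]
  rw [lintegral_congr_ae hsum, h.lintegral_negExp_sum hlam hg_meas]
  simp only [hpoint]

namespace Params

variable {p : Params} {s a r : ℝ}

lemma meanLoss_lt_one (hs : 0 ≤ s) (u : ℝ) : p.meanLoss s u < 1 := by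
  have hlt (i : Fin 4) : p.prob Link.LOS (p.level u) * p.loss Link.LOS s (p.gain i) u
      + p.prob Link.NLOS (p.level u) * p.loss Link.NLOS s (p.gain i) u ∈ Set.Iio 1 :=
    convex_Iio (1 : ℝ) (loss_lt_one hs (gain_nonneg i) u) (loss_lt_one hs (gain_nonneg i) u)
      (prob_nonneg _ _) (prob_nonneg _ _) (prob_LOS_add_prob_NLOS _)
  exact (convex_Iio (1 : ℝ)).sum_mem (fun i _ => gainProb_nonneg i) (sum_gainProb p)
    fun i _ => hlt i

lemma continuousAt_meanLoss_right (hs : 0 ≤ s) (hr : 0 < r)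
    (hgrid : r ∉ Set.range fun j : ℕ => (j : ℝ) / p.ρ) : ContinuousAt (p.meanLoss s) r := by
  have hloss (κ : Link) (i : Fin 4) : ContinuousAt (p.loss κ s (p.gain i)) r :=
    ContinuousAt.comp (f := fun u => (s, u)) (continuousAt_loss hs (gain_nonneg i) hr)
      (by fun_prop)
  have hgrid_lt : (p.level r : ℝ) / p.ρ < r :=
    lt_of_le_of_ne (level_div_le hr.le) fun h => hgrid ⟨_, h⟩
  have hlevel : ∀ᶠ u in 𝓝 r, p.level u = p.level r := by
    filter_upwards [lt_mem_nhds hgrid_lt, gt_mem_nhds (lt_level_add_one_div r)] with u hu hu'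
      using level_eq hu.le hu'
  have hcont : ContinuousAt (fun u => ∑ i, p.gainProb i *
      (p.prob Link.LOS (p.level r) * p.loss Link.LOS s (p.gain i) u
        + p.prob Link.NLOS (p.level r) * p.loss Link.NLOS s (p.gain i) u)) r :=
    tendsto_finsetSum _ fun i _ => ((((hloss Link.LOS i).const_mul _).add
      ((hloss Link.NLOS i).const_mul _)).const_mul _).tendsto
  refine hcont.congr ?_
  filter_upwards [hlevel] with u hu
  rw [meanLoss, hu]

lemma continuousOn_laplaceIntegral_right (hs : 0 ≤ s) :
    ContinuousOn (p.laplaceIntegral s) (Set.Ici 0) := fun _ _ =>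
  tendsto_laplaceIntegral tendsto_const_nhds (tendsto_id.mono_left nhdsWithin_le_nhds)
    (Eventually.of_forall fun _ => hs) self_mem_nhdsWithin hs

/-- The density of the nearest distance, weighted with the Laplace transform at `s` of the power
that would be received if all points, including the nearest one, interfered. -/
def nearestWeight (p : Params) (s r : ℝ) : ℝ :=
  (1 - p.meanLoss s r) * (p.nearestPDF r * p.laplaceIntegral s r)

/-- The integral of `nearestWeight` over `(a, ∞)` for `0 ≤ a`: the probability that there is no
point within the distance `a`, times the Laplace transform of the power from beyond `a`. -/
def nearestTail (p : Params) (s a : ℝ) : ℝ :=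
  Real.exp (-(Real.pi * p.lam * a ^ 2)) * p.laplaceIntegral s a

lemma nearestWeight_nonneg (hs : 0 ≤ s) (hr : 0 ≤ r) : 0 ≤ p.nearestWeight s r :=
  mul_nonneg (sub_nonneg.2 (meanLoss_lt_one hs r).le)
    (mul_nonneg (nearestPDF_nonneg hr) (laplaceIntegral_pos _ _).le)

lemma nearestWeight_le_nearestPDF (hs : 0 ≤ s) (hr : 0 ≤ r) :
    p.nearestWeight s r ≤ p.nearestPDF r :=
  (mul_le_of_le_one_left (mul_nonneg (nearestPDF_nonneg hr) (laplaceIntegral_pos _ _).le)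
    (sub_le_self _ (meanLoss_nonneg hs r))).trans
    (mul_le_of_le_one_right (nearestPDF_nonneg hr) (laplaceIntegral_le_one hs hr))

lemma integrableOn_nearestWeight (hs : 0 ≤ s) :
    IntegrableOn (p.nearestWeight s) (Set.Ioi 0) := by
  refine Integrable.mono' p.integrableOn_nearestPDF ?_ ?_
  · exact (measurable_const.sub (p.measurable_meanLoss s)).aestronglyMeasurable.mul
      (p.continuous_nearestPDF.aestronglyMeasurable.mul
        (((continuousOn_laplaceIntegral_right hs).mono Set.Ioi_subset_Ici_self).aestronglyMeasurable
          measurableSet_Ioi))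
  · filter_upwards [ae_restrict_mem measurableSet_Ioi] with r hr
    rw [Real.norm_of_nonneg (nearestWeight_nonneg hs (le_of_lt hr))]
    exact nearestWeight_le_nearestPDF hs (le_of_lt hr)

lemma hasDerivAt_setIntegral_Ioi_mul_meanLoss (hs : 0 ≤ s) (hr : 0 < r)
    (hgrid : r ∉ Set.range fun j : ℕ => (j : ℝ) / p.ρ) :
    HasDerivAt (fun y => ∫ u in Set.Ioi y, u * p.meanLoss s u) (-(r * p.meanLoss s r)) r := by
  have hint := integrableOn_mul_meanLoss (p := p) hs
  have hmeas : Measurable fun u => u * p.meanLoss s u := measurable_id.mul (p.measurable_meanLoss s)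
  have hprimitive : HasDerivAt (fun y => ∫ u in (0 : ℝ)..y, u * p.meanLoss s u)
      (r * p.meanLoss s r) r :=
    intervalIntegral.integral_hasDerivAt_right
      ((intervalIntegrable_iff_integrableOn_Ioc_of_le hr.le).2
        (hint.mono_set Set.Ioc_subset_Ioi_self))
      hmeas.stronglyMeasurable.stronglyMeasurableAtFilter
      (continuousAt_id.mul (continuousAt_meanLoss_right hs hr hgrid))
  refine (hprimitive.const_sub (∫ u in Set.Ioi 0, u * p.meanLoss s u)).congr_of_eventuallyEq ?_
  filter_upwards [lt_mem_nhds hr] with y hy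
  rw [eq_sub_iff_add_eq, add_comm]
  exact intervalIntegral.integral_interval_add_Ioi hint
    (hint.mono_set (Set.Ioi_subset_Ioi (le_of_lt hy)))

lemma hasDerivAt_nearestTail (hs : 0 ≤ s) (hr : 0 < r)
    (hgrid : r ∉ Set.range fun j : ℕ => (j : ℝ) / p.ρ) :
    HasDerivAt (p.nearestTail s) (-p.nearestWeight s r) r := by
  have hlaplace : HasDerivAt (p.laplaceIntegral s) _ r :=
    ((hasDerivAt_setIntegral_Ioi_mul_meanLoss hs hr hgrid).const_mul (2 * Real.pi * p.lam)).neg.exp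
  have hvoid : HasDerivAt (fun a : ℝ => Real.exp (-(Real.pi * p.lam * a ^ 2))) _ r :=
    ((hasDerivAt_pow 2 r).const_mul (Real.pi * p.lam)).neg.exp
  refine (hvoid.mul hlaplace).congr_deriv ?_
  simp only [nearestWeight, nearestPDF, laplaceIntegral, Pi.neg_apply]
  push_cast
  ring

lemma tendsto_nearestTail (hs : 0 ≤ s) : Tendsto (p.nearestTail s) atTop (𝓝 0) := by
  have hvoid : Tendsto (fun a : ℝ => Real.exp (-(Real.pi * p.lam * a ^ 2))) atTop (𝓝 0) :=
    Real.tendsto_exp_neg_atTop_nhds_zero.comp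
      ((tendsto_pow_atTop two_ne_zero).const_mul_atTop (mul_pos Real.pi_pos p.lam_pos))
  refine squeeze_zero' ?_ ?_ hvoid
  · exact Eventually.of_forall fun a =>
      mul_nonneg (Real.exp_pos _).le (laplaceIntegral_pos _ _).le
  · filter_upwards [eventually_ge_atTop 0] with a ha
    exact mul_le_of_le_one_right (Real.exp_pos _).le (laplaceIntegral_le_one hs ha)

lemma integral_nearestWeight (hs : 0 ≤ s) (ha : 0 ≤ a) :
    ∫ r in Set.Ioi a, p.nearestWeight s r = p.nearestTail s a := by
  have hint := (integrableOn_nearestWeight (p := p) hs).mono_set (Set.Ioi_subset_Ioi ha)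
  have htail : Tendsto (fun b => p.nearestTail s a - p.nearestTail s b) atTop
      (𝓝 (p.nearestTail s a)) := by
    simpa using tendsto_const_nhds.sub (tendsto_nearestTail (p := p) hs)
  refine tendsto_nhds_unique (intervalIntegral_tendsto_integral_Ioi a hint tendsto_id)
    (htail.congr' ?_)
  filter_upwards [eventually_ge_atTop a] with b hb
  have hcont : ContinuousOn (p.nearestTail s) (Set.Icc a b) :=
    ContinuousOn.mul (by fun_prop) ((continuousOn_laplaceIntegral_right hs).mono
      fun x hx => ha.trans hx.1)
  have hint_ab : IntervalIntegrable (p.nearestWeight s) volume a b :=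
    (intervalIntegrable_iff_integrableOn_Ioc_of_le hb).2 (hint.mono_set Set.Ioc_subset_Ioi_self)
  have hftc := integral_eq_of_hasDerivAt_off_countable_of_le (p.nearestTail s)
    (fun r => -p.nearestWeight s r) hb (Set.countable_range fun j : ℕ => (j : ℝ) / p.ρ) hcont
    (fun x hx => hasDerivAt_nearestTail hs (ha.trans_lt hx.1.1) hx.2) hint_ab.neg
  rw [intervalIntegral.integral_neg] at hftc
  simp only [id]
  linarith

/-- Minus the logarithm of the conditional Laplace transform at `s` of the power received from an
interferer at the distance `r`, so that sums of it over the points are log-Laplace functionals. -/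
def logLoss (p : Params) (s r : ℝ) : ℝ≥0∞ := ENNReal.ofReal (-Real.log (1 - p.meanLoss s r))

lemma measurable_logLoss (p : Params) (s : ℝ) : Measurable (p.logLoss s) :=
  ((Real.measurable_log.comp (measurable_const.sub (p.measurable_meanLoss s))).neg).ennreal_ofReal

lemma negExp_logLoss (hs : 0 ≤ s) (r : ℝ) :
    negExp (p.logLoss s r) = ENNReal.ofReal (1 - p.meanLoss s r) := by
  have hnonneg := meanLoss_nonneg (p := p) hs r
  have hlt := meanLoss_lt_one (p := p) hs r
  rw [logLoss, negExp_ofReal (neg_nonneg.2 (Real.log_nonpos (by linarith) (by linarith))), neg_neg,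
    Real.exp_log (by linarith)]

lemma negExp_lintegral_one_sub_eq_nearestTail (hs : 0 ≤ s) (ha : 0 ≤ a) :
    negExp (∫⁻ y : Plane, (1 - (Set.Ici a).indicator 1 ‖y‖ * negExp (p.logLoss s ‖y‖))
      ∂(ENNReal.ofReal p.lam • volume)) = ENNReal.ofReal (p.nearestTail s a) := by
  set g : ℝ → ℝ := fun r => if r < a then 1 else p.meanLoss s r with hg
  have hg_nonneg (r : ℝ) : 0 ≤ g r := by
    simp only [hg]
    split_ifs
    · exact zero_le_one
    · exact meanLoss_nonneg hs r
  have hpoint (y : Plane) :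
      1 - (Set.Ici a).indicator 1 ‖y‖ * negExp (p.logLoss s ‖y‖) = ENNReal.ofReal (g ‖y‖) := by
    rcases lt_or_ge ‖y‖ a with hy | hy
    · rw [Set.indicator_of_notMem (Set.notMem_Ici.2 hy), zero_mul, tsub_zero]
      simp only [hg, hy, if_true, ENNReal.ofReal_one]
    · rw [Set.indicator_of_mem (Set.mem_Ici.2 hy), Pi.one_apply, one_mul, negExp_logLoss hs,
        ← ENNReal.ofReal_one, ← ENNReal.ofReal_sub _ (sub_nonneg.2 (meanLoss_lt_one hs _).le),
        sub_sub_cancel]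
      simp only [hg, hy.not_gt, if_false]
  obtain ⟨hint, hvalue⟩ := integral_mul_ite_lt_one ha
    ((integrableOn_mul_meanLoss (p := p) hs).mono_set (Set.Ioi_subset_Ioi ha))
  have hfar_nonneg : 0 ≤ ∫ r in Set.Ioi a, r * p.meanLoss s r :=
    setIntegral_nonneg measurableSet_Ioi fun r hr =>
      mul_nonneg (ha.trans (le_of_lt hr)) (meanLoss_nonneg hs r)
  have hlam := p.lam_pos.le
  have := Real.pi_pos.le
  simp only [hpoint]
  rw [lintegral_smul_measure, lintegral_ofReal_norm hg_nonneg hint, hvalue, smul_eq_mul,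
    ← ENNReal.ofReal_mul hlam, negExp_ofReal (by positivity), nearestTail,
    laplaceIntegral, ← Real.exp_add]
  congr 2
  ring

variable {Ω : Type*} [MeasurableSpace Ω] {P : Measure Ω} {v : ℕ → Ω → Plane}

lemma map_norm_nearest_withDensity [IsProbabilityMeasure P] (h : IsPPP P v p.lam)
    (hrank : ∀ᵐ ω ∂P, StrictMono fun n => ‖v n ω‖) (hs : 0 ≤ s) :
    (P.withDensity fun ω => negExp (∑' n, p.logLoss s ‖v n ω‖)).map (fun ω => ‖v 0 ω‖)
      = (volume.restrict (Set.Ioi 0)).withDensity fun r =>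
          ENNReal.ofReal (p.nearestWeight s r) := by
  have hnorm_meas : Measurable fun ω => ‖v 0 ω‖ := (h.measurable 0).norm
  have hint := integrableOn_nearestWeight (p := p) hs
  have hfin : IsFiniteMeasure (P.withDensity fun ω => negExp (∑' n, p.logLoss s ‖v n ω‖)) :=
    isFiniteMeasure_withDensity (((lintegral_mono fun ω => negExp_le_one _).trans_lt (by simp)).ne)
  refine Measure.ext_of_Ici _ _ fun a => ?_
  have hb : 0 ≤ max a 0 := le_max_right _ _
  trans ENNReal.ofReal (p.nearestTail s (max a 0))
  · rw [← negExp_lintegral_one_sub_eq_nearestTail hs hb,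
      ← h.lintegral_negExp_sum_of_le_norm_nearest p.lam_pos.le hrank
        (f := fun y => p.logLoss s ‖y‖) ((p.measurable_logLoss s).comp measurable_norm),
      Measure.map_apply hnorm_meas measurableSet_Ici,
      withDensity_apply _ (hnorm_meas measurableSet_Ici),
      ← lintegral_indicator (hnorm_meas measurableSet_Ici)]
    refine lintegral_congr fun ω => ?_
    simp only [Set.indicator, Set.mem_preimage, Set.mem_Ici, max_le_iff, norm_nonneg,
      and_true, Pi.one_apply, ite_mul, one_mul, zero_mul]
  · have hset : (Set.Ici a ∩ Set.Ioi 0 : Set ℝ) =ᵐ[volume] Set.Ioi (max a 0) := by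
      rw [← Set.Ioi_inter_Ioi]
      exact Ioi_ae_eq_Ici.symm.inter (ae_eq_refl _)
    rw [withDensity_apply _ measurableSet_Ici, Measure.restrict_restrict measurableSet_Ici,
      setLIntegral_congr hset, ← integral_nearestWeight hs hb,
      ofReal_integral_eq_lintegral_ofReal (hint.mono_set (Set.Ioi_subset_Ioi hb))]
    filter_upwards [ae_restrict_mem measurableSet_Ioi] with r hr
    exact nearestWeight_nonneg hs (hb.trans (le_of_lt hr))

lemma lintegral_nearest_mul_negExp_sum [IsProbabilityMeasure P] (h : IsPPP P v p.lam)
    (hrank : ∀ᵐ ω ∂P, StrictMono fun n => ‖v n ω‖) (hs : 0 ≤ s) {φ : ℝ → ℝ≥0∞}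
    (hφ : Measurable φ) :
    ∫⁻ ω, φ ‖v 0 ω‖ * negExp (∑' n, p.logLoss s ‖v n ω‖) ∂P
      = ∫⁻ r in Set.Ioi 0, φ r * ENNReal.ofReal (p.nearestWeight s r) := by
  have hweight_meas : Measurable fun ω => negExp (∑' n, p.logLoss s ‖v n ω‖) :=
    measurable_negExp.comp
      (Measurable.tsum fun n => (p.measurable_logLoss s).comp (h.measurable n).norm)
  have hnorm_meas : Measurable fun ω => ‖v 0 ω‖ := (h.measurable 0).norm
  calc _ = ∫⁻ r, φ r ∂(P.withDensity fun ω => negExp (∑' n, p.logLoss s ‖v n ω‖)).map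
          (fun ω => ‖v 0 ω‖) := by
        rw [lintegral_map hφ hnorm_meas, lintegral_withDensity_eq_lintegral_mul _ hweight_meas
          (g := fun ω => φ ‖v 0 ω‖) (hφ.comp hnorm_meas)]
        exact lintegral_congr fun ω => mul_comm _ _
    _ = _ := by
        rw [map_norm_nearest_withDensity h hrank hs, lintegral_withDensity_eq_lintegral_mul₀
          (integrableOn_nearestWeight hs).aemeasurable.ennreal_ofReal hφ.aemeasurable]
        exact lintegral_congr fun r => mul_comm _ _

theorem lintegral_nearest_mul_negExp_sum_others [IsProbabilityMeasure P] (h : IsPPP P v p.lam)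
    (hrank : ∀ᵐ ω ∂P, StrictMono fun n => ‖v n ω‖) (hs : 0 ≤ s) {φ : ℝ → ℝ≥0∞}
    (hφ : Measurable φ) :
    ∫⁻ ω, φ ‖v 0 ω‖ * negExp (∑' n, p.logLoss s ‖v (n + 1) ω‖) ∂P
      = ∫⁻ r in Set.Ioi 0, φ r * ENNReal.ofReal (p.nearestPDF r * p.laplaceIntegral s r) := by
  have hmeas := p.measurable_meanLoss s
  have hall := lintegral_nearest_mul_negExp_sum h hrank hs
    (φ := fun r => φ r * (ENNReal.ofReal (1 - p.meanLoss s r))⁻¹) (by fun_prop)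
  have hne (r : ℝ) : ENNReal.ofReal (1 - p.meanLoss s r) ≠ 0 :=
    (ENNReal.ofReal_pos.2 (sub_pos.2 (meanLoss_lt_one hs r))).ne'
  convert hall using 1
  · refine lintegral_congr fun ω => ?_
    rw [tsum_eq_zero_add' (f := fun n => p.logLoss s ‖v n ω‖) ENNReal.summable, negExp_add,
      negExp_logLoss hs, mul_assoc, ← mul_assoc _⁻¹,
      ENNReal.inv_mul_cancel (hne _) ENNReal.ofReal_ne_top, one_mul]
  · refine lintegral_congr fun r => ?_
    rw [nearestWeight, ENNReal.ofReal_mul (sub_nonneg.2 (meanLoss_lt_one hs r).le),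
      mul_assoc, ← mul_assoc _⁻¹, ENNReal.inv_mul_cancel (hne _) ENNReal.ofReal_ne_top, one_mul]

end Params

end Nearest

/-! ### Marks and the Laplace transform at a random argument -/

lemma setLIntegral_Icc_zero_one_ite {c : ℝ} (hc : c ∈ Set.Icc 0 1) (A B : ℝ≥0∞) :
    ∫⁻ u in Set.Icc (0 : ℝ) 1, (if u ≤ c then A else B)
      = ENNReal.ofReal c * A + ENNReal.ofReal (1 - c) * B := by
  have hpoint (u : ℝ) : (if u ≤ c then A else B)
      = (Set.Iic c).indicator (fun _ => A) u + (Set.Ioi c).indicator (fun _ => B) u := by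
    split_ifs with h
    · rw [Set.indicator_of_mem (Set.mem_Iic.2 h), Set.indicator_of_notMem (Set.notMem_Ioi.2 h),
        add_zero]
    · rw [Set.indicator_of_notMem (Set.notMem_Iic.2 (not_le.1 h)),
        Set.indicator_of_mem (Set.mem_Ioi.2 (not_le.1 h)), zero_add]
  have hbelow : Set.Iic c ∩ Set.Icc 0 1 = Set.Icc 0 c := by
    ext u
    exact ⟨fun h => ⟨h.2.1, h.1⟩, fun h => ⟨h.2, h.1, h.2.trans hc.2⟩⟩
  have habove : Set.Ioi c ∩ Set.Icc 0 1 = Set.Ioc c 1 := by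
    ext u
    exact ⟨fun h => ⟨h.1, h.2.2⟩, fun h => ⟨h.1, hc.1.trans h.1.le, h.2⟩⟩
  simp only [hpoint]
  rw [lintegral_add_left (measurable_const.indicator measurableSet_Iic),
    lintegral_indicator measurableSet_Iic, lintegral_indicator measurableSet_Ioi,
    Measure.restrict_restrict measurableSet_Iic, Measure.restrict_restrict measurableSet_Ioi,
    setLIntegral_const, setLIntegral_const, hbelow, habove, Real.volume_Icc, Real.volume_Ioc,
    sub_zero, mul_comm A, mul_comm B]

lemma Mark.measurable_fading (κ : Link) : Measurable fun z : Mark => z.fading κ := by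
  cases κ
  · exact measurable_fst.comp (measurable_snd.comp measurable_snd)
  · exact measurable_snd.comp (measurable_snd.comp measurable_snd)

namespace Params

section MarkLaw

variable {p : Params} {s G : ℝ}

instance isProbabilityMeasure_fadingLaw (p : Params) (κ : Link) :
    IsProbabilityMeasure (p.fadingLaw κ) :=
  isProbabilityMeasure_gammaMeasure (p.N_cast_pos κ) (p.N_cast_pos κ)

lemma lintegral_gainLaw (p : Params) (f : Fin 4 → ℝ≥0∞) :
    ∫⁻ i, f i ∂p.gainLaw = ∑ i, ENNReal.ofReal (p.gainProb i) * f i := by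
  simp [gainLaw, lintegral_finsetSum_measure, lintegral_smul_measure, lintegral_dirac]

instance isProbabilityMeasure_gainLaw (p : Params) : IsProbabilityMeasure p.gainLaw where
  measure_univ := by
    have hone := p.lintegral_gainLaw 1
    simp only [Pi.one_apply, lintegral_one, mul_one] at hone
    rw [hone, ← ENNReal.ofReal_sum_of_nonneg fun i _ => gainProb_nonneg i, sum_gainProb,
      ENNReal.ofReal_one]

instance isProbabilityMeasure_markLaw (p : Params) : IsProbabilityMeasure p.markLaw := by
  have : IsProbabilityMeasure (volume.restrict (Set.Icc (0 : ℝ) 1)) := ⟨by simp⟩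
  unfold markLaw
  infer_instance

lemma measurable_of_state {α β : Type*} [MeasurableSpace α] [MeasurableSpace β]
    {g : Link → α → β} (hg : ∀ κ, Measurable (g κ)) {f : α → Plane × Mark} (hf : Measurable f) :
    Measurable fun a => g (p.state (f a).1 (f a).2) a := by
  have hLOS : MeasurableSet {y : Plane × Mark | y.2.1 ≤ p.pLOS (p.level ‖y.1‖)} :=
    measurableSet_le (measurable_fst.comp measurable_snd)
      ((measurable_prob_level (p := p) Link.LOS).comp (measurable_norm.comp measurable_fst))
  classical
  have hsplit : (fun a => g (p.state (f a).1 (f a).2) a)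
      = fun a => if a ∈ f ⁻¹' {y : Plane × Mark | y.2.1 ≤ p.pLOS (p.level ‖y.1‖)}
          then g Link.LOS a else g Link.NLOS a := by
    funext a
    by_cases h : (f a).2.1 ≤ p.pLOS (p.level ‖(f a).1‖) <;> simp [state, h]
  rw [hsplit]
  exact Measurable.ite (hf hLOS) (hg Link.LOS) (hg Link.NLOS)

lemma lintegral_gain_fading (p : Params) (κ : Link) (u : ℝ) {g : Fin 4 → ℝ → ℝ≥0∞}
    (hg : ∀ i, Measurable (g i)) :
    ∫⁻ y, g y.1 (Mark.fading (u, y) κ)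
        ∂(p.gainLaw.prod ((p.fadingLaw Link.LOS).prod (p.fadingLaw Link.NLOS)))
      = ∑ i, ENNReal.ofReal (p.gainProb i) * ∫⁻ y, g i y ∂p.fadingLaw κ := by
  have hfading : Measurable fun y : Fin 4 × ℝ × ℝ => Mark.fading (u, y) κ :=
    (Mark.measurable_fading κ).comp measurable_prodMk_left
  have hmeas : Measurable fun y : Fin 4 × ℝ × ℝ => g y.1 (Mark.fading (u, y) κ) :=
    (measurable_from_prod_countable_right (f := fun y : Fin 4 × ℝ => g y.1 y.2) hg).comp
      (measurable_fst.prodMk hfading)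
  rw [lintegral_prod _ hmeas.aemeasurable, lintegral_gainLaw]
  refine Finset.sum_congr rfl fun i _ => ?_
  have hmeas_i : Measurable fun y : ℝ × ℝ => g i (Mark.fading (u, i, y) κ) :=
    (hg i).comp (hfading.comp measurable_prodMk_left)
  rw [lintegral_prod _ hmeas_i.aemeasurable]
  cases κ <;> simp [Mark.fading]

lemma lintegral_markLaw (p : Params) (x : Plane) {g : Link → Fin 4 → ℝ → ℝ≥0∞}
    (hg : ∀ κ i, Measurable (g κ i)) :
    ∫⁻ z, g (p.state x z) z.2.1 (z.fading (p.state x z)) ∂p.markLaw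
      = ENNReal.ofReal (p.prob Link.LOS (p.level ‖x‖)) *
          ∑ i, ENNReal.ofReal (p.gainProb i) * ∫⁻ y, g Link.LOS i y ∂p.fadingLaw Link.LOS
        + ENNReal.ofReal (p.prob Link.NLOS (p.level ‖x‖)) *
          ∑ i, ENNReal.ofReal (p.gainProb i) * ∫⁻ y, g Link.NLOS i y ∂p.fadingLaw Link.NLOS := by
  have hmeas : Measurable fun z : Mark => g (p.state x z) z.2.1 (z.fading (p.state x z)) :=
    measurable_of_state (g := fun κ z => g κ z.2.1 (z.fading κ)) (f := fun z => (x, z))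
      (fun κ => (measurable_from_prod_countable_right (f := fun y : Fin 4 × ℝ => g κ y.1 y.2)
        (hg κ)).comp ((measurable_fst.comp measurable_snd).prodMk (Mark.measurable_fading κ)))
      measurable_prodMk_left
  rw [markLaw, lintegral_prod _ hmeas.aemeasurable]
  refine Eq.trans ?_ (setLIntegral_Icc_zero_one_ite (pLOS_mem_Icc (p.level ‖x‖)) _ _)
  refine lintegral_congr fun u => ?_
  split_ifs with h
  · have hstate (y : Fin 4 × ℝ × ℝ) : p.state x (u, y) = Link.LOS := if_pos h
    simp only [hstate, lintegral_gain_fading p Link.LOS u (hg Link.LOS)]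
  · have hstate (y : Fin 4 × ℝ × ℝ) : p.state x (u, y) = Link.NLOS := if_neg h
    simp only [hstate, lintegral_gain_fading p Link.NLOS u (hg Link.NLOS)]

lemma pathLoss_eq (κ : Link) (r : ℝ) :
    p.pathLoss κ r = p.C κ / (r ^ 2 + p.Δh ^ 2) ^ (p.α κ / 2) := by
  have hsq : 0 ≤ r ^ 2 + p.Δh ^ 2 := by positivity
  rw [pathLoss, Real.sqrt_eq_rpow, ← Real.rpow_mul hsq, mul_one_div]

lemma pathLoss_nonneg (κ : Link) (r : ℝ) : 0 ≤ p.pathLoss κ r :=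
  div_nonneg (p.C_pos κ).le (Real.sqrt_nonneg _)

lemma measurable_pathLoss (κ : Link) : Measurable (p.pathLoss κ) := by
  unfold pathLoss
  fun_prop

lemma lintegral_negExp_fadingLaw (κ : Link) (hs : 0 ≤ s) (hG : 0 ≤ G) (r : ℝ) :
    ∫⁻ y, negExp (ENNReal.ofReal (s * (p.pathLoss κ r * G) * y)) ∂p.fadingLaw κ
      = ENNReal.ofReal (1 - p.loss κ s G r) := by
  have hN := p.N_cast_pos κ
  have hpathLoss := pathLoss_nonneg (p := p) κ r
  have hrel := relPower_nonneg (p := p) (κ := κ) hs hG r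
  have hpower : s * (p.pathLoss κ r * G) = p.N κ * p.relPower κ s G r := by
    rw [pathLoss_eq, relPower, mul_div_mul_comm]
    field_simp
  rw [fadingLaw, lintegral_negExp_gammaMeasure hN hN (by positivity), loss, sub_sub_cancel,
    Real.rpow_natCast, ← inv_pow, hpower]
  congr 2
  field_simp

lemma one_sub_meanLoss (s r : ℝ) :
    1 - p.meanLoss s r
      = p.prob Link.LOS (p.level r) * ∑ i, p.gainProb i * (1 - p.loss Link.LOS s (p.gain i) r)
        + p.prob Link.NLOS (p.level r)
          * ∑ i, p.gainProb i * (1 - p.loss Link.NLOS s (p.gain i) r) := by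
  have hgain := p.sum_gainProb
  have hprob := prob_LOS_add_prob_NLOS (p := p) (p.level r)
  simp only [meanLoss, Fin.sum_univ_four] at hgain ⊢
  linear_combination -hprob - (p.prob Link.LOS (p.level r) + p.prob Link.NLOS (p.level r)) * hgain

theorem lintegral_negExp_channelGain (hs : 0 ≤ s) (x : Plane) :
    ∫⁻ z, negExp (ENNReal.ofReal s * ENNReal.ofReal (p.channelGain x z)) ∂p.markLaw
      = ENNReal.ofReal (1 - p.meanLoss s ‖x‖) := by
  set g : Link → Fin 4 → ℝ → ℝ≥0∞ := fun κ i y =>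
    negExp (ENNReal.ofReal (s * (p.pathLoss κ ‖x‖ * p.gain i) * y)) with hg
  have hg_meas (κ : Link) (i : Fin 4) : Measurable (g κ i) :=
    measurable_negExp.comp (measurable_const.mul measurable_id).ennreal_ofReal
  have hpoint (z : Mark) : negExp (ENNReal.ofReal s * ENNReal.ofReal (p.channelGain x z))
      = g (p.state x z) z.2.1 (z.fading (p.state x z)) := by
    rw [← ENNReal.ofReal_mul hs, channelGain, hg, ← mul_assoc s]
  have hterm_nonneg (κ : Link) (i : Fin 4) :
      0 ≤ p.gainProb i * (1 - p.loss κ s (p.gain i) ‖x‖) :=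
    mul_nonneg (gainProb_nonneg i) (sub_nonneg.2 (loss_lt_one hs (gain_nonneg i) _).le)
  have hstate_nonneg (κ : Link) :
      0 ≤ p.prob κ (p.level ‖x‖) * ∑ i, p.gainProb i * (1 - p.loss κ s (p.gain i) ‖x‖) :=
    mul_nonneg (prob_nonneg _ _) (Finset.sum_nonneg fun i _ => hterm_nonneg κ i)
  have hstate (κ : Link) : ENNReal.ofReal (p.prob κ (p.level ‖x‖)) *
        ∑ i, ENNReal.ofReal (p.gainProb i) * ∫⁻ y, g κ i y ∂p.fadingLaw κ
      = ENNReal.ofReal (p.prob κ (p.level ‖x‖) *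
          ∑ i, p.gainProb i * (1 - p.loss κ s (p.gain i) ‖x‖)) := by
    rw [ENNReal.ofReal_mul (prob_nonneg _ _),
      ENNReal.ofReal_sum_of_nonneg fun i _ => hterm_nonneg κ i]
    congr 1
    refine Finset.sum_congr rfl fun i _ => ?_
    rw [lintegral_negExp_fadingLaw κ hs (gain_nonneg i), ENNReal.ofReal_mul (gainProb_nonneg i)]
  simp only [hpoint]
  rw [lintegral_markLaw p x hg_meas, hstate, hstate,
    ← ENNReal.ofReal_add (hstate_nonneg _) (hstate_nonneg _), ← one_sub_meanLoss]

lemma measurable_channelGain (p : Params) :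
    Measurable fun y : Plane × Mark => p.channelGain y.1 y.2 := by
  have hgain : Measurable fun y : Plane × Mark => p.gain y.2.2.1 :=
    (measurable_of_finite p.gain).comp (measurable_fst.comp (measurable_snd.comp measurable_snd))
  refine measurable_of_state (g := fun κ (y : Plane × Mark) => p.pathLoss κ ‖y.1‖ * p.gain y.2.2.1
    * y.2.fading κ) (f := id) (fun κ => ?_) measurable_id
  exact (((measurable_pathLoss κ).comp (measurable_norm.comp measurable_fst)).mul hgain).mul
    ((Mark.measurable_fading κ).comp measurable_snd)

end MarkLaw

end Params

section Independence

variable {Ω α β γ : Type*} [MeasurableSpace Ω] [MeasurableSpace α] [MeasurableSpace β]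
  [MeasurableSpace γ] {P : Measure Ω} [IsProbabilityMeasure P] {X : Ω → α} {Y : Ω → β} {Z : Ω → γ}

lemma lintegral_comp_prodMk_of_indepFun (hX : Measurable X) (hY : Measurable Y)
    (hXY : IndepFun X Y P) {Φ : α × β → ℝ≥0∞} (hΦ : Measurable Φ) :
    ∫⁻ ω, Φ (X ω, Y ω) ∂P = ∫⁻ ω, ∫⁻ y, Φ (X ω, y) ∂P.map Y ∂P := by
  have := Measure.isProbabilityMeasure_map hY.aemeasurable (μ := P)
  rw [← lintegral_map hΦ (hX.prodMk hY),
    hXY.map_prod_eq_prod_map_map hX.aemeasurable hY.aemeasurable, lintegral_prod _ hΦ.aemeasurable,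
    lintegral_map hΦ.lintegral_prod_right' hX]

lemma lintegral_comp_prodMk_prodMk_of_indepFun (hX : Measurable X) (hY : Measurable Y)
    (hZ : Measurable Z) (hX_YZ : IndepFun X (fun ω => (Y ω, Z ω)) P) (hYZ : IndepFun Y Z P)
    {Φ : α × β × γ → ℝ≥0∞} (hΦ : Measurable Φ) :
    ∫⁻ ω, Φ (X ω, Y ω, Z ω) ∂P = ∫⁻ ω, ∫⁻ y, Φ (X ω, y, Z ω) ∂P.map Y ∂P := by
  have := Measure.isProbabilityMeasure_map hY.aemeasurable (μ := P)
  have := Measure.isProbabilityMeasure_map hZ.aemeasurable (μ := P)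
  have hΦ_right (x : α) : Measurable fun w : β × γ => Φ (x, w) := hΦ.comp measurable_prodMk_left
  have hinner : Measurable fun w : α × γ => ∫⁻ y, Φ (w.1, y, w.2) ∂P.map Y :=
    (hΦ.comp (f := fun w : (α × γ) × β => (w.1.1, w.2, w.1.2)) (by fun_prop)).lintegral_prod_right'
  calc ∫⁻ ω, Φ (X ω, Y ω, Z ω) ∂P
      = ∫⁻ ω, ∫⁻ w, Φ (X ω, w) ∂P.map (fun ω => (Y ω, Z ω)) ∂P :=
        lintegral_comp_prodMk_of_indepFun hX (hY.prodMk hZ) hX_YZ hΦ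
    _ = ∫⁻ ω, ∫⁻ y, ∫⁻ z, Φ (X ω, y, z) ∂P.map Z ∂P.map Y ∂P := by
        refine lintegral_congr fun ω => ?_
        rw [hYZ.map_prod_eq_prod_map_map hY.aemeasurable hZ.aemeasurable,
          lintegral_prod _ (hΦ_right _).aemeasurable]
    _ = ∫⁻ ω, ∫⁻ z, ∫⁻ y, Φ (X ω, y, z) ∂P.map Y ∂P.map Z ∂P :=
        lintegral_congr fun ω => lintegral_lintegral_swap (hΦ_right _).aemeasurable
    _ = ∫⁻ ω, ∫⁻ y, Φ (X ω, y, Z ω) ∂P.map Y ∂P :=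
        (lintegral_comp_prodMk_of_indepFun hX hZ (hX_YZ.comp measurable_id measurable_snd)
          hinner).symm

end Independence

section RandomParameter

variable {α β : Type*} [MeasurableSpace α] [MeasurableSpace β] {μ : Measure α} {ν : Measure β}

lemma tendsto_tsum_lintegral_indicator_floor {T : α → ℝ} (hT : Measurable T) (hT₀ : ∀ a, 0 ≤ T a)
    {A : ℝ → α → ℝ≥0∞} (hA : ∀ s, 0 ≤ s → AEMeasurable (A s) μ) {bound : α → ℝ≥0∞}
    (hbound : ∀ᵐ a ∂μ, ∀ s, 0 ≤ s → A s a ≤ bound a) (hbound_fin : ∫⁻ a, bound a ∂μ ≠ ∞)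
    (hcont : ∀ᵐ a ∂μ, ContinuousOn (fun s => A s a) (Set.Ici 0)) :
    Tendsto (fun k : ℕ => ∑' j : ℕ, ∫⁻ a, {x : ℝ | ⌊x * k⌋₊ = j}.indicator 1 (T a)
      * A (j / k) a ∂μ) atTop (𝓝 (∫⁻ a, A (T a) a ∂μ)) := by
  have hfiber (k j : ℕ) : MeasurableSet {x : ℝ | ⌊x * k⌋₊ = j} :=
    (Nat.measurable_floor.comp (measurable_id.mul_const (k : ℝ))) (measurableSet_singleton j)
  have hmeas (k j : ℕ) :
      AEMeasurable (fun a => {x : ℝ | ⌊x * k⌋₊ = j}.indicator 1 (T a) * A (j / k) a) μ :=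
    ((measurable_one.indicator (hfiber k j)).comp hT).aemeasurable.mul (hA _ (by positivity))
  have hsum (k : ℕ) (a : α) : ∑' j : ℕ, {x : ℝ | ⌊x * k⌋₊ = j}.indicator 1 (T a) * A (j / k) a
      = A ((⌊T a * k⌋₊ : ℝ) / k) a := by
    rw [tsum_eq_single ⌊T a * k⌋₊ fun j hj => ?_]
    · rw [Set.indicator_of_mem (show T a ∈ {x : ℝ | ⌊x * k⌋₊ = ⌊T a * k⌋₊} from rfl),
        Pi.one_apply, one_mul]
    · rw [Set.indicator_of_notMem (show T a ∉ {x : ℝ | ⌊x * k⌋₊ = j} from fun h => hj h.symm),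
        zero_mul]
  simp only [← lintegral_tsum (hmeas _), hsum]
  refine tendsto_lintegral_of_dominated_convergence' bound (fun k => ?_) (fun k => ?_) hbound_fin ?_
  · simp only [← hsum]
    exact AEMeasurable.tsum (hmeas k)
  · filter_upwards [hbound] with a ha using ha _ (by positivity)
  · filter_upwards [hcont] with a ha
    have hfloor : Tendsto (fun k : ℕ => (⌊T a * k⌋₊ : ℝ) / k) atTop (𝓝 (T a)) :=
      (tendsto_nat_floor_mul_div_atTop (hT₀ a)).comp tendsto_natCast_atTop_atTop
    exact (ha (T a) (hT₀ a)).tendsto.comp (tendsto_nhdsWithin_iff.2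
      ⟨hfloor, Eventually.of_forall fun k => Set.mem_Ici.2 (by positivity)⟩)

lemma lintegral_comp_eq_of_forall_const {T : α → ℝ} {U : β → ℝ} (hT : Measurable T)
    (hU : Measurable U) (hT₀ : ∀ a, 0 ≤ T a) (hU₀ : ∀ b, 0 ≤ U b) {A : ℝ → α → ℝ≥0∞}
    {B : ℝ → β → ℝ≥0∞} (hA : ∀ s, 0 ≤ s → AEMeasurable (A s) μ)
    (hB : ∀ s, 0 ≤ s → AEMeasurable (B s) ν) {boundA : α → ℝ≥0∞} {boundB : β → ℝ≥0∞}
    (hboundA : ∀ᵐ a ∂μ, ∀ s, 0 ≤ s → A s a ≤ boundA a)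
    (hboundB : ∀ᵐ b ∂ν, ∀ s, 0 ≤ s → B s b ≤ boundB b) (hA_fin : ∫⁻ a, boundA a ∂μ ≠ ∞)
    (hB_fin : ∫⁻ b, boundB b ∂ν ≠ ∞)
    (hA_cont : ∀ᵐ a ∂μ, ContinuousOn (fun s => A s a) (Set.Ici 0))
    (hB_cont : ∀ᵐ b ∂ν, ContinuousOn (fun s => B s b) (Set.Ici 0))
    (h : ∀ s, 0 ≤ s → ∀ ψ : ℝ → ℝ≥0∞, Measurable ψ →
      ∫⁻ a, ψ (T a) * A s a ∂μ = ∫⁻ b, ψ (U b) * B s b ∂ν) :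
    ∫⁻ a, A (T a) a ∂μ = ∫⁻ b, B (U b) b ∂ν := by
  have hlim := tendsto_tsum_lintegral_indicator_floor hU hU₀ hB hboundB hB_fin hB_cont
  refine tendsto_nhds_unique
    (tendsto_tsum_lintegral_indicator_floor hT hT₀ hA hboundA hA_fin hA_cont) ?_
  refine hlim.congr fun k => tsum_congr fun j => (h _ (by positivity) _ ?_).symm
  exact measurable_one.indicator
    ((Nat.measurable_floor.comp (measurable_id.mul_const (k : ℝ))) (measurableSet_singleton j))

lemma ae_lt_top_of_tendsto_lintegral_negExp [IsProbabilityMeasure μ] {X : α → ℝ≥0∞}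
    (hX : Measurable X)
    (h : Tendsto (fun s => ∫⁻ a, negExp (ENNReal.ofReal s * X a) ∂μ) (𝓝[>] 0) (𝓝 1)) :
    ∀ᵐ a ∂μ, X a < ∞ := by
  have hfin : MeasurableSet {a | X a < ∞} := hX measurableSet_Iio
  have hlim : Tendsto (fun s => ∫⁻ a, negExp (ENNReal.ofReal s * X a) ∂μ) (𝓝[>] 0)
      (𝓝 (∫⁻ a, {a | X a < ∞}.indicator 1 a ∂μ)) := by
    refine tendsto_lintegral_filter_of_dominated_convergence (fun _ => 1)
      (Eventually.of_forall fun s => measurable_negExp.comp (hX.const_mul _))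
      (Eventually.of_forall fun s => Eventually.of_forall fun a => negExp_le_one _) (by simp)
      (Eventually.of_forall fun a => ?_)
    by_cases ha : X a < ∞
    · have hzero : Tendsto (fun s => ENNReal.ofReal s * X a) (𝓝[>] 0) (𝓝 0) := by
        simpa using ENNReal.Tendsto.mul_const (ENNReal.tendsto_ofReal
          (tendsto_id.mono_left (nhdsWithin_le_nhds (a := (0 : ℝ)) (s := Set.Ioi 0))))
          (Or.inr ha.ne)
      rw [Set.indicator_of_mem (show a ∈ {a | X a < ∞} from ha), Pi.one_apply, ← negExp_zero]
      exact (continuous_negExp.tendsto _).comp hzero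
    · rw [Set.indicator_of_notMem (show a ∉ {a | X a < ∞} from ha)]
      refine tendsto_const_nhds.congr' ?_
      filter_upwards [self_mem_nhdsWithin] with s hs
      rw [not_lt_top_iff.1 ha, ENNReal.mul_top (ENNReal.ofReal_pos.2 hs).ne', negExp_top]
  rw [lintegral_indicator_one hfin] at hlim
  exact (prob_compl_eq_zero_iff hfin).2 (tendsto_nhds_unique hlim h)

end RandomParameter

namespace Params

section Transform

variable {α : Type*} [MeasurableSpace α] {p : Params} {s r : ℝ}

/-- The indicator function of the event that the link to a UAV at `x` with mark `z` is in
state `κ`. -/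
def stateIndicator (p : Params) (κ : Link) (x : Plane) (z : Mark) : ℝ≥0∞ :=
  ({κ} : Set Link).indicator 1 (p.state x z)

/-- The interference as a function of the locations `x` of all UAVs and of the marks `m` of the
interferers; the mark of the UAV at `x (n + 1)` is `m n`. -/
def tailInterference (p : Params) (x : ℕ → Plane) (m : ℕ → Mark) : ℝ≥0∞ :=
  ∑' n, ENNReal.ofReal (p.channelGain (x (n + 1)) (m n))

lemma measurable_stateIndicator (κ : Link) {x : α → Plane} {z : α → Mark} (hx : Measurable x)
    (hz : Measurable z) : Measurable fun a => p.stateIndicator κ (x a) (z a) :=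
  measurable_of_state (g := fun κ' _ => ({κ} : Set Link).indicator 1 κ')
    (f := fun a => (x a, z a)) (fun _ => measurable_const) (hx.prodMk hz)

lemma stateIndicator_le_one (κ : Link) (x : Plane) (z : Mark) : p.stateIndicator κ x z ≤ 1 :=
  Set.indicator_le_self' (by simp) _

lemma stateIndicator_state (x : Plane) (z : Mark) : p.stateIndicator (p.state x z) x z = 1 := by
  simp [stateIndicator]

lemma stateIndicator_of_ne {κ : Link} {x : Plane} {z : Mark} (h : p.state x z ≠ κ) :
    p.stateIndicator κ x z = 0 := by
  simp [stateIndicator, h]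

lemma lintegral_stateIndicator (κ : Link) (x : Plane) :
    ∫⁻ z, p.stateIndicator κ x z ∂p.markLaw = ENNReal.ofReal (p.prob κ (p.level ‖x‖)) := by
  have hlaw := p.lintegral_markLaw x (g := fun κ' _ _ => ({κ} : Set Link).indicator 1 κ')
    fun _ _ => measurable_const
  have hgain : ∑ i, ENNReal.ofReal (p.gainProb i) = 1 := by
    rw [← ENNReal.ofReal_sum_of_nonneg fun i _ => gainProb_nonneg i, sum_gainProb,
      ENNReal.ofReal_one]
  refine hlaw.trans ?_
  simp only [lintegral_const, measure_univ, mul_one, ← Finset.sum_mul, hgain, one_mul]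
  cases κ <;> simp

lemma measurable_tailInterference {x : α → ℕ → Plane} {m : α → ℕ → Mark} (hx : Measurable x)
    (hm : Measurable m) : Measurable fun a => p.tailInterference (x a) (m a) := by
  refine Measurable.tsum fun n => ?_
  have hlink : Measurable fun a => (x a (n + 1), m a n) := by fun_prop
  exact (p.measurable_channelGain.comp hlink).ennreal_ofReal

lemma continuousOn_laplaceIntegral_left (hr : 0 ≤ r) :
    ContinuousOn (fun s => p.laplaceIntegral s r) (Set.Ici 0) := fun _ hs =>
  tendsto_laplaceIntegral (tendsto_id.mono_left nhdsWithin_le_nhds) tendsto_const_nhds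
    self_mem_nhdsWithin (Eventually.of_forall fun _ => hr) hs

lemma aemeasurable_nearestPDF_mul_laplaceIntegral (hs : 0 ≤ s) :
    AEMeasurable (fun r => ENNReal.ofReal (p.nearestPDF r * p.laplaceIntegral s r))
      (volume.restrict (Set.Ioi 0)) :=
  (p.continuous_nearestPDF.measurable.aemeasurable.mul
    (((continuousOn_laplaceIntegral_right hs).mono Set.Ioi_subset_Ici_self).aemeasurable
      measurableSet_Ioi)).ennreal_ofReal

lemma nearestPDF_mul_laplaceIntegral_le (hs : 0 ≤ s) (hr : 0 ≤ r) :
    ENNReal.ofReal (p.nearestPDF r * p.laplaceIntegral s r) ≤ ENNReal.ofReal (p.nearestPDF r) :=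
  ENNReal.ofReal_le_ofReal
    (mul_le_of_le_one_right (nearestPDF_nonneg hr) (laplaceIntegral_le_one hs hr))

lemma continuousOn_nearestPDF_mul_laplaceIntegral (hr : 0 ≤ r) :
    ContinuousOn (fun s => ENNReal.ofReal (p.nearestPDF r * p.laplaceIntegral s r)) (Set.Ici 0) :=
  ENNReal.continuous_ofReal.comp_continuousOn
    (continuousOn_const.mul (continuousOn_laplaceIntegral_left hr))

lemma continuousOn_lintegral_nearestPDF_mul_laplaceIntegral (p : Params) :
    ContinuousOn (fun s => ∫⁻ r in Set.Ioi 0,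
      ENNReal.ofReal (p.nearestPDF r * p.laplaceIntegral s r)) (Set.Ici 0) := by
  intro s₀ hs₀
  refine tendsto_lintegral_filter_of_dominated_convergence'
    (fun r => ENNReal.ofReal (p.nearestPDF r)) ?_ ?_
    p.integrableOn_nearestPDF.lintegral_lt_top.ne ?_
  · filter_upwards [self_mem_nhdsWithin] with s hs
    exact aemeasurable_nearestPDF_mul_laplaceIntegral hs
  · filter_upwards [self_mem_nhdsWithin] with s hs
    filter_upwards [ae_restrict_mem measurableSet_Ioi] with r hr
    exact nearestPDF_mul_laplaceIntegral_le hs (le_of_lt hr)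
  · filter_upwards [ae_restrict_mem measurableSet_Ioi] with r hr
    exact continuousOn_nearestPDF_mul_laplaceIntegral (le_of_lt hr) s₀ hs₀

end Transform

end Params

/-! ### The coverage probability -/

lemma lintegral_negExp_tsum_of_iIndepFun {Ω : Type*} [MeasurableSpace Ω] {P : Measure Ω}
    [IsProbabilityMeasure P] {X : ℕ → Ω → ℝ≥0∞} (hX : ∀ n, Measurable (X n))
    (hind : iIndepFun X P) {c : ℕ → ℝ≥0∞} (hc : ∀ n, ∫⁻ ω, negExp (X n ω) ∂P = negExp (c n)) :
    ∫⁻ ω, negExp (∑' n, X n ω) ∂P = negExp (∑' n, c n) := by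
  have hpartial (m : ℕ) :
      ∫⁻ ω, negExp (∑ n ∈ Finset.range m, X n ω) ∂P = negExp (∑ n ∈ Finset.range m, c n) := by
    simp only [negExp_sum, ← hc]
    exact lintegral_prod_eq_prod_lintegral_of_indepFun _ _
      (hind.comp (fun _ => negExp) fun _ => measurable_negExp)
      fun n => measurable_negExp.comp (hX n)
  have htsum (f : ℕ → ℝ≥0∞) : Tendsto (fun m => negExp (∑ n ∈ Finset.range m, f n)) atTop
      (𝓝 (negExp (∑' n, f n))) :=
    (continuous_negExp.tendsto _).comp (ENNReal.tendsto_nat_tsum f)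
  refine tendsto_nhds_unique (tendsto_lintegral_of_dominated_convergence (fun _ => 1) (fun m => ?_)
    (fun m => Eventually.of_forall fun ω => negExp_le_one _) (by simp)
    (Eventually.of_forall fun ω => htsum fun n => X n ω)) ?_
  · exact measurable_negExp.comp (Finset.measurable_fun_sum _ fun n _ => hX n)
  · simpa only [hpartial] using htsum c

namespace IsNetwork

variable {Ω : Type*} [MeasurableSpace Ω] {P : Measure Ω} {p : Params} {v : ℕ → Ω → Plane}
  {mark : ℕ → Ω → Mark} {s : ℝ}

lemma measurable_points (hnet : IsNetwork P p v mark) : Measurable fun ω n => v n ω :=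
  measurable_pi_lambda _ hnet.ppp.measurable

lemma measurable_tail_marks (hnet : IsNetwork P p v mark) : Measurable fun ω n => mark (n + 1) ω :=
  measurable_pi_lambda _ fun n => hnet.mark_measurable (n + 1)

lemma measurable_nearest (hnet : IsNetwork P p v mark) : Measurable fun ω => ‖v 0 ω‖ :=
  (hnet.ppp.measurable 0).norm

lemma measurable_interference (hnet : IsNetwork P p v mark) : Measurable (p.interference v mark) :=
  Measurable.tsum fun n => (p.measurable_channelGain.comp
    ((hnet.ppp.measurable (n + 1)).prodMk (hnet.mark_measurable (n + 1)))).ennreal_ofReal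

lemma indepFun_mark_zero_tail_marks (hnet : IsNetwork P p v mark) :
    IndepFun (mark 0) (fun ω n => mark (n + 1) ω) P := by
  rw [IndepFun_iff_Indep]
  have hdisjoint := indep_iSup_of_disjoint (fun i => (hnet.mark_measurable i).comap_le)
    hnet.mark_indep.iIndep (S := {0}) (T := {0}ᶜ) disjoint_compl_right
  refine indep_of_indep_of_le_left (indep_of_indep_of_le_right hdisjoint ?_)
    (le_iSup₂_of_le 0 (by simp) le_rfl)
  rw [MeasurableSpace.comap_process_pi]
  exact iSup_le fun n => le_iSup₂_of_le (n + 1) (by simp) le_rfl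

lemma indepFun_points_mark_zero_tail_marks (hnet : IsNetwork P p v mark) :
    IndepFun (fun ω n => v n ω) (fun ω => (mark 0 ω, fun n => mark (n + 1) ω)) P :=
  hnet.indep.comp (φ := id) (ψ := fun m : ℕ → Mark => (m 0, fun n => m (n + 1))) measurable_id
    (by fun_prop)

variable [IsProbabilityMeasure P]

lemma lintegral_mark_zero (hnet : IsNetwork P p v mark)
    {Φ : (ℕ → Plane) × Mark × (ℕ → Mark) → ℝ≥0∞} (hΦ : Measurable Φ) :
    ∫⁻ ω, Φ (fun n => v n ω, mark 0 ω, fun n => mark (n + 1) ω) ∂P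
      = ∫⁻ ω, ∫⁻ z, Φ (fun n => v n ω, z, fun n => mark (n + 1) ω) ∂p.markLaw ∂P := by
  rw [← hnet.mark_law 0]
  exact lintegral_comp_prodMk_prodMk_of_indepFun hnet.measurable_points (hnet.mark_measurable 0)
    hnet.measurable_tail_marks hnet.indepFun_points_mark_zero_tail_marks
    hnet.indepFun_mark_zero_tail_marks hΦ

lemma lintegral_negExp_tailInterference (hnet : IsNetwork P p v mark) (hs : 0 ≤ s)
    (x : ℕ → Plane) :
    ∫⁻ ω, negExp (ENNReal.ofReal s * p.tailInterference x fun n => mark (n + 1) ω) ∂P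
      = negExp (∑' n, p.logLoss s ‖x (n + 1)‖) := by
  have hgain (n : ℕ) : Measurable fun z =>
      ENNReal.ofReal s * ENNReal.ofReal (p.channelGain (x (n + 1)) z) :=
    (p.measurable_channelGain.comp measurable_prodMk_left).ennreal_ofReal.const_mul _
  simp only [Params.tailInterference, ← ENNReal.tsum_mul_left]
  refine lintegral_negExp_tsum_of_iIndepFun (fun n => (hgain n).comp (hnet.mark_measurable _))
    ((hnet.mark_indep.precomp (add_left_injective 1)).comp
      (fun n z => ENNReal.ofReal s * ENNReal.ofReal (p.channelGain (x (n + 1)) z)) hgain)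
    fun n => ?_
  rw [Params.negExp_logLoss hs, ← Params.lintegral_negExp_channelGain hs, ← hnet.mark_law (n + 1)]
  exact (lintegral_map (measurable_negExp.comp (hgain n)) (hnet.mark_measurable _)).symm

lemma lintegral_nearest_mul_negExp_interference (hnet : IsNetwork P p v mark) (hs : 0 ≤ s)
    {φ : ℝ → ℝ≥0∞} (hφ : Measurable φ) :
    ∫⁻ ω, φ ‖v 0 ω‖ * negExp (ENNReal.ofReal s * p.interference v mark ω) ∂P
      = ∫⁻ r in Set.Ioi 0, φ r * ENNReal.ofReal (p.nearestPDF r * p.laplaceIntegral s r) := by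
  have hjoint : Measurable fun y : (ℕ → Plane) × (ℕ → Mark) =>
      φ ‖y.1 0‖ * negExp (ENNReal.ofReal s * p.tailInterference y.1 y.2) :=
    (hφ.comp (by fun_prop)).mul (measurable_negExp.comp
      ((Params.measurable_tailInterference measurable_fst measurable_snd).const_mul _))
  rw [← Params.lintegral_nearest_mul_negExp_sum_others hnet.ppp hnet.ranked hs hφ]
  refine (lintegral_comp_prodMk_of_indepFun hnet.measurable_points hnet.measurable_tail_marks
    (hnet.indepFun_points_mark_zero_tail_marks.comp measurable_id measurable_snd) hjoint).trans
    (lintegral_congr fun ω => ?_)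
  have hright : Measurable fun m =>
      negExp (ENNReal.ofReal s * p.tailInterference (fun n => v n ω) m) :=
    measurable_negExp.comp
      ((Params.measurable_tailInterference measurable_const measurable_id).const_mul _)
  rw [← hnet.lintegral_negExp_tailInterference hs fun n => v n ω,
    ← lintegral_map hright hnet.measurable_tail_marks, ← lintegral_const_mul _ hright]

lemma lintegral_nearest_mul_state_mul_negExp_const (hnet : IsNetwork P p v mark) (hs : 0 ≤ s)
    (κ : Link) {φ : ℝ → ℝ≥0∞} (hφ : Measurable φ) :
    ∫⁻ ω, φ ‖v 0 ω‖ * p.stateIndicator κ (v 0 ω) (mark 0 ω)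
        * negExp (ENNReal.ofReal s * p.interference v mark ω) ∂P
      = ∫⁻ r in Set.Ioi 0, φ r * ENNReal.ofReal (p.prob κ (p.level r))
        * ENNReal.ofReal (p.nearestPDF r * p.laplaceIntegral s r) := by
  have hprob : Measurable fun r => ENNReal.ofReal (p.prob κ (p.level r)) :=
    (Params.measurable_prob_level κ).ennreal_ofReal
  have hjoint : Measurable fun y : (ℕ → Plane) × Mark × (ℕ → Mark) =>
      φ ‖y.1 0‖ * p.stateIndicator κ (y.1 0) y.2.1
        * negExp (ENNReal.ofReal s * p.tailInterference y.1 y.2.2) :=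
    ((hφ.comp (by fun_prop)).mul (Params.measurable_stateIndicator κ (by fun_prop)
      (by fun_prop))).mul (measurable_negExp.comp
        ((Params.measurable_tailInterference (by fun_prop) (by fun_prop)).const_mul _))
  refine Eq.trans ?_ (hnet.lintegral_nearest_mul_negExp_interference hs (hφ.mul hprob))
  refine (hnet.lintegral_mark_zero hjoint).trans (lintegral_congr fun ω => ?_)
  have hserving : Measurable fun z => p.stateIndicator κ (v 0 ω) z :=
    Params.measurable_stateIndicator κ measurable_const measurable_id
  dsimp only
  rw [lintegral_mul_const _ (hserving.const_mul _), lintegral_const_mul _ hserving,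
    Params.lintegral_stateIndicator]
  rfl

theorem ae_interference_lt_top (hnet : IsNetwork P p v mark) :
    ∀ᵐ ω ∂P, p.interference v mark ω < ∞ := by
  have htransform (s : ℝ) (hs : 0 ≤ s) :
      ∫⁻ ω, negExp (ENNReal.ofReal s * p.interference v mark ω) ∂P
        = ∫⁻ r in Set.Ioi 0, ENNReal.ofReal (p.nearestPDF r * p.laplaceIntegral s r) := by
    simpa using hnet.lintegral_nearest_mul_negExp_interference hs (φ := 1) measurable_one
  have hone : ∫⁻ r in Set.Ioi 0, ENNReal.ofReal (p.nearestPDF r * p.laplaceIntegral 0 r) = 1 := by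
    simp [← htransform 0 le_rfl, negExp_zero]
  refine ae_lt_top_of_tendsto_lintegral_negExp hnet.measurable_interference ?_
  rw [← hone]
  refine ((p.continuousOn_lintegral_nearestPDF_mul_laplaceIntegral 0 Set.self_mem_Ici).mono_left
    (nhdsWithin_mono 0 Set.Ioi_subset_Ici_self)).congr' ?_
  filter_upwards [self_mem_nhdsWithin] with s hs using (htransform s (le_of_lt hs)).symm

theorem lintegral_nearest_mul_state_mul_negExp (hnet : IsNetwork P p v mark) (κ : Link)
    {φ : ℝ → ℝ≥0∞} (hφ : Measurable φ) (hφ_le : ∀ r, φ r ≤ 1) {τ : ℝ → ℝ} (hτ : Measurable τ)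
    (hτ_nonneg : ∀ r, 0 ≤ τ r) :
    ∫⁻ ω, φ ‖v 0 ω‖ * p.stateIndicator κ (v 0 ω) (mark 0 ω)
        * negExp (ENNReal.ofReal (τ ‖v 0 ω‖) * p.interference v mark ω) ∂P
      = ∫⁻ r in Set.Ioi 0, φ r * ENNReal.ofReal (p.prob κ (p.level r))
        * ENNReal.ofReal (p.nearestPDF r * p.laplaceIntegral (τ r) r) := by
  have hprob : Measurable fun r => ENNReal.ofReal (p.prob κ (p.level r)) :=
    (Params.measurable_prob_level κ).ennreal_ofReal
  have hstate : Measurable fun ω => p.stateIndicator κ (v 0 ω) (mark 0 ω) :=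
    Params.measurable_stateIndicator κ (hnet.ppp.measurable 0) (hnet.mark_measurable 0)
  have hserving (ω : Ω) : φ ‖v 0 ω‖ * p.stateIndicator κ (v 0 ω) (mark 0 ω) ≤ 1 :=
    mul_le_one' (hφ_le _) (Params.stateIndicator_le_one _ _ _)
  have hradial (r : ℝ) : φ r * ENNReal.ofReal (p.prob κ (p.level r)) ≤ 1 :=
    mul_le_one' (hφ_le r) (ENNReal.ofReal_le_one.2 (Params.prob_le_one _ _))
  refine lintegral_comp_eq_of_forall_const (T := fun ω => τ ‖v 0 ω‖) (U := τ)
    (A := fun s ω => φ ‖v 0 ω‖ * p.stateIndicator κ (v 0 ω) (mark 0 ω)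
      * negExp (ENNReal.ofReal s * p.interference v mark ω))
    (B := fun s r => φ r * ENNReal.ofReal (p.prob κ (p.level r))
      * ENNReal.ofReal (p.nearestPDF r * p.laplaceIntegral s r))
    (boundA := fun _ => 1) (boundB := fun r => ENNReal.ofReal (p.nearestPDF r))
    (hτ.comp hnet.measurable_nearest) hτ (fun _ => hτ_nonneg _) hτ_nonneg (fun s _ => ?_)
    (fun s hs => ?_) (Eventually.of_forall fun ω s _ => ?_) ?_ (by simp)
    p.integrableOn_nearestPDF.lintegral_lt_top.ne ?_ ?_ fun s hs ψ hψ => ?_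
  · exact (((hφ.comp hnet.measurable_nearest).mul hstate).mul
      (measurable_negExp.comp (hnet.measurable_interference.const_mul _))).aemeasurable
  · exact (hφ.mul hprob).aemeasurable.mul
      (Params.aemeasurable_nearestPDF_mul_laplaceIntegral hs)
  · exact mul_le_one' (hserving ω) (negExp_le_one _)
  · filter_upwards [ae_restrict_mem measurableSet_Ioi] with r hr s hs
    exact (mul_le_of_le_one_left' (hradial r)).trans
      (Params.nearestPDF_mul_laplaceIntegral_le hs (le_of_lt hr))
  · filter_upwards [hnet.ae_interference_lt_top] with ω hω s _
    exact ENNReal.Tendsto.const_mul ((continuous_negExp.tendsto _).comp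
      (ENNReal.Tendsto.mul_const (ENNReal.tendsto_ofReal (tendsto_id.mono_left nhdsWithin_le_nhds))
        (Or.inr hω.ne))) (Or.inr (ne_top_of_le_ne_top ENNReal.one_ne_top (hserving ω)))
  · filter_upwards [ae_restrict_mem measurableSet_Ioi] with r hr s hs
    exact ENNReal.Tendsto.const_mul
      (Params.continuousOn_nearestPDF_mul_laplaceIntegral (le_of_lt hr) s hs)
      (Or.inr (ne_top_of_le_ne_top ENNReal.one_ne_top (hradial r)))
  · simpa only [Function.comp_apply, Pi.mul_apply, mul_assoc] using
      hnet.lintegral_nearest_mul_state_mul_negExp_const hs κ ((hψ.comp hτ).mul hφ)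

end IsNetwork

lemma one_sub_one_sub_pow (y : ℝ) (N : ℕ) :
    1 - (1 - y) ^ N = ∑ n ∈ Finset.Icc 1 N, (-1 : ℝ) ^ (n + 1) * N.choose n * y ^ n := by
  have hbinomial : (1 - y) ^ N = ∑ n ∈ Finset.range (N + 1), (-1 : ℝ) ^ n * N.choose n * y ^ n := by
    rw [sub_eq_neg_add, add_pow]
    refine Finset.sum_congr rfl fun n _ => ?_
    rw [one_pow, neg_pow]
    ring
  have hIcc : Finset.Icc 1 N = Finset.Ico 1 (N + 1) := by ext; simp
  rw [hbinomial, Finset.range_eq_Ico, Finset.sum_eq_sum_Ico_succ_bot (Nat.succ_pos N), hIcc]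
  simp only [pow_zero, Nat.choose_zero_right, Nat.cast_one, mul_one, zero_add,
    sub_add_cancel_left, ← Finset.sum_neg_distrib]
  exact Finset.sum_congr rfl fun n _ => by ring

namespace Params

section AlzerTail

variable {Ω : Type*} {p : Params} {v : ℕ → Ω → Plane} {mark : ℕ → Ω → Mark} {Υ : ℝ} {ω : Ω}

/-- The `n`-th exponential in the binomial expansion of Alzer's tail, on the event that the serving
link is in state `κ`. -/
def alzerTerm (p : Params) (v : ℕ → Ω → Plane) (mark : ℕ → Ω → Mark) (κ : Link) (Υ : ℝ) (n : ℕ)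
    (ω : Ω) : ℝ≥0∞ :=
  ENNReal.ofReal (Real.exp (-p.noiseArg κ Υ n ‖v 0 ω‖)) * p.stateIndicator κ (v 0 ω) (mark 0 ω)
    * negExp (ENNReal.ofReal (p.laplaceArg κ Υ n ‖v 0 ω‖) * p.interference v mark ω)

/-- Alzer's tail on the event that the serving link is in state `κ`, as a binomial sum. -/
def alzerPart (p : Params) (v : ℕ → Ω → Plane) (mark : ℕ → Ω → Mark) (κ : Link) (Υ : ℝ)
    (ω : Ω) : ℝ :=
  ∑ n ∈ Finset.Icc 1 (p.N κ),
    (-1 : ℝ) ^ (n + 1) * (p.N κ).choose n * (p.alzerTerm v mark κ Υ n ω).toReal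

lemma nat_mul_η_mul_required (n : ℕ) (Υ : ℝ) (ω : Ω) :
    n * (p.η (p.state (v 0 ω) (mark 0 ω)) * p.required v mark Υ ω)
      = p.noiseArg (p.state (v 0 ω) (mark 0 ω)) Υ n ‖v 0 ω‖
        + p.laplaceArg (p.state (v 0 ω) (mark 0 ω)) Υ n ‖v 0 ω‖
          * (p.interference v mark ω).toReal := by
  rw [required, pathLoss_eq, noiseArg, laplaceArg, Real.rpow_neg (by positivity)]
  simp only [div_eq_mul_inv, mul_inv, inv_inv]
  ring

lemma ofReal_exp_neg_noiseArg_le_one (κ : Link) (hΥ : 0 < Υ) (n : ℕ) (r : ℝ) :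
    ENNReal.ofReal (Real.exp (-p.noiseArg κ Υ n r)) ≤ 1 :=
  ENNReal.ofReal_le_one.2 (Real.exp_le_one_iff.2 (neg_nonpos.2 (noiseArg_nonneg κ hΥ n r)))

lemma alzerTerm_le_one (κ : Link) (hΥ : 0 < Υ) (n : ℕ) (ω : Ω) :
    p.alzerTerm v mark κ Υ n ω ≤ 1 :=
  mul_le_one' (mul_le_one' (ofReal_exp_neg_noiseArg_le_one κ hΥ n _) (stateIndicator_le_one _ _ _))
    (negExp_le_one _)

lemma toReal_alzerTerm_state (hΥ : 0 < Υ) (n : ℕ) (hω : p.interference v mark ω < ∞) :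
    (p.alzerTerm v mark (p.state (v 0 ω) (mark 0 ω)) Υ n ω).toReal
      = Real.exp (-(p.η (p.state (v 0 ω) (mark 0 ω)) * p.required v mark Υ ω)) ^ n := by
  have harg := laplaceArg_nonneg (p := p) (p.state (v 0 ω) (mark 0 ω)) hΥ n ‖v 0 ω‖
  rw [← Real.exp_nat_mul, mul_neg, nat_mul_η_mul_required, neg_add, Real.exp_add, alzerTerm,
    stateIndicator_state, mul_one, ENNReal.toReal_mul, ENNReal.toReal_ofReal (Real.exp_pos _).le]
  conv_lhs => rw [← ENNReal.ofReal_toReal hω.ne]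
  rw [← ENNReal.ofReal_mul harg, negExp_ofReal (mul_nonneg harg ENNReal.toReal_nonneg),
    ENNReal.toReal_ofReal (Real.exp_pos _).le]

lemma alzerPart_state (hΥ : 0 < Υ) (hω : p.interference v mark ω < ∞) :
    p.alzerPart v mark (p.state (v 0 ω) (mark 0 ω)) Υ ω = p.alzerTail v mark Υ ω := by
  rw [alzerTail, alzer, one_sub_one_sub_pow, alzerPart]
  exact Finset.sum_congr rfl fun n _ => by rw [toReal_alzerTerm_state hΥ n hω]

lemma alzerPart_of_ne {κ : Link} (hκ : p.state (v 0 ω) (mark 0 ω) ≠ κ) :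
    p.alzerPart v mark κ Υ ω = 0 :=
  Finset.sum_eq_zero fun n _ => by simp [alzerTerm, stateIndicator_of_ne hκ]

lemma alzerPart_LOS_add_alzerPart_NLOS (hΥ : 0 < Υ) (hω : p.interference v mark ω < ∞) :
    p.alzerPart v mark Link.LOS Υ ω + p.alzerPart v mark Link.NLOS Υ ω
      = p.alzerTail v mark Υ ω := by
  rw [← alzerPart_state hΥ hω]
  cases hκ : p.state (v 0 ω) (mark 0 ω)
  · rw [alzerPart_of_ne (κ := Link.NLOS) (by simp [hκ]), add_zero]
  · rw [alzerPart_of_ne (κ := Link.LOS) (by simp [hκ]), zero_add]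

lemma measurable_noiseArg (p : Params) (κ : Link) (Υ : ℝ) (n : ℕ) :
    Measurable (p.noiseArg κ Υ n) := by
  unfold noiseArg
  fun_prop

lemma measurable_laplaceArg (p : Params) (κ : Link) (Υ : ℝ) (n : ℕ) :
    Measurable (p.laplaceArg κ Υ n) := by
  unfold laplaceArg
  fun_prop

lemma integrableOn_prob_mul_coverTerm (κ : Link) (hΥ : 0 < Υ) (n : ℕ) :
    IntegrableOn (fun r => p.prob κ (p.level r) * p.coverTerm κ Υ n r) (Set.Ioi 0) := by
  refine Integrable.mono' p.integrableOn_nearestPDF ?_ ?_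
  · exact (measurable_prob_level κ).aestronglyMeasurable.mul
      (ContinuousOn.aestronglyMeasurable (fun r hr =>
        (continuousAt_coverTerm κ hΥ n hr).continuousWithinAt) measurableSet_Ioi)
  · filter_upwards [ae_restrict_mem measurableSet_Ioi] with r hr
    have hterm := coverTerm_nonneg (p := p) κ Υ n (le_of_lt hr)
    rw [Real.norm_of_nonneg (mul_nonneg (prob_nonneg _ _) hterm)]
    exact (mul_le_of_le_one_left hterm (prob_le_one _ _)).trans
      (coverTerm_le_nearestPDF κ hΥ n (le_of_lt hr))

lemma prob_mul_Ψ_eq_sum (κ : Link) (hΥ : 0 < Υ) {r : ℝ} (hr : 0 < r) :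
    p.prob κ (p.level r) * p.Ψ κ r Υ = ∑ n ∈ Finset.Icc 1 (p.N κ),
      (-1 : ℝ) ^ (n + 1) * (p.N κ).choose n * (p.prob κ (p.level r) * p.coverTerm κ Υ n r) := by
  rw [Ψ_eq_sum_coverTerm κ hΥ hr, Finset.mul_sum]
  exact Finset.sum_congr rfl fun n _ => by ring

lemma integrableOn_prob_mul_Ψ (κ : Link) (hΥ : 0 < Υ) :
    IntegrableOn (fun r => p.prob κ (p.level r) * p.Ψ κ r Υ) (Set.Ioi 0) :=
  IntegrableOn.congr_fun
    (integrable_finsetSum _ fun n _ => (integrableOn_prob_mul_coverTerm κ hΥ n).const_mul _)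
    (fun _ hr => (prob_mul_Ψ_eq_sum κ hΥ hr).symm) measurableSet_Ioi

end AlzerTail

end Params

namespace IsNetwork

variable {Ω : Type*} [MeasurableSpace Ω] {P : Measure Ω} {p : Params} {v : ℕ → Ω → Plane}
  {mark : ℕ → Ω → Mark} {Υ : ℝ}

lemma measurable_alzerTerm (hnet : IsNetwork P p v mark) (κ : Link) (Υ : ℝ) (n : ℕ) :
    Measurable (p.alzerTerm v mark κ Υ n) :=
  ((((p.measurable_noiseArg κ Υ n).comp hnet.measurable_nearest).neg.exp.ennreal_ofReal).mul
    (Params.measurable_stateIndicator κ (hnet.ppp.measurable 0) (hnet.mark_measurable 0))).mul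
    (measurable_negExp.comp
      (((p.measurable_laplaceArg κ Υ n).comp hnet.measurable_nearest).ennreal_ofReal.mul
        hnet.measurable_interference))

variable [IsProbabilityMeasure P]

lemma integrable_alzerTerm (hnet : IsNetwork P p v mark) (κ : Link) (hΥ : 0 < Υ) (n : ℕ) :
    Integrable (fun ω => (p.alzerTerm v mark κ Υ n ω).toReal) P :=
  integrable_toReal_of_lintegral_ne_top (hnet.measurable_alzerTerm κ Υ n).aemeasurable
    ((lintegral_mono fun ω => Params.alzerTerm_le_one κ hΥ n ω).trans_lt (by simp)).ne

lemma integral_alzerTerm (hnet : IsNetwork P p v mark) (κ : Link) (hΥ : 0 < Υ) (n : ℕ) :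
    ∫ ω, (p.alzerTerm v mark κ Υ n ω).toReal ∂P
      = ∫ r in Set.Ioi 0, p.prob κ (p.level r) * p.coverTerm κ Υ n r := by
  rw [integral_toReal (hnet.measurable_alzerTerm κ Υ n).aemeasurable
      (Eventually.of_forall fun ω =>
        (Params.alzerTerm_le_one κ hΥ n ω).trans_lt ENNReal.one_lt_top),
    integral_eq_lintegral_of_nonneg_ae _
      (Params.integrableOn_prob_mul_coverTerm κ hΥ n).aestronglyMeasurable]
  · refine congrArg ENNReal.toReal ((hnet.lintegral_nearest_mul_state_mul_negExp κ
      (φ := fun r => ENNReal.ofReal (Real.exp (-p.noiseArg κ Υ n r)))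
      (p.measurable_noiseArg κ Υ n).neg.exp.ennreal_ofReal
      (Params.ofReal_exp_neg_noiseArg_le_one κ hΥ n) (p.measurable_laplaceArg κ Υ n)
      (Params.laplaceArg_nonneg κ hΥ n)).trans ?_)
    refine setLIntegral_congr_fun measurableSet_Ioi fun r _ => ?_
    rw [← ENNReal.ofReal_mul (Real.exp_pos _).le, ← ENNReal.ofReal_mul
      (mul_nonneg (Real.exp_pos _).le (Params.prob_nonneg _ _)), Params.coverTerm]
    ring_nf
  · filter_upwards [ae_restrict_mem measurableSet_Ioi] with r hr
    exact mul_nonneg (Params.prob_nonneg _ _) (Params.coverTerm_nonneg κ Υ n (le_of_lt hr))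

lemma integrable_alzerPart (hnet : IsNetwork P p v mark) (κ : Link) (hΥ : 0 < Υ) :
    Integrable (p.alzerPart v mark κ Υ) P :=
  integrable_finsetSum _ fun n _ => (hnet.integrable_alzerTerm κ hΥ n).const_mul _

lemma integral_alzerPart (hnet : IsNetwork P p v mark) (κ : Link) (hΥ : 0 < Υ) :
    ∫ ω, p.alzerPart v mark κ Υ ω ∂P = ∫ r in Set.Ioi 0, p.prob κ (p.level r) * p.Ψ κ r Υ := by
  rw [setIntegral_congr_fun measurableSet_Ioi fun r hr => Params.prob_mul_Ψ_eq_sum κ hΥ hr,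
    integral_finsetSum _ fun n _ =>
      (Params.integrableOn_prob_mul_coverTerm κ hΥ n).const_mul _]
  simp only [Params.alzerPart]
  rw [integral_finsetSum _ fun n _ => (hnet.integrable_alzerTerm κ hΥ n).const_mul _]
  refine Finset.sum_congr rfl fun n _ => ?_
  rw [integral_const_mul, integral_const_mul, hnet.integral_alzerTerm κ hΥ n]

lemma ae_alzerPart_add_eq_alzerTail (hnet : IsNetwork P p v mark) (hΥ : 0 < Υ) :
    (fun ω => p.alzerPart v mark Link.LOS Υ ω + p.alzerPart v mark Link.NLOS Υ ω)
      =ᵐ[P] p.alzerTail v mark Υ := by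
  filter_upwards [hnet.ae_interference_lt_top] with ω hω
    using Params.alzerPart_LOS_add_alzerPart_NLOS hΥ hω

theorem integrable_alzerTail (hnet : IsNetwork P p v mark) (hΥ : 0 < Υ) :
    Integrable (p.alzerTail v mark Υ) P :=
  ((hnet.integrable_alzerPart _ hΥ).add (hnet.integrable_alzerPart _ hΥ)).congr
    (hnet.ae_alzerPart_add_eq_alzerTail hΥ)

theorem alzerCoverage_eq_integral_coverDensity (hnet : IsNetwork P p v mark) (hΥ : 0 < Υ) :
    p.alzerCoverage v mark P Υ = ∫ r in Set.Ioi 0, p.coverDensity Υ r := by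
  simp only [Params.coverDensity]
  rw [Params.alzerCoverage, ← integral_congr_ae (hnet.ae_alzerPart_add_eq_alzerTail hΥ),
    integral_add (hnet.integrable_alzerPart _ hΥ) (hnet.integrable_alzerPart _ hΥ),
    hnet.integral_alzerPart _ hΥ, hnet.integral_alzerPart _ hΥ,
    integral_add (Params.integrableOn_prob_mul_Ψ _ hΥ) (Params.integrableOn_prob_mul_Ψ _ hΥ)]

end IsNetwork

namespace Params

section Fading

variable {p : Params} {κ : Link} {x : ℝ}

lemma η_pow_mul_factorial (p : Params) (κ : Link) :
    p.η κ ^ p.N κ * (p.N κ).factorial = (p.N κ : ℝ) ^ p.N κ := by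
  have hN := (p.N_cast_pos κ).ne'
  have hfactorial : (0 : ℝ) < (p.N κ).factorial := by positivity
  rw [η, mul_pow, ← Real.rpow_mul_natCast hfactorial.le, div_mul_cancel₀ _ hN, Real.rpow_neg_one,
    mul_assoc, inv_mul_cancel₀ hfactorial.ne', mul_one]

theorem alzer_le_fadingLaw_Iic (κ : Link) (hx : 0 ≤ x) :
    p.alzer κ x ≤ (p.fadingLaw κ).real (Set.Iic x) := by
  have hη := p.η_pow_mul_factorial κ
  obtain ⟨m, hm⟩ := Nat.exists_eq_add_of_le' (p.N_pos κ)
  rw [alzer, fadingLaw]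
  rw [hm] at hη ⊢
  push_cast at hη ⊢
  rw [gammaMeasure_real_Iic m hx]
  exact one_sub_exp_pow_le_integral_erlangDensity (η_pos κ) hη hx

lemma fadingLaw_Iic_eq_alzer (hN : p.N κ = 1) (hx : 0 ≤ x) :
    (p.fadingLaw κ).real (Set.Iic x) = p.alzer κ x := by
  have hexponential : erlangDensity 0 = fun t => Real.exp (-t) := by ext t; simp [erlangDensity]
  have hcdf := gammaMeasure_real_Iic 0 hx
  rw [hexponential, intervalIntegral.integral_comp_neg] at hcdf
  simp only [Nat.cast_zero, zero_add, neg_zero, integral_exp, Real.exp_zero] at hcdf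
  simpa [fadingLaw, alzer, η, hN] using hcdf

lemma measurable_fadingLaw_Ioi (p : Params) (κ : Link) :
    Measurable fun t => p.fadingLaw κ (Set.Ioi t) :=
  Antitone.measurable fun _ _ h => measure_mono (Set.Ioi_subset_Ioi h)

end Fading

section Threshold

variable {Ω : Type*} {p : Params} {v : ℕ → Ω → Plane} {mark : ℕ → Ω → Mark} {Υ : ℝ} {ω : Ω}

/-- The fading power gain that a serving link of state `κ` and horizontal distance `r` needs for
coverage against the interference `I`. -/
def threshold (p : Params) (Υ : ℝ) (κ : Link) (r : ℝ) (I : ℝ≥0∞) : ℝ :=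
  Υ * (I.toReal + p.noise / p.Pv) / (p.pathLoss κ r * p.gain 0)

lemma measurable_threshold {α : Type*} [MeasurableSpace α] (p : Params) (Υ : ℝ) (κ : Link)
    {r : α → ℝ} {I : α → ℝ≥0∞} (hr : Measurable r) (hI : Measurable I) :
    Measurable fun a => p.threshold Υ κ (r a) (I a) :=
  ((hI.ennreal_toReal.add_const _).const_mul Υ).div (((measurable_pathLoss κ).comp hr).mul_const _)

lemma pathLoss_pos (κ : Link) {r : ℝ} (hr : 0 < r) : 0 < p.pathLoss κ r := by
  have hC := p.C_pos κ
  unfold pathLoss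
  positivity

lemma required_nonneg (hΥ : 0 < Υ) (ω : Ω) : 0 ≤ p.required v mark Υ ω := by
  have hnoise := p.noise_pos
  have hPv := p.Pv_pos
  have hgain := p.gain_zero_pos
  have hloss := pathLoss_nonneg (p := p) (p.state (v 0 ω) (mark 0 ω)) ‖v 0 ω‖
  unfold required
  positivity

lemma lt_sinr_iff (hΥ : 0 < Υ) (hI : p.interference v mark ω < ∞) (hr : 0 < ‖v 0 ω‖) :
    ENNReal.ofReal Υ < p.sinr v mark ω ↔
      p.required v mark Υ ω < (mark 0 ω).fading (p.state (v 0 ω) (mark 0 ω)) := by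
  have hnoise : 0 < p.noise / p.Pv := div_pos p.noise_pos p.Pv_pos
  have hloss : 0 < p.pathLoss (p.state (v 0 ω) (mark 0 ω)) ‖v 0 ω‖ * p.gain 0 :=
    mul_pos (pathLoss_pos _ hr) p.gain_zero_pos
  have hdenominator : 0 < (p.interference v mark ω).toReal + p.noise / p.Pv := by positivity
  rw [sinr, desiredGain, required]
  conv_lhs => rw [← ENNReal.ofReal_toReal hI.ne]
  rw [← ENNReal.ofReal_add ENNReal.toReal_nonneg hnoise.le,
    ← ENNReal.ofReal_div_of_pos hdenominator, ENNReal.ofReal_lt_ofReal_iff_of_nonneg hΥ.le,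
    lt_div_iff₀ hdenominator, div_lt_iff₀' hloss]

lemma alzerTail_sub_fadingLaw_Ioi (p : Params) (v : ℕ → Ω → Plane) (mark : ℕ → Ω → Mark) (Υ : ℝ)
    (ω : Ω) :
    p.alzerTail v mark Υ ω
        - (p.fadingLaw (p.state (v 0 ω) (mark 0 ω))).real (Set.Ioi (p.required v mark Υ ω))
      = (p.fadingLaw (p.state (v 0 ω) (mark 0 ω))).real (Set.Iic (p.required v mark Υ ω))
        - p.alzer (p.state (v 0 ω) (mark 0 ω)) (p.required v mark Υ ω) := by
  rw [← Set.compl_Iic, probReal_compl_eq_one_sub measurableSet_Iic, alzerTail]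
  ring

end Threshold

end Params

lemma IsPPP.ae_forall_notMem {Ω : Type*} [MeasurableSpace Ω] {P : Measure Ω}
    [IsProbabilityMeasure P] {v : ℕ → Ω → Plane} {lam : ℝ} (h : IsPPP P v lam) {A : Set Plane}
    (hA : MeasurableSet A) (hvol : volume A = 0) : ∀ᵐ ω ∂P, ∀ n, v n ω ∉ A := by
  have hmeas : MeasurableSet {ω | {n | v n ω ∈ A}.encard = (0 : ℕ)} :=
    measurable_encard h.measurable hA (measurableSet_singleton _)
  have hempty : P {ω | {n | v n ω ∈ A}.encard = (0 : ℕ)} = 1 := by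
    rw [h.poisson A hA (by simp [hvol]) 0]
    simp [Measure.real, hvol]
  filter_upwards [(mem_ae_iff_prob_eq_one hmeas).2 hempty] with ω hω n
  exact Set.eq_empty_iff_forall_notMem.1 (Set.encard_eq_zero.1 hω) n

namespace IsNetwork

variable {Ω : Type*} [MeasurableSpace Ω] {P : Measure Ω} {p : Params} {v : ℕ → Ω → Plane}
  {mark : ℕ → Ω → Mark} {Υ : ℝ}

lemma measurable_comp_state {β : Type*} [MeasurableSpace β] (hnet : IsNetwork P p v mark)
    {g : Link → Ω → β} (hg : ∀ κ, Measurable (g κ)) :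
    Measurable fun ω => g (p.state (v 0 ω) (mark 0 ω)) ω :=
  Params.measurable_of_state (f := fun ω => (v 0 ω, mark 0 ω)) hg
    ((hnet.ppp.measurable 0).prodMk (hnet.mark_measurable 0))

lemma measurable_threshold (hnet : IsNetwork P p v mark) (Υ : ℝ) (κ : Link) :
    Measurable fun ω => p.threshold Υ κ ‖v 0 ω‖ (p.interference v mark ω) :=
  p.measurable_threshold Υ κ hnet.measurable_nearest hnet.measurable_interference

lemma measurable_required (hnet : IsNetwork P p v mark) (Υ : ℝ) :
    Measurable (p.required v mark Υ) :=
  hnet.measurable_comp_state (hnet.measurable_threshold Υ)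

lemma measurable_serving_fading (hnet : IsNetwork P p v mark) :
    Measurable fun ω => (mark 0 ω).fading (p.state (v 0 ω) (mark 0 ω)) :=
  hnet.measurable_comp_state fun κ => (Mark.measurable_fading κ).comp (hnet.mark_measurable 0)

lemma measurable_fadingLaw_required (hnet : IsNetwork P p v mark) (Υ : ℝ) :
    Measurable fun ω =>
      p.fadingLaw (p.state (v 0 ω) (mark 0 ω)) (Set.Ioi (p.required v mark Υ ω)) :=
  hnet.measurable_comp_state
    (g := fun κ ω => p.fadingLaw κ (Set.Ioi (p.threshold Υ κ ‖v 0 ω‖ (p.interference v mark ω))))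
    fun κ => (p.measurable_fadingLaw_Ioi κ).comp (hnet.measurable_threshold Υ κ)

variable [IsProbabilityMeasure P]

lemma ae_norm_nearest_pos (hnet : IsNetwork P p v mark) : ∀ᵐ ω ∂P, 0 < ‖v 0 ω‖ := by
  filter_upwards [hnet.ppp.ae_forall_notMem (measurableSet_singleton 0) (measure_singleton 0)]
    with ω hω using norm_pos_iff.2 (hω 0)

lemma lintegral_serving_fading (hnet : IsNetwork P p v mark) {h : Link → ℝ × ℝ≥0∞ → ℝ → ℝ≥0∞}
    (hh : ∀ κ, Measurable (Function.uncurry (h κ))) :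
    ∫⁻ ω, h (p.state (v 0 ω) (mark 0 ω)) (‖v 0 ω‖, p.interference v mark ω)
        ((mark 0 ω).fading (p.state (v 0 ω) (mark 0 ω))) ∂P
      = ∫⁻ ω, ∫⁻ y, h (p.state (v 0 ω) (mark 0 ω)) (‖v 0 ω‖, p.interference v mark ω) y
          ∂p.fadingLaw (p.state (v 0 ω) (mark 0 ω)) ∂P := by
  have hserving : Measurable fun w : (ℕ → Plane) × Mark × (ℕ → Mark) => (w.1 0, w.2.1) := by
    fun_prop
  have hlink : Measurable fun w : (ℕ → Plane) × Mark × (ℕ → Mark) =>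
      (‖w.1 0‖, p.tailInterference w.1 w.2.2) :=
    Measurable.prodMk (by fun_prop) (Params.measurable_tailInterference (by fun_prop) (by fun_prop))
  have hfading (κ : Link) : Measurable fun w : (ℕ → Plane) × Mark × (ℕ → Mark) =>
      h κ (‖w.1 0‖, p.tailInterference w.1 w.2.2) (w.2.1.fading κ) :=
    (hh κ).comp (hlink.prodMk ((Mark.measurable_fading κ).comp (by fun_prop)))
  have hmean (κ : Link) : Measurable fun w : (ℕ → Plane) × Mark × (ℕ → Mark) =>
      ∫⁻ y, h κ (‖w.1 0‖, p.tailInterference w.1 w.2.2) y ∂p.fadingLaw κ :=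
    (hh κ).lintegral_prod_right'.comp hlink
  refine (hnet.lintegral_mark_zero (Params.measurable_of_state hfading hserving)).trans
    (Eq.trans (lintegral_congr fun ω => ?_)
      (hnet.lintegral_mark_zero (Params.measurable_of_state hmean hserving)).symm)
  set W := (‖v 0 ω‖, p.tailInterference (fun n => v n ω) fun n => mark (n + 1) ω)
  refine (p.lintegral_markLaw (v 0 ω) (g := fun κ _ => h κ W) fun κ _ =>
    (hh κ).comp measurable_prodMk_left).trans (Eq.trans ?_ (p.lintegral_markLaw (v 0 ω)
      (g := fun κ _ _ => ∫⁻ y, h κ W y ∂p.fadingLaw κ) fun _ _ => measurable_const).symm)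
  simp only [lintegral_const, measure_univ, mul_one]

lemma measure_required_lt_fading (hnet : IsNetwork P p v mark) (Υ : ℝ) :
    P {ω | p.required v mark Υ ω < (mark 0 ω).fading (p.state (v 0 ω) (mark 0 ω))}
      = ∫⁻ ω, p.fadingLaw (p.state (v 0 ω) (mark 0 ω)) (Set.Ioi (p.required v mark Υ ω)) ∂P := by
  have hmeas (κ : Link) : Measurable (Function.uncurry fun (w : ℝ × ℝ≥0∞) (y : ℝ) =>
      (Set.Ioi (p.threshold Υ κ w.1 w.2)).indicator (1 : ℝ → ℝ≥0∞) y) :=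
    measurable_one.indicator (measurableSet_lt
      (p.measurable_threshold Υ κ (measurable_fst.comp measurable_fst)
        (measurable_snd.comp measurable_fst)) measurable_snd)
  rw [← lintegral_indicator_one (measurableSet_lt (hnet.measurable_required Υ)
    hnet.measurable_serving_fading)]
  refine (hnet.lintegral_serving_fading hmeas).trans (lintegral_congr fun ω => ?_)
  exact lintegral_indicator_one measurableSet_Ioi

lemma integrable_fadingLaw_required (hnet : IsNetwork P p v mark) (Υ : ℝ) :
    Integrable (fun ω => (p.fadingLaw (p.state (v 0 ω) (mark 0 ω))).real
      (Set.Ioi (p.required v mark Υ ω))) P := by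
  refine integrable_toReal_of_lintegral_ne_top
    (hnet.measurable_fadingLaw_required Υ).aemeasurable ?_
  rw [← hnet.measure_required_lt_fading]
  exact measure_ne_top _ _

theorem coverage_eq_integral_fadingLaw (hnet : IsNetwork P p v mark) (hΥ : 0 < Υ) :
    p.coverage v mark P Υ = ∫ ω, (p.fadingLaw (p.state (v 0 ω) (mark 0 ω))).real
      (Set.Ioi (p.required v mark Υ ω)) ∂P := by
  have hcovered : {ω | ENNReal.ofReal Υ < p.sinr v mark ω} =ᵐ[P]
      {ω | p.required v mark Υ ω < (mark 0 ω).fading (p.state (v 0 ω) (mark 0 ω))} := by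
    filter_upwards [hnet.ae_interference_lt_top, hnet.ae_norm_nearest_pos] with ω hI hr
    exact propext (Params.lt_sinr_iff hΥ hI hr)
  rw [Params.coverage, Measure.real, measure_congr hcovered, hnet.measure_required_lt_fading]
  exact (integral_toReal (hnet.measurable_fadingLaw_required Υ).aemeasurable
    (Eventually.of_forall fun ω => measure_lt_top _ _)).symm

theorem coverage_le_alzerCoverage (hnet : IsNetwork P p v mark) (hΥ : 0 < Υ) :
    p.coverage v mark P Υ ≤ p.alzerCoverage v mark P Υ := by
  rw [hnet.coverage_eq_integral_fadingLaw hΥ, Params.alzerCoverage]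
  refine integral_mono (hnet.integrable_fadingLaw_required Υ) (hnet.integrable_alzerTail hΥ)
    fun ω => sub_nonneg.1 ?_
  rw [Params.alzerTail_sub_fadingLaw_Ioi]
  exact sub_nonneg.2 (Params.alzer_le_fadingLaw_Iic _ (Params.required_nonneg hΥ ω))

theorem abs_coverage_sub_alzerCoverage_le (hnet : IsNetwork P p v mark) (hΥ : 0 < Υ) {δ : ℝ}
    (hδ : ∀ (κ : Link) (x : ℝ), 0 ≤ x →
      |(p.fadingLaw κ).real (Set.Iic x) - p.alzer κ x| ≤ δ) :
    |p.coverage v mark P Υ - p.alzerCoverage v mark P Υ| ≤ δ := by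
  rw [abs_sub_comm, hnet.coverage_eq_integral_fadingLaw hΥ, Params.alzerCoverage,
    ← integral_sub (hnet.integrable_alzerTail hΥ) (hnet.integrable_fadingLaw_required Υ)]
  have hpointwise (ω : Ω) : ‖p.alzerTail v mark Υ ω
      - (p.fadingLaw (p.state (v 0 ω) (mark 0 ω))).real (Set.Ioi (p.required v mark Υ ω))‖ ≤ δ := by
    rw [Params.alzerTail_sub_fadingLaw_Ioi]
    exact hδ _ _ (Params.required_nonneg hΥ ω)
  simpa only [probReal_univ, mul_one, Real.norm_eq_abs]
    using norm_integral_le_of_norm_le_const (μ := P) (Eventually.of_forall hpointwise)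

theorem coverage_eq_alzerCoverage (hnet : IsNetwork P p v mark) (hΥ : 0 < Υ)
    (hN : ∀ κ, p.N κ = 1) : p.coverage v mark P Υ = p.alzerCoverage v mark P Υ := by
  have hdistance := hnet.abs_coverage_sub_alzerCoverage_le hΥ (δ := 0) fun κ x hx => by
    rw [Params.fadingLaw_Iic_eq_alzer (hN κ) hx, sub_self, abs_zero]
  exact sub_eq_zero.1 (abs_nonpos_iff.1 hdistance)

end IsNetwork

end UAV

end

theorem theorem1 {Ω : Type*} [MeasurableSpace Ω] (P : Measure Ω) [IsProbabilityMeasure P]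
    (p : UAV.Params) (v : ℕ → Ω → UAV.Plane) (mark : ℕ → Ω → UAV.Mark)
    (hnet : UAV.IsNetwork P p v mark) (Υ : ℝ) (hΥ : 0 < Υ) :
    -- the interference and all the series in the closed form are finite
    (∀ᵐ ω ∂P, p.interference v mark ω < ∞) ∧
    (∀ (κ : UAV.Link) (s : ℝ) (i : Fin 4), 0 ≤ s → Summable (p.ringTerm κ s i)) ∧
    (∀ ζ ∈ Set.Ioo (-1 : ℝ) 1, Summable (p.levelTerm Υ ζ)) ∧
    -- as `m → ∞` the quadrature sum attains the coverage probability taken with Alzer's expression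
    Integrable (p.alzerTail v mark Υ) P ∧
    Tendsto (p.quadrature Υ) atTop (𝓝 (p.alzerCoverage v mark P Υ)) ∧
    -- this limit is an upper bound, and its error is at most that of Alzer's expression
    p.coverage v mark P Υ ≤ p.alzerCoverage v mark P Υ ∧
    (∀ δ : ℝ, (∀ (κ : UAV.Link) (x : ℝ), 0 ≤ x →
        |(p.fadingLaw κ).real (Set.Iic x) - p.alzer κ x| ≤ δ) →
      |p.coverage v mark P Υ - p.alzerCoverage v mark P Υ| ≤ δ) ∧
    -- for Rayleigh fading there is no error
    ((∀ κ, p.N κ = 1) →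
      Tendsto (p.quadrature Υ) atTop (𝓝 (p.coverage v mark P Υ))) := by
  have hquad := hnet.alzerCoverage_eq_integral_coverDensity hΥ ▸
    UAV.Params.tendsto_quadrature (p := p) hΥ
  exact ⟨hnet.ae_interference_lt_top, fun κ _ i hs => UAV.Params.summable_ringTerm κ hs i,
    fun _ hζ => UAV.Params.summable_levelTerm hΥ hζ, hnet.integrable_alzerTail hΥ, hquad,
    hnet.coverage_le_alzerCoverage hΥ,
    fun _ hδ => hnet.abs_coverage_sub_alzerCoverage_le hΥ hδ,
    fun hN => hnet.coverage_eq_alzerCoverage hΥ hN ▸ hquad⟩
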